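/- Let $\alpha>0$ and let $d\ge 3$ be a fixed integer. Let $A$ be a uniformly random simple $d$-regular graph on $[n]=\{1,\dots,n\}$ (for those $n$ for which such graphs exist), identified with its adjacency matrix. Let $W=(W_{ij})_{i,j\in[n]}$ be a random real symmetric matrix independent of $A$ whose entries $\{W_{ij}\}_{1\le i<j\le n}$ are i.i.d. with a common law of Weibull type with shape parameter $\alpha$: for some constants $C_1,C_2>0$ and all $t\ge 1$, $$\tfrac{C_1}{2}e^{-t^\alpha}\le \mathbb P(W_{ij}\ge t)\le \tfrac{C_2}{2}e^{-t^\alpha},\qquad \tfrac{C_1}{2}e^{-t^\alpha}\le \mathbb P(W_{ij}\le -t)\le \tfrac{C_2}{2}e^{-t^\alpha}.$$ Let $X=A\odot W$, i.e. $X_{ij}=A_{ij}W_{ij}$. A top eigenvector of $X$ is a (nonzero, real) eigenvector $\mathbf f=(f_i)_{i\in[n]}$ for the largest eigenvalue of $X$. 1. For every $\varepsilon>0$ and all sufficiently large $n$ (depending only on $\alpha,\varepsilon,d,C_1,C_2$), with probability at least $1-e^{-(\log n)^{1/2}}$, for every top eigenvector $\mathbf f$ of $X$ there exists a subset $\mathcal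 I\subseteq[n]$ with $|\mathcal I|\le n^{\varepsilon}$ such that $$\Big(\sum_{i\in\mathcal I}|f_i|^2\Big)^{1/2}\ge(1-\varepsilon)\|\mathbf f\|_2.\qquad(*)$$ 2. If $0<\alpha<2$, then there is a constant $\zeta_\alpha\in(0,1)$, depending only on $\alpha$, such that for every $\varepsilon>0$ and all sufficiently large $n$ (depending only on $\alpha,\varepsilon,d,C_1,C_2$), with probability at least $1-e^{-(\log n)^{1/2}}$, for every top eigenvector $\mathbf f$ of $X$ there exists a collection $\mathcal J$ of at most $e^{\varepsilon(\log n)^{\zeta_\alpha}}$ pairwise vertex-disjoint edges of $A$ such that $(*)$ holds with $\mathcal I=\{v\in[n]: v\text{ is a vertex of some edge in }\mathcal J\}$. -/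

import Mathlib

open MeasureTheory ProbabilityTheory
open scoped Matrix

/-- The set of (simple) `d`-regular graphs with vertex set `Fin n`. -/
def regularGraphs (n d : ℕ) : Set (SimpleGraph (Fin n)) :=
  open Classical in {G | G.IsRegularOfDegree d}

/-- `ν` is the law of a Weibull random variable with shape parameter `α`, with the constants
`C₁, C₂` in the two-sided tail bounds. -/
structure IsWeibull (α C₁ C₂ : ℝ) (ν : Measure ℝ) : Prop where
  isProbabilityMeasure : IsProbabilityMeasure ν
  upper_tail : ∀ t : ℝ, 1 ≤ t →
    C₁ * Real.exp (-t ^ α) / 2 ≤ ν.real (Set.Ici t) ∧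
      ν.real (Set.Ici t) ≤ C₂ * Real.exp (-t ^ α) / 2
  lower_tail : ∀ t : ℝ, 1 ≤ t →
    C₁ * Real.exp (-t ^ α) / 2 ≤ ν.real (Set.Iic (-t)) ∧
      ν.real (Set.Iic (-t)) ≤ C₂ * Real.exp (-t ^ α) / 2

/-- The index set `{(i, j) : i < j}` of the independent entries of a symmetric matrix. -/
abbrev UpperPairs (n : ℕ) : Type := {e : Fin n × Fin n // e.1 < e.2}

/-- `A` is a uniformly random `d`-regular graph on `Fin n`, and `W` is an independent random symmetric
matrix whose entries above the diagonal are i.i.d. with law `ν`. -/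
structure IsWeightedRandomRegularGraph {Ω : Type*} [MeasurableSpace Ω] (P : Measure Ω)
    {n : ℕ} (d : ℕ) (ν : Measure ℝ) (A : Ω → SimpleGraph (Fin n))
    (W : Ω → Matrix (Fin n) (Fin n) ℝ) : Prop where
  graph_law : HasLaw A (uniformOn (regularGraphs n d)) P
  weights_symm : ∀ ω, (W ω).IsSymm
  weights_law : ∀ e : UpperPairs n, HasLaw (fun ω => W ω e.1.1 e.1.2) ν P
  weights_indep : iIndepFun (fun (e : UpperPairs n) (ω : Ω) => W ω e.1.1 e.1.2) P
  graph_weights_indep : IndepFun A (fun (ω : Ω) (e : UpperPairs n) => W ω e.1.1 e.1.2) P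

/-- The Hadamard product of the adjacency matrix of `G` and the matrix `w`. -/
noncomputable def weightedAdjMatrix {n : ℕ} (G : SimpleGraph (Fin n))
    (w : Matrix (Fin n) (Fin n) ℝ) : Matrix (Fin n) (Fin n) ℝ :=
  open Classical in (G.adjMatrix ℝ) ⊙ w

/-- `f` is an eigenvector (in particular `f ≠ 0`) of `M` for the largest eigenvalue of `M`. -/
def IsTopEigenvector {n : ℕ} (M : Matrix (Fin n) (Fin n) ℝ) (f : Fin n → ℝ) : Prop :=
  ∃ l : ℝ, Module.End.HasEigenvector (Matrix.toLin' M) l f ∧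
    ∀ m : ℝ, Module.End.HasEigenvalue (Matrix.toLin' M) m → m ≤ l

/-- The set `I` carries at least a `1 - ε` fraction of the `ℓ²`-norm of `f`. -/
def IsLocalizedOn {n : ℕ} (ε : ℝ) (f : Fin n → ℝ) (I : Finset (Fin n)) : Prop :=
  (1 - ε) * Real.sqrt (∑ i, |f i| ^ 2) ≤ Real.sqrt (∑ i ∈ I, |f i| ^ 2)

/-- `J` is a collection of pairwise vertex-disjoint edges of `G`. -/
def IsVertexDisjointEdges {n : ℕ} (G : SimpleGraph (Fin n)) (J : Finset (Sym2 (Fin n))) : Prop :=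
  (∀ e ∈ J, e ∈ G.edgeSet) ∧
    ∀ e ∈ J, ∀ e' ∈ J, e ≠ e' → ∀ v : Fin n, v ∈ e → v ∉ e'

/-- The set of all vertices of the edges in `J`. -/
noncomputable def edgeVertices {n : ℕ} (J : Finset (Sym2 (Fin n))) : Finset (Fin n) :=
  open Classical in Finset.univ.filter (fun v => ∃ e ∈ J, v ∈ e)

/-!
Write `L = log n`. Fix a regular graph `G` and let the weights be random. Call `∑ |w| ^ α` over a
set of edges its mass. Since `|w| ^ α` has exponential tails of rate `1`, Chernoff's bound
(`IsWeibull.measure_sum_trunc_ge_le`) shows that the weights above a truncation level `τ` in a ball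
of bounded or slowly growing radius have mass at least `x` with probability about `exp (-x)`.
Taking `τ` a small multiple of `L ^ (1 / α)`, the weights below `τ` form a matrix of norm at most
`d τ`, which is negligible, and the components of the graph of weights above `τ` lie in small
balls, as a long path of large weights would have too much mass (`mem_gball_of_reachable`). An
eigenvector for the eigenvalue `l` then has little mass on the components whose own top eigenvalue
is smaller than `l` by a definite amount (`l2norm_restr_le_of_gap`). It remains to see that few
components are left.

*Few vertices.* Let `Λ v` be the largest top eigenvalue that unit mass can produce in the ball
around `v` (`localConst`). By homogeneity, the ball produces the eigenvalue `u ^ (1 / α)` only with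
mass `u (Λ v) ^ (-α)`. At the critical level `u`, where `∑ v, exp (-u (Λ v) ^ (-α))` is a small
power of `n` (`exists_critical_level`), the second moment method gives a ball that does produce
nearly `u ^ (1 / α)` (`measureReal_forall_not_mem_upperBox_le`), while by the first moment method
only few balls have nearly enough mass to do so. The values `Λ v` depend on `G` and are never
computed: every regular graph is good (`exists_localized_of_regular`).

*Few edges, for `α < 2`.* Some edge has mass nearly `L`, and no ball has mass much larger than `L`.
A component that is a tree is bipartite, so its norm is at most `(∑ w ^ 2) ^ (1 / 2)`, which is at
most `(m ^ ((2 - α) / α) ∑ |w| ^ α) ^ (1 / 2)` if no single edge has mass above `m`. So for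
`m = (1 - κ) L` such a component cannot reach the top eigenvalue, by a relative margin of order `κ`
(`sqrt_tree_le`). This leaves the components with an edge of mass at least `(1 - κ) L`, of which
there are about `exp (κ L)`; all their other edges are small, so that the eigenvector lives on the
heavy edges (`l2norm_restr_compl_heavyEdges_le`). With `κ` of order `L ^ (-1 / 8)`, the number of
these edges is at most `exp (ε L ^ (7 / 8))`. Components which contain a cycle are near a short
cycle of `G`. In a random regular graph the vertices near short cycles are few, by a switching
argument (`sum_card_shortCycleVerts_le`), too few to see a mass of order `L`.

Both parts hold for all, or for most, regular graphs `G`, and `exists_event_of_forall_graph`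
transfers them to a random graph independent of the weights.
-/

/-! ### Quadratic forms and eigenvectors -/

/-- The bilinear form `(f, g) ↦ ∑ i, ∑ j, f i * M i j * g j` of the matrix `M`. -/
def bilin {V : Type*} [Fintype V] (M : V → V → ℝ) (f g : V → ℝ) : ℝ :=
  ∑ i, ∑ j, f i * M i j * g j

/-- The Euclidean norm of a vector. Plain functions carry the supremum norm in Mathlib, hence the
explicit definition. -/
noncomputable def l2norm {V : Type*} [Fintype V] (f : V → ℝ) : ℝ := Real.sqrt (∑ i, f i ^ 2)

/-- The restriction of a vector to a set of coordinates, extended by zero. -/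
noncomputable def restr {V : Type*} (s : Set V) (f : V → ℝ) : V → ℝ := s.indicator f

lemma restr_apply_mem {V : Type*} {s : Set V} {f : V → ℝ} {i : V} (h : i ∈ s) : restr s f i = f i := by
  simp [restr, h]

lemma restr_apply_not_mem {V : Type*} {s : Set V} {f : V → ℝ} {i : V} (h : i ∉ s) : restr s f i = 0 := by
  simp [restr, h]

section LinearAlgebra

variable {V : Type*} [Fintype V]

lemma l2norm_nonneg (f : V → ℝ) : 0 ≤ l2norm f := Real.sqrt_nonneg _

lemma l2norm_sq (f : V → ℝ) : l2norm f ^ 2 = ∑ i, f i ^ 2 :=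
  Real.sq_sqrt (Finset.sum_nonneg fun _ _ => sq_nonneg _)

lemma bilin_prod (M : V → V → ℝ) (f g : V → ℝ) :
    bilin M f g = ∑ p : V × V, f p.1 * M p.1 p.2 * g p.2 := by
  rw [bilin, Fintype.sum_prod_type]

lemma bilin_add_left (M : V → V → ℝ) (N : V → V → ℝ) (f g : V → ℝ) :
    bilin (fun i j => M i j + N i j) f g = bilin M f g + bilin N f g := by
  simp only [bilin, ← Finset.sum_add_distrib]
  exact Finset.sum_congr rfl fun i _ => Finset.sum_congr rfl fun j _ => by ring

/-- Schur's test: a matrix with at most `d` nonzero entries, all of size at most `τ`, in each row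
and column has operator norm at most `d * τ`. -/
lemma bilin_le_of_abs_le (M : V → V → ℝ) (a : V → V → ℝ) (τ d : ℝ) (hτ : 0 ≤ τ) (hd : 0 ≤ d)
    (ha : ∀ i j, a i j = 0 ∨ a i j = 1) (hrow : ∀ i, ∑ j, a i j ≤ d)
    (hcol : ∀ j, ∑ i, a i j ≤ d)
    (hM : ∀ i j, |M i j| ≤ τ * a i j) (f g : V → ℝ) :
    bilin M f g ≤ d * τ * (l2norm f * l2norm g) := by
  have ha0 : ∀ i j, 0 ≤ a i j := fun i j => by rcases ha i j with h | h <;> simp [h]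
  have ha2 : ∀ i j, a i j ^ 2 = a i j := fun i j => by rcases ha i j with h | h <;> simp [h]
  have h1 : bilin M f g ≤ τ * ∑ p : V × V, (a p.1 p.2 * |f p.1|) * (a p.1 p.2 * |g p.2|) := by
    rw [bilin_prod, Finset.mul_sum]
    refine Finset.sum_le_sum fun p _ => ?_
    calc f p.1 * M p.1 p.2 * g p.2 ≤ |f p.1 * M p.1 p.2 * g p.2| := le_abs_self _
      _ = |f p.1| * |g p.2| * |M p.1 p.2| := by rw [abs_mul, abs_mul]; ring
      _ ≤ |f p.1| * |g p.2| * (τ * a p.1 p.2) :=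
        mul_le_mul_of_nonneg_left (hM _ _) (by positivity)
      _ = |f p.1| * |g p.2| * (τ * a p.1 p.2 ^ 2) := by rw [ha2]
      _ = _ := by ring
  have h2 := Finset.sum_mul_sq_le_sq_mul_sq (Finset.univ : Finset (V × V))
    (fun p => a p.1 p.2 * |f p.1|) (fun p => a p.1 p.2 * |g p.2|)
  have h3 : ∑ p : V × V, (a p.1 p.2 * |f p.1|) ^ 2 ≤ d * l2norm f ^ 2 := by
    rw [Fintype.sum_prod_type, l2norm_sq, Finset.mul_sum]
    refine Finset.sum_le_sum fun i _ => ?_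
    simp only [mul_pow, sq_abs, ha2]
    rw [← Finset.sum_mul]
    exact mul_le_mul_of_nonneg_right (hrow i) (sq_nonneg _)
  have h4 : ∑ p : V × V, (a p.1 p.2 * |g p.2|) ^ 2 ≤ d * l2norm g ^ 2 := by
    rw [Fintype.sum_prod_type, Finset.sum_comm, l2norm_sq, Finset.mul_sum]
    refine Finset.sum_le_sum fun i _ => ?_
    simp only [mul_pow, sq_abs, ha2]
    rw [← Finset.sum_mul]
    exact mul_le_mul_of_nonneg_right (hcol i) (sq_nonneg _)
  have h5 : ∑ p : V × V, (a p.1 p.2 * |f p.1|) * (a p.1 p.2 * |g p.2|)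
      ≤ d * (l2norm f * l2norm g) := by
    refine abs_le_of_sq_le_sq' ?_ ?_ |>.2
    · refine h2.trans ?_
      calc _ ≤ (d * l2norm f ^ 2) * (d * l2norm g ^ 2) := by
            refine mul_le_mul h3 h4 (Finset.sum_nonneg fun _ _ => sq_nonneg _) (by positivity)
        _ = _ := by ring
    · exact mul_nonneg hd (mul_nonneg (l2norm_nonneg _) (l2norm_nonneg _))
  calc _ ≤ _ := h1
    _ ≤ τ * (d * (l2norm f * l2norm g)) := mul_le_mul_of_nonneg_left h5 hτ
    _ = _ := by ring

/-- The operator norm is at most the Frobenius norm. -/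
lemma bilin_le_frobenius (M : V → V → ℝ) (f g : V → ℝ) :
    bilin M f g ≤ Real.sqrt (∑ i, ∑ j, M i j ^ 2) * (l2norm f * l2norm g) := by
  have h2 := Finset.sum_mul_sq_le_sq_mul_sq (Finset.univ : Finset (V × V))
    (fun p => M p.1 p.2) (fun p => f p.1 * g p.2)
  have h3 : ∑ p : V × V, (f p.1 * g p.2) ^ 2 = l2norm f ^ 2 * l2norm g ^ 2 := by
    rw [Fintype.sum_prod_type, l2norm_sq, l2norm_sq, Finset.sum_mul_sum]
    simp only [mul_pow]
  have h0 : 0 ≤ ∑ i, ∑ j, M i j ^ 2 :=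
    Finset.sum_nonneg fun _ _ => Finset.sum_nonneg fun _ _ => sq_nonneg _
  rw [bilin_prod]
  refine abs_le_of_sq_le_sq' ?_ ?_ |>.2
  · rw [h3, Fintype.sum_prod_type (fun p : V × V => M p.1 p.2 ^ 2)] at h2
    rw [mul_pow, Real.sq_sqrt h0, mul_pow]
    refine le_trans (le_of_eq ?_) h2
    congr 1
    exact Finset.sum_congr rfl fun p _ => by ring
  · exact mul_nonneg (Real.sqrt_nonneg _) (mul_nonneg (l2norm_nonneg _) (l2norm_nonneg _))

/-- For a weighted bipartite graph, the Frobenius bound on the quadratic form improves by a factor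
`√2`. -/
lemma bilin_le_of_bipartite (M : V → V → ℝ) (φ : V → Bool) (f : V → ℝ)
    (hφ : ∀ i j, f i ≠ 0 → f j ≠ 0 → M i j ≠ 0 → φ i ≠ φ j) (S : ℝ)
    (hS : ∑ i, ∑ j, M i j ^ 2 ≤ 2 * S) :
    bilin M f f ≤ Real.sqrt S * l2norm f ^ 2 := by
  classical
  have h0 : 0 ≤ ∑ i, ∑ j, M i j ^ 2 :=
    Finset.sum_nonneg fun _ _ => Finset.sum_nonneg fun _ _ => sq_nonneg _
  have hS0 : 0 ≤ S := by linarith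
  have h2 := Finset.sum_mul_sq_le_sq_mul_sq (Finset.univ : Finset (V × V))
    (fun p => M p.1 p.2) (fun p => if φ p.1 ≠ φ p.2 then f p.1 * f p.2 else 0)
  set A := ∑ i, if φ i then f i ^ 2 else 0 with hA
  set B := ∑ i, if φ i then 0 else f i ^ 2 with hB
  have hAB : A + B = l2norm f ^ 2 := by
    rw [l2norm_sq, hA, hB, ← Finset.sum_add_distrib]
    exact Finset.sum_congr rfl fun i _ => by split_ifs <;> simp
  have h3 : ∑ p : V × V, (if φ p.1 ≠ φ p.2 then f p.1 * f p.2 else 0) ^ 2 = 2 * (A * B) := by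
    have : (2 : ℝ) * (A * B) = A * B + B * A := by ring
    rw [this, hA, hB, Finset.sum_mul_sum, Finset.sum_mul_sum, ← Finset.sum_add_distrib,
      Fintype.sum_prod_type]
    refine Finset.sum_congr rfl fun i _ => ?_
    rw [← Finset.sum_add_distrib]
    refine Finset.sum_congr rfl fun j _ => ?_
    cases φ i <;> cases φ j <;> simp [mul_pow]
  rw [bilin_prod]
  refine abs_le_of_sq_le_sq' ?_ ?_ |>.2
  · rw [h3, Fintype.sum_prod_type (fun p : V × V => M p.1 p.2 ^ 2)] at h2
    rw [mul_pow, Real.sq_sqrt hS0]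
    have e : ∑ p : V × V, f p.1 * M p.1 p.2 * f p.2
        = ∑ p : V × V, M p.1 p.2 * (if φ p.1 ≠ φ p.2 then f p.1 * f p.2 else 0) := by
      refine Finset.sum_congr rfl fun p _ => ?_
      by_cases h : φ p.1 ≠ φ p.2
      · rw [if_pos h]; ring
      · rw [if_neg h]
        by_cases h1 : f p.1 = 0
        · simp [h1]
        by_cases h2 : f p.2 = 0
        · simp [h2]
        by_cases h3 : M p.1 p.2 = 0
        · simp [h3]
        exact absurd (hφ _ _ h1 h2 h3) h
    rw [e]
    refine h2.trans ?_
    have hA0 : 0 ≤ A := Finset.sum_nonneg fun i _ => by split_ifs <;> positivity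
    have hB0 : 0 ≤ B := Finset.sum_nonneg fun i _ => by split_ifs <;> positivity
    rw [← hAB]
    calc _ ≤ 2 * S * (2 * (A * B)) := by
            refine mul_le_mul_of_nonneg_right hS (by positivity)
      _ = S * (4 * (A * B)) := by ring
      _ ≤ S * (A + B) ^ 2 := mul_le_mul_of_nonneg_left (by nlinarith [sq_nonneg (A - B)]) hS0
  · positivity

lemma l2norm_restr_sq (s : Set V) (f : V → ℝ) :
    l2norm (restr s f) ^ 2 = ∑ i, f i * restr s f i := by
  rw [l2norm_sq]
  refine Finset.sum_congr rfl fun i _ => ?_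
  by_cases h : i ∈ s
  · rw [restr_apply_mem h]; ring
  · rw [restr_apply_not_mem h]; ring

lemma l2norm_restr_le (s : Set V) (f : V → ℝ) : l2norm (restr s f) ≤ l2norm f := by
  refine Real.sqrt_le_sqrt (Finset.sum_le_sum fun i _ => ?_)
  by_cases h : i ∈ s
  · rw [restr_apply_mem h]
  · rw [restr_apply_not_mem h, zero_pow two_ne_zero]; positivity

lemma bilin_congr {M N : V → V → ℝ} {f g : V → ℝ}
    (h : ∀ i j, f i ≠ 0 → g j ≠ 0 → M i j = N i j) : bilin M f g = bilin N f g := by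
  refine Finset.sum_congr rfl fun i _ => Finset.sum_congr rfl fun j _ => ?_
  by_cases h1 : f i = 0
  · simp [h1]
  by_cases h2 : g j = 0
  · simp [h2]
  rw [h i j h1 h2]

lemma sum_l2norm_restr_fiber {κ : Type*} [Fintype κ] (c : V → κ) (f : V → ℝ) :
    ∑ C, l2norm (restr {i | c i = C} f) ^ 2 = l2norm f ^ 2 := by
  classical
  simp only [l2norm_restr_sq]
  rw [Finset.sum_comm, l2norm_sq]
  refine Finset.sum_congr rfl fun i _ => ?_
  rw [Finset.sum_eq_single (c i)]
  · rw [restr_apply_mem (s := {k | c k = c i}) (i := i) rfl]; ring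
  · intro C _ hC
    rw [restr_apply_not_mem (s := {k | c k = C}) (i := i) (fun h => hC h.symm), mul_zero]
  · simp

/-- The bilinear form of a block diagonal matrix splits into the blocks. -/
lemma bilin_eq_sum_blocks {κ : Type*} [Fintype κ] (c : V → κ) (M : V → V → ℝ)
    (hM : ∀ i j, M i j ≠ 0 → c i = c j) (f g : V → ℝ) :
    bilin M f g = ∑ C, bilin M (restr {i | c i = C} f) (restr {i | c i = C} g) := by
  classical
  simp only [bilin]
  symm
  rw [Finset.sum_comm]
  refine Finset.sum_congr rfl fun i _ => ?_
  rw [Finset.sum_comm]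
  refine Finset.sum_congr rfl fun j _ => ?_
  rw [Finset.sum_eq_single (c i)]
  · rw [restr_apply_mem (s := {k | c k = c i}) (i := i) rfl]
    by_cases h : c j = c i
    · rw [restr_apply_mem (s := {k | c k = c i}) (i := j) h]
    · have : M i j = 0 := by
        by_contra h'
        exact h (hM i j h').symm
      simp [this]
  · intro C _ hC
    rw [restr_apply_not_mem (s := {k | c k = C}) (i := i) (fun h => hC h.symm)]
    simp
  · simp

lemma bilin_self_le_of_blocks {κ : Type*} [Fintype κ] (c : V → κ) (M : V → V → ℝ)
    (hM : ∀ i j, M i j ≠ 0 → c i = c j) (f : V → ℝ) (β : ℝ)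
    (hβ : ∀ C, bilin M (restr {i | c i = C} f) (restr {i | c i = C} f)
      ≤ β * l2norm (restr {i | c i = C} f) ^ 2) :
    bilin M f f ≤ β * l2norm f ^ 2 := by
  rw [bilin_eq_sum_blocks c M hM, ← sum_l2norm_restr_fiber c f, Finset.mul_sum]
  exact Finset.sum_le_sum fun C _ => hβ C

lemma bilin_le_of_blocks {κ : Type*} [Fintype κ] (c : V → κ) (M : V → V → ℝ)
    (hM : ∀ i j, M i j ≠ 0 → c i = c j) (f g : V → ℝ) (β : ℝ) (hβ0 : 0 ≤ β)
    (hβ : ∀ C, bilin M (restr {i | c i = C} f) (restr {i | c i = C} g)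
      ≤ β * (l2norm (restr {i | c i = C} f) * l2norm (restr {i | c i = C} g))) :
    bilin M f g ≤ β * (l2norm f * l2norm g) := by
  rw [bilin_eq_sum_blocks c M hM]
  refine (Finset.sum_le_sum fun C _ => hβ C).trans ?_
  rw [← Finset.mul_sum]
  refine mul_le_mul_of_nonneg_left ?_ hβ0
  have h := Finset.sum_mul_sq_le_sq_mul_sq (Finset.univ : Finset κ)
    (fun C => l2norm (restr {i | c i = C} f)) (fun C => l2norm (restr {i | c i = C} g))
  rw [sum_l2norm_restr_fiber, sum_l2norm_restr_fiber, ← mul_pow] at h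
  exact (abs_le_of_sq_le_sq' h (mul_nonneg (l2norm_nonneg _) (l2norm_nonneg _))).2

/-- If `f` is an eigenvector of `M` with eigenvalue `l`, its restriction to `s` satisfies
`l ‖f_s‖² = ⟨f_s, M f⟩`. -/
lemma eigen_restr {M : V → V → ℝ} {f : V → ℝ} {l : ℝ} (hf : ∀ i, ∑ j, M i j * f j = l * f i)
    (s : Set V) : l * l2norm (restr s f) ^ 2 = bilin M (restr s f) f := by
  rw [l2norm_restr_sq, Finset.mul_sum, bilin]
  refine Finset.sum_congr rfl fun i _ => ?_
  have : ∑ j, restr s f i * M i j * f j = restr s f i * ∑ j, M i j * f j := by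
    rw [Finset.mul_sum]
    exact Finset.sum_congr rfl fun j _ => by ring
  rw [this, hf]; ring

/-- Spectral gap estimate. Let `M = M₁ + M₂`, where `M₁` has norm at most `b` and `M₂` does not
connect the coordinates in `s` to the others. If on `s` the quadratic form of `M₂` stays below the
eigenvalue `l` of `f` by `gap`, then `f` has little mass on `s`: pair the eigenvalue equation with
the restriction of `f` to `s`. -/
lemma l2norm_restr_le_of_gap {M M₁ M₂ : V → V → ℝ} {f : V → ℝ} {l b gap : ℝ}
    (hf : ∀ i, ∑ j, M i j * f j = l * f i) (hM : ∀ i j, M i j = M₁ i j + M₂ i j)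
    (s : Set V) (hs : ∀ i j, i ∈ s → j ∉ s → M₂ i j = 0)
    (hb : ∀ g h : V → ℝ, bilin M₁ g h ≤ b * (l2norm g * l2norm h))
    (hgap : bilin M₂ (restr s f) (restr s f) ≤ (l - gap) * l2norm (restr s f) ^ 2) :
    gap * l2norm (restr s f) ≤ b * l2norm f := by
  have h1 := eigen_restr hf s
  have h2 : bilin M (restr s f) f = bilin M₁ (restr s f) f + bilin M₂ (restr s f) f := by
    rw [← bilin_add_left]
    exact bilin_congr fun i j _ _ => hM i j
  have h3 : bilin M₂ (restr s f) f = bilin M₂ (restr s f) (restr s f) := by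
    refine Finset.sum_congr rfl fun i _ => Finset.sum_congr rfl fun j _ => ?_
    by_cases hi : i ∈ s
    · by_cases hj : j ∈ s
      · rw [restr_apply_mem hj]
      · rw [hs i j hi hj]; simp
    · rw [restr_apply_not_mem hi]; simp
  have h4 := hb (restr s f) f
  have h5 : gap * l2norm (restr s f) ^ 2 ≤ b * (l2norm (restr s f) * l2norm f) := by
    rw [h2, h3] at h1; linarith
  rcases (l2norm_nonneg (restr s f)).eq_or_lt with h | h
  · rw [← h] at h5 ⊢
    have := hb f f
    -- The bound on `M₁` at `(f, f)` and `(f, -f)` forces `b ≥ 0` unless `f = 0`.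
    have hb0 : 0 ≤ b * l2norm f := by
      by_contra hlt
      push Not at hlt
      have hf0 : 0 < l2norm f := by
        rcases (l2norm_nonneg f).eq_or_lt with h' | h'
        · rw [← h'] at hlt; simp at hlt
        · exact h'
      have hpos : 0 ≤ bilin M₁ f f ∨ 0 ≤ bilin M₁ f (fun i => - f i) := by
        have : bilin M₁ f (fun i => - f i) = - bilin M₁ f f := by
          simp [bilin]
        rw [this]
        rcases le_total 0 (bilin M₁ f f) with h' | h'
        · exact Or.inl h'
        · exact Or.inr (by linarith)
      have hn : l2norm (fun i => - f i) = l2norm f := by simp [l2norm]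
      rcases hpos with h' | h'
      · have := hb f f
        nlinarith
      · have := hb f (fun i => - f i)
        rw [hn] at this
        nlinarith
    linarith
  · have : (gap * l2norm (restr s f)) * l2norm (restr s f)
        ≤ (b * l2norm f) * l2norm (restr s f) := by nlinarith
    exact le_of_mul_le_mul_right this h

lemma l2norm_restr_compl_sq (s : Set V) (f : V → ℝ) :
    l2norm (restr s f) ^ 2 + l2norm (restr sᶜ f) ^ 2 = l2norm f ^ 2 := by
  rw [l2norm_sq, l2norm_sq, l2norm_sq, ← Finset.sum_add_distrib]
  refine Finset.sum_congr rfl fun i _ => ?_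
  by_cases h : i ∈ s
  · rw [restr_apply_mem h, restr_apply_not_mem (by simpa using h)]; ring
  · rw [restr_apply_not_mem h, restr_apply_mem (s := sᶜ) (by simpa using h)]; ring

lemma l2norm_restr_union_sq_le (s t : Set V) (f : V → ℝ) :
    l2norm (restr (s ∪ t) f) ^ 2 ≤ l2norm (restr s f) ^ 2 + l2norm (restr t f) ^ 2 := by
  rw [l2norm_sq, l2norm_sq, l2norm_sq, ← Finset.sum_add_distrib]
  refine Finset.sum_le_sum fun i _ => ?_
  by_cases h : i ∈ s
  · rw [restr_apply_mem (s := s ∪ t) (Or.inl h), restr_apply_mem h]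
    nlinarith [sq_nonneg (restr t f i)]
  · by_cases h' : i ∈ t
    · rw [restr_apply_mem (s := s ∪ t) (Or.inr h'), restr_apply_mem h']
      nlinarith [sq_nonneg (restr s f i)]
    · rw [restr_apply_not_mem (s := s ∪ t) (by simp [h, h']), zero_pow two_ne_zero]
      positivity

/-- A power sum inequality: `∑ x² ≤ m ^ ((2 - α) / α) ∑ |x| ^ α` if every `|x| ^ α` is at most `m`.
-/
lemma sum_sq_le_rpow_mul {ι : Type*} (s : Finset ι) (x : ι → ℝ) {α m : ℝ} (hα : 0 < α) (hα2 : α ≤ 2)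
    (hm : ∀ i ∈ s, |x i| ^ α ≤ m) :
    ∑ i ∈ s, x i ^ 2 ≤ m ^ ((2 - α) / α) * ∑ i ∈ s, |x i| ^ α := by
  rw [Finset.mul_sum]
  refine Finset.sum_le_sum fun i hi => ?_
  have h0 : 0 ≤ |x i| := abs_nonneg _
  have h1 : x i ^ 2 = (|x i| ^ α) ^ ((2 - α) / α) * |x i| ^ α := by
    rw [← Real.rpow_mul h0, mul_div_cancel₀ _ hα.ne', ← Real.rpow_add_of_nonneg h0 (by linarith) hα.le]
    rw [show 2 - α + α = ((2 : ℕ) : ℝ) by push_cast; ring, Real.rpow_natCast, sq_abs]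
  rw [h1]
  have : 0 ≤ (2 - α) / α := div_nonneg (by linarith) hα.le
  exact mul_le_mul_of_nonneg_right
    (Real.rpow_le_rpow (Real.rpow_nonneg h0 _) (hm i hi) this) (Real.rpow_nonneg h0 _)

lemma sum_sq_le_rpow {ι : Type*} (s : Finset ι) (x : ι → ℝ) {α S : ℝ} (hα : 0 < α) (hα2 : α ≤ 2)
    (hS : ∑ i ∈ s, |x i| ^ α ≤ S) : ∑ i ∈ s, x i ^ 2 ≤ S ^ (2 / α) := by
  have h0 : ∀ i ∈ s, 0 ≤ |x i| ^ α := fun i _ => Real.rpow_nonneg (abs_nonneg _) _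
  have hS0 : 0 ≤ S := (Finset.sum_nonneg h0).trans hS
  refine (sum_sq_le_rpow_mul s x hα hα2
    fun i hi => (Finset.single_le_sum h0 hi).trans hS).trans ?_
  have h1 : S ^ (2 / α) = S ^ ((2 - α) / α) * S := by
    rw [← Real.rpow_add_one' hS0]
    · congr 1; field_simp; ring
    · have : (2 - α) / α + 1 = 2 / α := by field_simp; ring
      rw [this]; positivity
  rw [h1]
  exact mul_le_mul_of_nonneg_left hS (Real.rpow_nonneg hS0 _)

end LinearAlgebra

section TopEigenvector

variable {n : ℕ}

/-- Since `1 - ε ≤ √(1 - ε)`, localization follows if the squared mass off `I` is at most `ε`. -/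
lemma isLocalizedOn_of_compl {ε : ℝ} {f : Fin n → ℝ} (I : Finset (Fin n))
    (h : l2norm (restr (↑I : Set (Fin n))ᶜ f) ^ 2 ≤ ε * l2norm f ^ 2) : IsLocalizedOn ε f I := by
  have hI : Real.sqrt (∑ i ∈ I, |f i| ^ 2) = l2norm (restr (↑I : Set (Fin n)) f) := by
    rw [l2norm]
    congr 1
    rw [← Finset.sum_subset (Finset.subset_univ I)]
    · exact Finset.sum_congr rfl fun i hi => by rw [restr_apply_mem (by simpa using hi), sq_abs]
    · intro i _ hi
      rw [restr_apply_not_mem (by simpa using hi)]; simp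
  have hn : Real.sqrt (∑ i, |f i| ^ 2) = l2norm f := by simp [l2norm]
  rw [IsLocalizedOn, hI, hn]
  have h1 := l2norm_restr_compl_sq (↑I : Set (Fin n)) f
  rcases le_total 1 ε with hε | hε
  · have := l2norm_nonneg f
    have := l2norm_nonneg (restr (↑I : Set (Fin n)) f)
    nlinarith
  · refine abs_le_of_sq_le_sq' ?_ (l2norm_nonneg _) |>.2
    by_cases hε0 : 0 ≤ ε
    · have : (1 - ε) ^ 2 ≤ 1 - ε := by nlinarith
      have := mul_le_mul_of_nonneg_right this (sq_nonneg (l2norm f))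
      rw [mul_pow]; linarith
    · have h2 : l2norm f ^ 2 = 0 := by
        have := sq_nonneg (l2norm (restr (↑I : Set (Fin n))ᶜ f))
        nlinarith [sq_nonneg (l2norm f)]
      rw [mul_pow, h2]; nlinarith [sq_nonneg (l2norm (restr (↑I : Set (Fin n)) f))]

/-- A top eigenvector satisfies the eigenvalue equation, and its eigenvalue dominates the quadratic
form. -/
lemma IsTopEigenvector.exists_eigenvalue {M : Matrix (Fin n) (Fin n) ℝ} (hM : M.IsSymm)
    {f : Fin n → ℝ} (hf : IsTopEigenvector M f) :
    ∃ l : ℝ, (∀ i, ∑ j, M i j * f j = l * f i) ∧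
      ∀ g : Fin n → ℝ, bilin (fun i j => M i j) g g ≤ l * l2norm g ^ 2 := by
  obtain ⟨l, hfl, hmax⟩ := hf
  refine ⟨l, fun i => ?_, fun g => ?_⟩
  · have := congrFun hfl.apply_eq_smul i
    simpa [Matrix.toLin'_apply, Matrix.mulVec, dotProduct] using this
  · have hH : (l • (1 : Matrix (Fin n) (Fin n) ℝ) - M).IsHermitian := by
      rw [Matrix.IsHermitian, Matrix.conjTranspose_eq_transpose_of_trivial]
      simp [hM.eq]
    have hps : (l • (1 : Matrix (Fin n) (Fin n) ℝ) - M).PosSemidef := by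
      rw [hH.posSemidef_iff_eigenvalues_nonneg]
      intro i
      have h1 := hH.mulVec_eigenvectorBasis i
      have hne : (⇑(hH.eigenvectorBasis i) : Fin n → ℝ) ≠ 0 := by
        intro h
        apply hH.eigenvectorBasis.toBasis.ne_zero i
        ext j
        simpa using congrFun h j
      have h2 : Module.End.HasEigenvalue (Matrix.toLin' M) (l - hH.eigenvalues i) := by
        refine Module.End.hasEigenvalue_of_hasEigenvector (x := ⇑(hH.eigenvectorBasis i)) ?_
        rw [Module.End.hasEigenvector_iff, Module.End.mem_eigenspace_iff]
        refine ⟨?_, hne⟩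
        rw [Matrix.sub_mulVec, Matrix.smul_mulVec, Matrix.one_mulVec] at h1
        rw [Matrix.toLin'_apply, sub_smul, ← h1]
        simp
      have := hmax _ h2
      simp only [Pi.zero_apply]
      linarith
    have := hps.dotProduct_mulVec_nonneg g
    rw [Matrix.sub_mulVec, Matrix.smul_mulVec, Matrix.one_mulVec, dotProduct_sub] at this
    have h3 : star g ⬝ᵥ l • g = l * l2norm g ^ 2 := by
      rw [l2norm_sq, Finset.mul_sum]
      simp [dotProduct]
      exact Finset.sum_congr rfl fun i _ => by ring
    have h4 : star g ⬝ᵥ M *ᵥ g = bilin (fun i j => M i j) g g := by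
      simp only [dotProduct, Matrix.mulVec, bilin, Finset.mul_sum, star_trivial]
      exact Finset.sum_congr rfl fun i _ => Finset.sum_congr rfl fun j _ => by ring
    linarith

end TopEigenvector

/-! ### Weighted graphs, balls and components of large weights -/

section WeightedGraph

variable {n : ℕ}

/-- The symmetric matrix with zero diagonal and entries `w` above the diagonal. Weights are indexed
by the pairs `i < j` throughout, so that they can be drawn from a product measure. -/
noncomputable def symEntry (w : UpperPairs n → ℝ) (i j : Fin n) : ℝ :=
  if h : i < j then w ⟨(i, j), h⟩ else if h : j < i then w ⟨(j, i), h⟩ else 0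

/-- The weighted adjacency matrix of `G` whose weight on the edge `{i, j}`, `i < j`, is `w (i, j)`.
-/
noncomputable def wmat (G : SimpleGraph (Fin n)) (w : UpperPairs n → ℝ) (i j : Fin n) : ℝ :=
  open Classical in if G.Adj i j then symEntry w i j else 0

lemma symEntry_comm (w : UpperPairs n → ℝ) (i j : Fin n) : symEntry w i j = symEntry w j i := by
  unfold symEntry
  rcases lt_trichotomy i j with h | h | h
  · simp [h, h.not_gt]
  · subst h; simp
  · simp [h, h.not_gt]

lemma symEntry_upper (w : UpperPairs n → ℝ) (e : UpperPairs n) : symEntry w e.1.1 e.1.2 = w e := by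
  simp [symEntry, e.2]

lemma wmat_comm (G : SimpleGraph (Fin n)) (w : UpperPairs n → ℝ) (i j : Fin n) :
    wmat G w i j = wmat G w j i := by
  simp only [wmat, symEntry_comm w i j]
  by_cases h : G.Adj i j
  · simp [h, h.symm]
  · have h' : ¬ G.Adj j i := fun h' => h h'.symm
    simp [h, h']

lemma wmat_self (G : SimpleGraph (Fin n)) (w : UpperPairs n → ℝ) (i : Fin n) :
    wmat G w i i = 0 := by
  simp [wmat]

lemma wmat_of_not_adj {G : SimpleGraph (Fin n)} {i j : Fin n} (h : ¬ G.Adj i j)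
    (w : UpperPairs n → ℝ) : wmat G w i j = 0 := by
  simp [wmat, h]

lemma wmat_upper {G : SimpleGraph (Fin n)} {e : UpperPairs n} (h : G.Adj e.1.1 e.1.2)
    (w : UpperPairs n → ℝ) : wmat G w e.1.1 e.1.2 = w e := by
  rw [wmat, if_pos h, symEntry_upper]

lemma weightedAdjMatrix_eq_wmat (G : SimpleGraph (Fin n)) {M : Matrix (Fin n) (Fin n) ℝ}
    (hM : M.IsSymm) :
    weightedAdjMatrix G M = Matrix.of (wmat G (fun e => M e.1.1 e.1.2)) := by
  ext i j
  simp only [weightedAdjMatrix, wmat, Matrix.hadamard_apply, SimpleGraph.adjMatrix_apply,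
    Matrix.of_apply]
  split_ifs with h
  · rw [one_mul, symEntry]
    rcases lt_trichotomy i j with h' | h' | h'
    · simp [h']
    · subst h'; exact absurd rfl h.ne
    · simp [h', h'.not_gt, hM.apply]
  · simp

lemma exists_upper_of_ne {i j : Fin n} (h : i ≠ j) :
    ∃ e : UpperPairs n, s(e.1.1, e.1.2) = s(i, j) := by
  rcases lt_or_gt_of_ne h with h | h
  · exact ⟨⟨(i, j), h⟩, rfl⟩
  · exact ⟨⟨(j, i), h⟩, Sym2.eq_swap⟩

/-- A sum over ordered pairs of a symmetric function vanishing on the diagonal. -/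
lemma sum_sum_eq_two_mul (F : Fin n → Fin n → ℝ) (hF : ∀ i j, F i j = F j i) (h0 : ∀ i, F i i = 0) :
    ∑ i, ∑ j, F i j = 2 * ∑ e : UpperPairs n, F e.1.1 e.1.2 := by
  classical
  have h1 : ∑ e : UpperPairs n, F e.1.1 e.1.2
      = ∑ p : Fin n × Fin n, if p.1 < p.2 then F p.1 p.2 else 0 := by
    rw [← Finset.sum_filter]
    exact (Finset.sum_subtype (p := fun p : Fin n × Fin n => p.1 < p.2) _ (by simp)
      (fun p => F p.1 p.2)).symm
  have h2 : ∑ p : Fin n × Fin n, (if p.1 < p.2 then F p.1 p.2 else 0)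
      = ∑ p : Fin n × Fin n, if p.2 < p.1 then F p.1 p.2 else 0 := by
    rw [← (Equiv.prodComm (Fin n) (Fin n)).sum_comp]
    refine Finset.sum_congr rfl fun p _ => ?_
    simp [hF p.2 p.1]
  rw [two_mul, h1]
  nth_rewrite 2 [h2]
  rw [← Fintype.sum_prod_type', ← Finset.sum_add_distrib]
  refine Finset.sum_congr rfl fun p _ => ?_
  rcases lt_trichotomy p.1 p.2 with h | h | h
  · simp [h, h.not_gt]
  · simp [h, h0]
  · simp [h, h.not_gt]

/-- The graph of the nonzero entries of the weighted adjacency matrix. -/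
def supportGraph (G : SimpleGraph (Fin n)) (w : UpperPairs n → ℝ) : SimpleGraph (Fin n) where
  Adj i j := wmat G w i j ≠ 0
  symm := ⟨fun i j h => by rwa [wmat_comm]⟩
  loopless := ⟨fun i h => h (wmat_self G w i)⟩

lemma supportGraph_le (G : SimpleGraph (Fin n)) (w : UpperPairs n → ℝ) : supportGraph G w ≤ G := by
  intro i j h
  by_contra h'
  exact h (wmat_of_not_adj h' w)

/-- The ball of radius `k` around `v` in the graph metric: the vertices reached from `v` by a walk
of length at most `k`. -/
noncomputable def gball (G : SimpleGraph (Fin n)) (k : ℕ) (v : Fin n) : Finset (Fin n) :=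
  open Classical in Finset.univ.filter fun u => ∃ p : G.Walk v u, p.length ≤ k

/-- The edges of `G` with both ends in `B`. -/
noncomputable def edgesIn (G : SimpleGraph (Fin n)) (B : Finset (Fin n)) : Finset (UpperPairs n) :=
  open Classical in Finset.univ.filter fun e => e.1.1 ∈ B ∧ e.1.2 ∈ B ∧ G.Adj e.1.1 e.1.2

lemma mem_gball {G : SimpleGraph (Fin n)} {k : ℕ} {v u : Fin n} :
    u ∈ gball G k v ↔ ∃ p : G.Walk v u, p.length ≤ k := by
  simp [gball]

lemma mem_edgesIn {G : SimpleGraph (Fin n)} {B : Finset (Fin n)} {e : UpperPairs n} :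
    e ∈ edgesIn G B ↔ e.1.1 ∈ B ∧ e.1.2 ∈ B ∧ G.Adj e.1.1 e.1.2 := by
  simp [edgesIn]

lemma self_mem_gball (G : SimpleGraph (Fin n)) (k : ℕ) (v : Fin n) : v ∈ gball G k v :=
  mem_gball.2 ⟨.nil, by simp⟩

lemma mem_gball_comm {G : SimpleGraph (Fin n)} {k : ℕ} {v u : Fin n} :
    u ∈ gball G k v ↔ v ∈ gball G k u := by
  constructor <;> rintro h <;> obtain ⟨p, hp⟩ := mem_gball.1 h <;>
    exact mem_gball.2 ⟨p.reverse, by simpa using hp⟩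

lemma mem_gball_trans {G : SimpleGraph (Fin n)} {k l : ℕ} {v u x : Fin n} (h : u ∈ gball G k v)
    (h' : x ∈ gball G l u) : x ∈ gball G (k + l) v := by
  obtain ⟨p, hp⟩ := mem_gball.1 h
  obtain ⟨q, hq⟩ := mem_gball.1 h'
  exact mem_gball.2 ⟨p.append q, by rw [SimpleGraph.Walk.length_append]; omega⟩

lemma mem_gball_of_adj {G : SimpleGraph (Fin n)} {k : ℕ} (hk : 1 ≤ k) {v u : Fin n}
    (h : G.Adj v u) : u ∈ gball G k v :=
  mem_gball.2 ⟨h.toWalk, by simpa using hk⟩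

/-- Every vertex has exactly `d` neighbours. This is `SimpleGraph.IsRegularOfDegree` without its
`LocallyFinite` instance argument. -/
def IsRegularGraph (G : SimpleGraph (Fin n)) (d : ℕ) : Prop :=
  open Classical in ∀ v, (Finset.univ.filter fun u => G.Adj v u).card = d

lemma isRegularGraph_of_mem {G : SimpleGraph (Fin n)} {d : ℕ} :
    G ∈ regularGraphs n d ↔ IsRegularGraph G d := by
  classical
  simp only [regularGraphs, IsRegularGraph, Set.mem_ofPred_eq, SimpleGraph.IsRegularOfDegree]
  refine forall_congr' fun v => ?_
  rw [← SimpleGraph.card_neighborFinset_eq_degree]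
  have : G.neighborFinset v = Finset.univ.filter fun u => G.Adj v u := by
    ext u; simp
  rw [this]

lemma card_gball_le {G : SimpleGraph (Fin n)} {d : ℕ} (hG : IsRegularGraph G d) (k : ℕ)
    (v : Fin n) : (gball G k v).card ≤ (d + 1) ^ k := by
  classical
  induction k generalizing v with
  | zero =>
    have : gball G 0 v ⊆ {v} := by
      intro u hu
      obtain ⟨p, hp⟩ := mem_gball.1 hu
      have := SimpleGraph.Walk.eq_of_length_eq_zero (Nat.le_zero.1 hp)
      simp [this]
    simpa using Finset.card_le_card this
  | succ k ih =>
    have h1 : gball G (k + 1) v ⊆ gball G k v ∪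
        (Finset.univ.filter fun u => G.Adj v u).biUnion (fun u => gball G k u) := by
      intro u hu
      obtain ⟨p, hp⟩ := mem_gball.1 hu
      cases p with
      | nil => exact Finset.mem_union_left _ (self_mem_gball G k _)
      | cons h q =>
        refine Finset.mem_union_right _ (Finset.mem_biUnion.2 ⟨_, by simpa using h, ?_⟩)
        exact mem_gball.2 ⟨q, by simpa using hp⟩
    refine (Finset.card_le_card h1).trans ((Finset.card_union_le _ _).trans ?_)
    have h2 := Finset.card_biUnion_le_card_mul (Finset.univ.filter fun u => G.Adj v u)
      (fun u => gball G k u) ((d + 1) ^ k) (fun u _ => ih u)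
    have h3 : (Finset.univ.filter fun u => G.Adj v u).card = d := by
      convert hG v
    rw [h3] at h2
    have := ih v
    calc _ ≤ (d + 1) ^ k + d * (d + 1) ^ k := by omega
      _ = _ := by ring

lemma card_edgesIn_le (G : SimpleGraph (Fin n)) (B : Finset (Fin n)) :
    (edgesIn G B).card ≤ B.card ^ 2 := by
  classical
  have : (edgesIn G B).image (fun e => e.1) ⊆ B ×ˢ B := by
    intro p hp
    obtain ⟨e, he, rfl⟩ := Finset.mem_image.1 hp
    rw [mem_edgesIn] at he
    exact Finset.mem_product.2 ⟨he.1, he.2.1⟩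
  have h := Finset.card_le_card this
  rw [Finset.card_image_of_injective _ Subtype.val_injective, Finset.card_product] at h
  rw [sq]; exact h

lemma row_sum_le {G : SimpleGraph (Fin n)} {d : ℕ} (hG : IsRegularGraph G d) (i : Fin n) :
    open Classical in ∑ j, (if G.Adj i j then (1 : ℝ) else 0) ≤ d := by
  classical
  have := hG i
  rw [← this]
  simp only [Finset.sum_boole]
  norm_cast

/-- A weighted adjacency matrix with weights bounded by `τ` has norm at most `d * τ`. -/
lemma bilin_wmat_le {G : SimpleGraph (Fin n)} {d : ℕ} (hG : IsRegularGraph G d) {τ : ℝ}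
    (hτ : 0 ≤ τ) (w : UpperPairs n → ℝ) (hw : ∀ e, |w e| ≤ τ) (f g : Fin n → ℝ) :
    bilin (wmat G w) f g ≤ d * τ * (l2norm f * l2norm g) := by
  classical
  refine bilin_le_of_abs_le _ (fun i j => if G.Adj i j then 1 else 0) τ d hτ (by positivity) ?_
    ?_ ?_ ?_ f g
  · intro i j; by_cases h : G.Adj i j <;> simp [h]
  · intro i; convert row_sum_le hG i
  · intro j
    simp only [G.adj_comm _ j]
    convert row_sum_le hG j
  · intro i j
    by_cases h : G.Adj i j
    · simp only [wmat, h, if_true, mul_one, symEntry]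
      split_ifs
      · exact hw _
      · exact hw _
      · simpa using hτ
    · simp [wmat, h]

lemma bilin_wmat_self_eq (G : SimpleGraph (Fin n)) (w : UpperPairs n → ℝ) (B : Finset (Fin n))
    (g : Fin n → ℝ) (hg : ∀ i, i ∉ B → g i = 0) :
    bilin (wmat G w) g g = 2 * ∑ e ∈ edgesIn G B, w e * (g e.1.1 * g e.1.2) := by
  classical
  rw [bilin, sum_sum_eq_two_mul]
  · congr 1
    rw [← Finset.sum_subset (Finset.subset_univ (edgesIn G B))]
    · refine Finset.sum_congr rfl fun e he => ?_
      rw [wmat_upper (mem_edgesIn.1 he).2.2]; ring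
    · intro e _ he
      rw [mem_edgesIn] at he
      by_cases h1 : e.1.1 ∈ B
      · by_cases h2 : e.1.2 ∈ B
        · rw [wmat_of_not_adj (fun h => he ⟨h1, h2, h⟩)]; ring
        · rw [hg _ h2]; ring
      · rw [hg _ h1]; ring
  · intro i j; rw [wmat_comm]; ring
  · intro i; rw [wmat_self]; ring

/-- The block of a matrix on `B`, with the other entries replaced by zero. -/
noncomputable def blockOf (B : Finset (Fin n)) (M : Fin n → Fin n → ℝ) (i j : Fin n) : ℝ :=
  if i ∈ B ∧ j ∈ B then M i j else 0

lemma sum_blockOf_wmat_sq (G : SimpleGraph (Fin n)) (w : UpperPairs n → ℝ) (B : Finset (Fin n)) :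
    ∑ i, ∑ j, blockOf B (wmat G w) i j ^ 2 = 2 * ∑ e ∈ edgesIn G B, w e ^ 2 := by
  classical
  rw [sum_sum_eq_two_mul]
  · congr 1
    rw [← Finset.sum_subset (Finset.subset_univ (edgesIn G B))]
    · refine Finset.sum_congr rfl fun e he => ?_
      have h := mem_edgesIn.1 he
      rw [blockOf, if_pos ⟨h.1, h.2.1⟩, wmat_upper h.2.2]
    · intro e _ he
      rw [mem_edgesIn] at he
      rw [blockOf]
      split_ifs with h
      · rw [wmat_of_not_adj (fun h' => he ⟨h.1, h.2, h'⟩)]; simp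
      · simp
  · intro i j; simp only [blockOf, wmat_comm G w i j, and_comm]
  · intro i; simp [blockOf, wmat_self]

/-- If all nonzero weights are at least `τ`, the sum of `|w| ^ α` over the edges in `B` is at least
`τ ^ α` times the number of edges with nonzero weight. -/
lemma card_mul_le_sum_rpow {G : SimpleGraph (Fin n)} {w : UpperPairs n → ℝ} {τ α : ℝ} (hα : 0 < α)
    (hτ : 0 < τ) (hw : ∀ e, w e ≠ 0 → τ ≤ |w e|) (B : Finset (Fin n)) (S : Finset (Sym2 (Fin n)))
    (hS : ∀ s ∈ S, s ∈ (supportGraph G w).edgeSet) (hSB : ∀ s ∈ S, ∀ x ∈ s, x ∈ B) :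
    S.card * τ ^ α ≤ ∑ e ∈ edgesIn G B, |w e| ^ α := by
  classical
  set D := (edgesIn G B).filter (fun e => w e ≠ 0) with hD
  have h1 : S ⊆ D.image (fun e : UpperPairs n => s(e.1.1, e.1.2)) := by
    intro s hs
    induction s using Sym2.ind with
    | _ i j =>
      have hadj : wmat G w i j ≠ 0 := hS _ hs
      have hne : i ≠ j := by rintro rfl; exact hadj (wmat_self G w i)
      obtain ⟨e, he⟩ := exists_upper_of_ne hne
      refine Finset.mem_image.2 ⟨e, ?_, he⟩
      have hadj' : wmat G w e.1.1 e.1.2 ≠ 0 := by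
        rcases Sym2.eq_iff.1 he with ⟨h1, h2⟩ | ⟨h1, h2⟩
        · rwa [h1, h2]
        · rwa [h1, h2, wmat_comm]
      have hG : G.Adj e.1.1 e.1.2 := by
        by_contra h'; exact hadj' (wmat_of_not_adj h' w)
      rw [wmat_upper hG] at hadj'
      rw [hD, Finset.mem_filter, mem_edgesIn]
      refine ⟨⟨hSB _ hs _ ?_, hSB _ hs _ ?_, hG⟩, hadj'⟩
      · rw [← he]; exact Sym2.mem_mk_left _ _
      · rw [← he]; exact Sym2.mem_mk_right _ _
  have h2 : S.card ≤ D.card := (Finset.card_le_card h1).trans Finset.card_image_le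
  calc (S.card : ℝ) * τ ^ α ≤ D.card * τ ^ α :=
        mul_le_mul_of_nonneg_right (by exact_mod_cast h2) (Real.rpow_nonneg hτ.le _)
    _ = ∑ e ∈ D, τ ^ α := by simp
    _ ≤ ∑ e ∈ D, |w e| ^ α := Finset.sum_le_sum fun e he =>
        Real.rpow_le_rpow hτ.le (hw e (Finset.mem_filter.1 he).2) hα.le
    _ ≤ _ := Finset.sum_le_sum_of_subset_of_nonneg (Finset.filter_subset _ _)
        fun e _ _ => Real.rpow_nonneg (abs_nonneg _) _

/-- A path of `k` large weights has mass at least `k τ ^ α`. If the ball of radius `k` around `v`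
does not carry that much, the component of `v` in the graph of large weights stays inside the ball.
-/
lemma mem_gball_of_reachable {G : SimpleGraph (Fin n)} {w : UpperPairs n → ℝ} {τ α : ℝ} (hα : 0 < α)
    (hτ : 0 < τ) (hw : ∀ e, w e ≠ 0 → τ ≤ |w e|) {k : ℕ} {v u : Fin n}
    (hT : ∑ e ∈ edgesIn G (gball G k v), |w e| ^ α < k * τ ^ α)
    (h : (supportGraph G w).Reachable v u) : u ∈ gball G k v := by
  classical
  obtain ⟨p, hp⟩ := h.exists_isPath
  by_contra hu
  have hlen : k < p.length := by
    by_contra hle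
    exact hu (mem_gball.2 ⟨p.mapLe (supportGraph_le G w), by simpa using hle⟩)
  have hq : (p.take k).IsPath := hp.take k
  have hql : (p.take k).length = k := by
    rw [SimpleGraph.Walk.take_length]; omega
  have hsupp : ∀ x ∈ (p.take k).support, x ∈ gball G k v := by
    intro x hx
    refine mem_gball.2 ⟨((p.take k).takeUntil x hx).mapLe (supportGraph_le G w), ?_⟩
    have := (p.take k).length_takeUntil_le_length hx
    simp only [SimpleGraph.Walk.length_map, SimpleGraph.Walk.mapLe]
    omega
  have := card_mul_le_sum_rpow hα hτ hw (gball G k v) (p.take k).edges.toFinset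
    (fun s hs => (p.take k).edges_subset_edgeSet (List.mem_toFinset.1 hs))
    (fun s hs x hx => hsupp x ((p.take k).mem_support_of_mem_edges (List.mem_toFinset.1 hs) hx))
  rw [List.toFinset_card_of_nodup hq.isTrail.edges_nodup, SimpleGraph.Walk.length_edges, hql] at this
  linarith

/-- For the same reason, cycles in that component have length less than `k`. -/
lemma length_cycle_lt {G : SimpleGraph (Fin n)} {w : UpperPairs n → ℝ} {τ α : ℝ} (hα : 0 < α)
    (hτ : 0 < τ) (hw : ∀ e, w e ≠ 0 → τ ≤ |w e|) {k : ℕ} {v u : Fin n}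
    (hT : ∑ e ∈ edgesIn G (gball G k v), |w e| ^ α < k * τ ^ α)
    (h : (supportGraph G w).Reachable v u) (p : (supportGraph G w).Walk u u) (hp : p.IsCycle) :
    p.length < k := by
  classical
  have := card_mul_le_sum_rpow hα hτ hw (gball G k v) p.edges.toFinset
    (fun s hs => p.edges_subset_edgeSet (List.mem_toFinset.1 hs))
    (fun s hs x hx => mem_gball_of_reachable hα hτ hw hT
      (h.trans (p.takeUntil x (p.mem_support_of_mem_edges (List.mem_toFinset.1 hs) hx)).reachable))
  rw [List.toFinset_card_of_nodup hp.isTrail.edges_nodup, SimpleGraph.Walk.length_edges] at this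
  have h1 : (p.length : ℝ) < k := by
    by_contra hle
    push Not at hle
    have := mul_le_mul_of_nonneg_right hle (Real.rpow_nonneg hτ.le α)
    linarith
  exact_mod_cast h1

end WeightedGraph

/-! ### Exponential moments, second moments, independent boxes -/

section Probability

open scoped ENNReal

/-- The number `x` if `|x| ≥ τ`, and `0` otherwise. -/
noncomputable def trunc (τ x : ℝ) : ℝ := if τ ≤ |x| then x else 0

lemma measurable_trunc (τ : ℝ) : Measurable (trunc τ) :=
  Measurable.ite (measurableSet_le measurable_const (by fun_prop)) measurable_id measurable_const

lemma le_abs_trunc {τ x : ℝ} (h : trunc τ x ≠ 0) : τ ≤ |trunc τ x| := by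
  unfold trunc at h ⊢
  split_ifs with h'
  · exact h'
  · simp [h'] at h

lemma abs_sub_trunc_le {τ : ℝ} (hτ : 0 ≤ τ) (x : ℝ) : |x - trunc τ x| ≤ τ := by
  unfold trunc
  split_ifs with h
  · simpa using hτ
  · simpa using (not_le.1 h).le

lemma IsWeibull.tail_abs {α C₁ C₂ : ℝ} {ν : Measure ℝ} (h : IsWeibull α C₁ C₂ ν) {t : ℝ}
    (ht : 1 ≤ t) : ν {x | t ≤ |x|} ≤ ENNReal.ofReal (C₂ * Real.exp (-t ^ α)) := by
  have := h.isProbabilityMeasure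
  have h1 : {x : ℝ | t ≤ |x|} = Set.Ici t ∪ Set.Iic (-t) := by
    ext x
    simp only [Set.mem_ofPred_eq, Set.mem_union, Set.mem_Ici, Set.mem_Iic, le_abs]
    refine or_congr Iff.rfl ⟨fun h => by linarith, fun h => by linarith⟩
  rw [h1, ← ofReal_measureReal]
  refine ENNReal.ofReal_le_ofReal ((measureReal_union_le _ _).trans ?_)
  have := (h.upper_tail t ht).2
  have := (h.lower_tail t ht).2
  linarith

lemma IsWeibull.const_nonneg {α C₁ C₂ : ℝ} {ν : Measure ℝ} (h : IsWeibull α C₁ C₂ ν) : 0 ≤ C₂ := by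
  have h1 := (h.upper_tail 1 le_rfl).2
  have h2 : 0 ≤ ν.real (Set.Ici 1) := measureReal_nonneg
  by_contra hlt
  push Not at hlt
  have := mul_neg_of_neg_of_pos hlt (Real.exp_pos (-(1:ℝ) ^ α))
  linarith

/-- The exponential moment of a truncated Weibull variable: since `|x| ^ α` has exponential tails of
rate `1`, its moment of order `1 - θ` is finite, and the large values contribute little. -/
lemma IsWeibull.lintegral_exp_trunc_le {α C₁ C₂ : ℝ} {ν : Measure ℝ} (h : IsWeibull α C₁ C₂ ν)
    (hα : 0 < α) {θ τ : ℝ} (hθ : 0 < θ) (hθ1 : θ ≤ 1) (hτ : 1 ≤ τ) :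
    ∫⁻ x, ENNReal.ofReal (Real.exp ((1 - θ) * |trunc τ x| ^ α)) ∂ν
      ≤ ENNReal.ofReal (1 + 2 * Real.exp 1 * C₂ / θ * Real.exp (-(θ * τ ^ α))) := by
  have := h.isProbabilityMeasure
  have hC := h.const_nonneg
  set s := τ ^ α with hs
  have hs1 : 1 ≤ s := Real.one_le_rpow hτ hα.le
  -- Slice according to the integer part `j` of `|x| ^ α - s`: the slice has probability at most
  -- `C₂ exp (-(s + j))`, and the integrand is at most `exp ((1 - θ) (s + j + 1))` there.
  set g : ℕ → ℝ → ℝ≥0∞ := fun j x => Set.indicator {x : ℝ | (s + j) ^ (1 / α) ≤ |x|}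
    (fun _ => ENNReal.ofReal (Real.exp ((1 - θ) * (s + j + 1)))) x with hg
  have hset : ∀ j : ℕ, MeasurableSet {x : ℝ | (s + j) ^ (1 / α) ≤ |x|} := fun j =>
    measurableSet_le measurable_const (by fun_prop)
  have hpt : ∀ x, ENNReal.ofReal (Real.exp ((1 - θ) * |trunc τ x| ^ α)) ≤ 1 + ∑' j, g j x := by
    intro x
    by_cases hx : τ ≤ |x|
    · have hy : s ≤ |x| ^ α := Real.rpow_le_rpow (by linarith) hx hα.le
      have h1 : ENNReal.ofReal (Real.exp ((1 - θ) * |trunc τ x| ^ α)) ≤ g ⌊|x| ^ α - s⌋₊ x := by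
        have hf1 := Nat.floor_le (sub_nonneg.2 hy)
        have hf2 := Nat.lt_floor_add_one (|x| ^ α - s)
        have hmem : x ∈ {x : ℝ | (s + (⌊|x| ^ α - s⌋₊ : ℝ)) ^ (1 / α) ≤ |x|} := by
          simp only [Set.mem_ofPred_eq]
          calc _ ≤ (|x| ^ α) ^ (1 / α) :=
                Real.rpow_le_rpow (by positivity) (by linarith) (by positivity)
            _ = |x| := by
                rw [← Real.rpow_mul (abs_nonneg x), mul_one_div_cancel hα.ne', Real.rpow_one]
        have hmem' : x ∈ {y : ℝ | (s + (⌊|x| ^ α - s⌋₊ : ℝ)) ^ (1 / α) ≤ |y|} := hmem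
        rw [hg]
        simp only
        rw [Set.indicator_of_mem hmem']
        refine ENNReal.ofReal_le_ofReal (Real.exp_le_exp.2 ?_)
        rw [trunc, if_pos hx]
        exact mul_le_mul_of_nonneg_left (by linarith) (by linarith)
      exact h1.trans ((ENNReal.le_tsum (f := fun j => g j x) _).trans le_add_self)
    · rw [trunc, if_neg hx, abs_zero, Real.zero_rpow hα.ne', mul_zero, Real.exp_zero]
      simp
  have hint : ∀ j, ∫⁻ x, g j x ∂ν
      ≤ ENNReal.ofReal (C₂ * Real.exp 1 * Real.exp (-(θ * s)) * (Real.exp (-θ)) ^ j) := by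
    intro j
    rw [hg]
    simp only
    rw [lintegral_indicator_const (hset j)]
    have hsj : 1 ≤ (s + j) ^ (1 / α) :=
      Real.one_le_rpow (by have : (0:ℝ) ≤ j := Nat.cast_nonneg j; linarith) (by positivity)
    refine (mul_le_mul_right (h.tail_abs hsj) _).trans ?_
    rw [← ENNReal.ofReal_mul (Real.exp_pos _).le]
    refine ENNReal.ofReal_le_ofReal ?_
    rw [← Real.rpow_mul (by positivity), one_div_mul_cancel hα.ne', Real.rpow_one]
    have h1 : Real.exp ((1 - θ) * (s + j + 1)) * (C₂ * Real.exp (-(s + j)))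
        = C₂ * Real.exp ((1 - θ) * (s + j + 1) + -(s + j)) := by rw [Real.exp_add]; ring
    have h2 : C₂ * Real.exp 1 * Real.exp (-(θ * s)) * (Real.exp (-θ)) ^ j
        = C₂ * Real.exp (1 + -(θ * s) + j * (-θ)) := by
      rw [Real.exp_add, Real.exp_add, Real.exp_nat_mul]; ring
    rw [h1, h2]
    refine mul_le_mul_of_nonneg_left (Real.exp_le_exp.2 ?_) hC
    nlinarith
  have hgeom : (∑' j : ℕ, C₂ * Real.exp 1 * Real.exp (-(θ * s)) * (Real.exp (-θ)) ^ j)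
      ≤ 2 * Real.exp 1 * C₂ / θ * Real.exp (-(θ * s)) := by
    have hlt : Real.exp (-θ) < 1 := by rw [← Real.exp_zero]; exact Real.exp_lt_exp.2 (by linarith)
    rw [tsum_mul_left, tsum_geometric_of_lt_one (Real.exp_pos _).le hlt]
    have h3 : θ / 2 ≤ 1 - Real.exp (-θ) := by
      have h4 : 1 + θ ≤ Real.exp θ := by linarith [Real.add_one_le_exp θ]
      have h5 : Real.exp (-θ) * Real.exp θ = 1 := by rw [← Real.exp_add]; simp
      nlinarith [Real.exp_pos (-θ)]
    have h6 : (1 - Real.exp (-θ))⁻¹ ≤ 2 / θ := by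
      rw [← one_div, div_le_div_iff₀ (by linarith) hθ]; linarith
    calc _ ≤ C₂ * Real.exp 1 * Real.exp (-(θ * s)) * (2 / θ) :=
          mul_le_mul_of_nonneg_left h6 (by positivity)
      _ = _ := by ring
  calc _ ≤ ∫⁻ x, (1 + ∑' j, g j x) ∂ν := lintegral_mono hpt
    _ = 1 + ∑' j, ∫⁻ x, g j x ∂ν := by
        rw [lintegral_add_left measurable_const, lintegral_tsum]
        · simp
        · exact fun j => (measurable_const.indicator (hset j)).aemeasurable
    _ ≤ 1 + ∑' j : ℕ, ENNReal.ofReal (C₂ * Real.exp 1 * Real.exp (-(θ * s)) * (Real.exp (-θ)) ^ j) :=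
        add_le_add le_rfl (ENNReal.tsum_le_tsum hint)
    _ = ENNReal.ofReal (1 + ∑' j : ℕ, C₂ * Real.exp 1 * Real.exp (-(θ * s)) * (Real.exp (-θ)) ^ j) := by
        rw [ENNReal.ofReal_add zero_le_one (tsum_nonneg fun j => by positivity),
          ENNReal.ofReal_tsum_of_nonneg (fun j => by positivity), ENNReal.ofReal_one]
        exact (summable_geometric_of_lt_one (Real.exp_pos _).le
          (by rw [← Real.exp_zero]; exact Real.exp_lt_exp.2 (by linarith))).mul_left _
    _ ≤ _ := ENNReal.ofReal_le_ofReal (by linarith)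

/-- Chernoff bound for the sum of the truncated variables `|w| ^ α` over a set of coordinates which
is not too large. -/
lemma IsWeibull.measure_sum_trunc_ge_le {ι : Type*} [Fintype ι] {α C₁ C₂ : ℝ} {ν : Measure ℝ}
    (h : IsWeibull α C₁ C₂ ν) (hα : 0 < α) {θ τ : ℝ} (hθ : 0 < θ) (hθ1 : θ ≤ 1) (hτ : 1 ≤ τ)
    (S : Finset ι) (hS : S.card * (2 * Real.exp 1 * C₂ / θ * Real.exp (-(θ * τ ^ α))) ≤ 1) (x : ℝ) :
    (Measure.pi fun _ : ι => ν).real {w | x ≤ ∑ e ∈ S, |trunc τ (w e)| ^ α}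
      ≤ Real.exp 1 * Real.exp (-((1 - θ) * x)) := by
  have := h.isProbabilityMeasure
  have hC := h.const_nonneg
  set b := 2 * Real.exp 1 * C₂ / θ * Real.exp (-(θ * τ ^ α)) with hb
  have hb0 : 0 ≤ b := by positivity
  have hmg : Measurable fun y : ℝ => ENNReal.ofReal (Real.exp ((1 - θ) * |trunc τ y| ^ α)) := by
    have := measurable_trunc τ
    fun_prop
  have hind : iIndepFun (fun (e : ι) (w : ι → ℝ) =>
      ENNReal.ofReal (Real.exp ((1 - θ) * |trunc τ (w e)| ^ α))) (Measure.pi fun _ : ι => ν) :=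
    iIndepFun_pi (μ := fun _ : ι => ν)
      (X := fun _ y => ENNReal.ofReal (Real.exp ((1 - θ) * |trunc τ y| ^ α)))
      fun _ => hmg.aemeasurable
  have hmono : {w : ι → ℝ | x ≤ ∑ e ∈ S, |trunc τ (w e)| ^ α} ⊆
      {w | ENNReal.ofReal (Real.exp ((1 - θ) * x))
        ≤ ∏ e ∈ S, ENNReal.ofReal (Real.exp ((1 - θ) * |trunc τ (w e)| ^ α))} := by
    intro w hw
    simp only [Set.mem_ofPred_eq] at hw ⊢
    rw [← ENNReal.ofReal_prod_of_nonneg (fun _ _ => (Real.exp_pos _).le), ← Real.exp_sum,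
      ← Finset.mul_sum]
    exact ENNReal.ofReal_le_ofReal
      (Real.exp_le_exp.2 (mul_le_mul_of_nonneg_left hw (by linarith)))
  have hmark := mul_meas_ge_le_lintegral (μ := Measure.pi fun _ : ι => ν)
    (f := fun w => ∏ e ∈ S, ENNReal.ofReal (Real.exp ((1 - θ) * |trunc τ (w e)| ^ α)))
    (Finset.measurable_fun_prod S fun e _ => hmg.comp (measurable_pi_apply e))
    (ENNReal.ofReal (Real.exp ((1 - θ) * x)))
  rw [lintegral_prod_eq_prod_lintegral_of_indepFun S _ hind
    (fun e => hmg.comp (measurable_pi_apply e))] at hmark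
  have hint : ∀ e : ι, ∫⁻ w, ENNReal.ofReal (Real.exp ((1 - θ) * |trunc τ (w e)| ^ α))
      ∂(Measure.pi fun _ : ι => ν) ≤ ENNReal.ofReal (1 + b) := by
    intro e
    rw [(measurePreserving_eval (fun _ : ι => ν) e).lintegral_comp hmg]
    exact h.lintegral_exp_trunc_le hα hθ hθ1 hτ
  have hprod : ∏ e ∈ S, ∫⁻ w, ENNReal.ofReal (Real.exp ((1 - θ) * |trunc τ (w e)| ^ α))
      ∂(Measure.pi fun _ : ι => ν) ≤ ENNReal.ofReal (Real.exp 1) := by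
    refine (Finset.prod_le_prod' fun e _ => hint e).trans ?_
    rw [Finset.prod_const, ← ENNReal.ofReal_pow (by linarith)]
    refine ENNReal.ofReal_le_ofReal ?_
    calc (1 + b) ^ S.card ≤ (Real.exp b) ^ S.card :=
          pow_le_pow_left₀ (by linarith) (by linarith [Real.add_one_le_exp b]) _
      _ = Real.exp (S.card * b) := by rw [Real.exp_nat_mul]
      _ ≤ Real.exp 1 := Real.exp_le_exp.2 hS
  have hfin := (mul_le_mul_right (measure_mono hmono) _).trans (hmark.trans hprod)
  rw [← ofReal_measureReal, ← ENNReal.ofReal_mul (Real.exp_pos _).le,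
    ENNReal.ofReal_le_ofReal_iff (Real.exp_pos _).le] at hfin
  rw [Real.exp_neg, ← div_eq_mul_inv, le_div_iff₀ (Real.exp_pos _), mul_comm]
  exact hfin

/-- Second moment bound: if each of the events `A v` is independent of all but `D` of the others, it
is unlikely that none of them occurs, provided that the expected number of those that occur is
large. -/
lemma measureReal_forall_not_mem_mul_le {Ω ι : Type*} [MeasurableSpace Ω] [Fintype ι] (μ : Measure Ω)
    [IsProbabilityMeasure μ] (A : ι → Set Ω) (hA : ∀ v, MeasurableSet (A v)) (R : ι → Finset ι)
    (D : ℕ) (hR : ∀ v, (R v).card ≤ D)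
    (hind : ∀ u v, u ∉ R v → μ.real (A u ∩ A v) = μ.real (A u) * μ.real (A v)) :
    μ.real {w | ∀ v, w ∉ A v} * ∑ v, μ.real (A v) ≤ D := by
  classical
  set s := ∑ v, μ.real (A v) with hs
  have hs0 : 0 ≤ s := Finset.sum_nonneg fun _ _ => measureReal_nonneg
  rcases hs0.eq_or_lt with h0 | h0
  · rw [← h0, mul_zero]; positivity
  set Z : Ω → ℝ := fun w => ∑ v, (A v).indicator (fun _ => (1 : ℝ)) w with hZ
  have hint1 : ∀ B : Set Ω, MeasurableSet B →
      Integrable (B.indicator fun _ => (1 : ℝ)) μ := fun B hB =>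
    (integrable_const (1 : ℝ)).indicator hB
  have hI : ∀ B : Set Ω, MeasurableSet B → ∫ w, B.indicator (fun _ => (1 : ℝ)) w ∂μ = μ.real B :=
    fun B hB => by rw [integral_indicator_const _ hB]; simp
  have hZint : Integrable Z μ := integrable_finsetSum _ fun v _ => hint1 _ (hA v)
  have hZI : ∫ w, Z w ∂μ = s := by
    rw [hZ, integral_finsetSum _ fun v _ => hint1 _ (hA v)]
    exact Finset.sum_congr rfl fun v _ => hI _ (hA v)
  have hZ2 : ∀ w, Z w ^ 2 = ∑ v, ∑ u, (A u ∩ A v).indicator (fun _ => (1 : ℝ)) w := by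
    intro w
    rw [sq, hZ]
    simp only
    rw [Finset.sum_mul_sum]
    refine Finset.sum_congr rfl fun v _ => Finset.sum_congr rfl fun u _ => ?_
    by_cases h1 : w ∈ A u <;> by_cases h2 : w ∈ A v <;> simp [Set.indicator, h1, h2]
  have hZ2int : Integrable (fun w => Z w ^ 2) μ := by
    simp only [hZ2]
    exact integrable_finsetSum _ fun v _ => integrable_finsetSum _ fun u _ =>
      hint1 _ ((hA u).inter (hA v))
  have hZ2I : ∫ w, Z w ^ 2 ∂μ ≤ s ^ 2 + D * s := by
    simp only [hZ2]
    rw [integral_finsetSum _ fun v _ => integrable_finsetSum _ fun u _ =>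
      hint1 _ ((hA u).inter (hA v))]
    have h1 : ∀ v, ∫ w, ∑ u, (A u ∩ A v).indicator (fun _ => (1 : ℝ)) w ∂μ
        ≤ s * μ.real (A v) + D * μ.real (A v) := by
      intro v
      rw [integral_finsetSum _ fun u _ => hint1 _ ((hA u).inter (hA v))]
      have h2 : ∀ u, ∫ w, (A u ∩ A v).indicator (fun _ => (1 : ℝ)) w ∂μ
          ≤ μ.real (A u) * μ.real (A v) + if u ∈ R v then μ.real (A v) else 0 := by
        intro u
        rw [hI _ ((hA u).inter (hA v))]
        split_ifs with h
        · have h3 : μ.real (A u ∩ A v) ≤ μ.real (A v) := measureReal_mono Set.inter_subset_right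
          have h4 : 0 ≤ μ.real (A u) * μ.real (A v) :=
            mul_nonneg measureReal_nonneg measureReal_nonneg
          linarith
        · rw [hind u v h, add_zero]
      refine (Finset.sum_le_sum fun u _ => h2 u).trans ?_
      rw [Finset.sum_add_distrib, ← Finset.sum_mul, ← hs, ← Finset.sum_filter,
        Finset.sum_const, nsmul_eq_mul]
      have h5 : ((Finset.univ.filter fun u => u ∈ R v).card : ℝ) ≤ D := by
        have : Finset.univ.filter (fun u => u ∈ R v) = R v := by ext; simp
        rw [this]; exact_mod_cast hR v
      have := mul_le_mul_of_nonneg_right h5 (measureReal_nonneg (μ := μ) (s := A v))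
      linarith
    refine (Finset.sum_le_sum fun v _ => h1 v).trans ?_
    rw [Finset.sum_add_distrib, ← Finset.mul_sum, ← Finset.mul_sum, ← hs]
    exact le_of_eq (by ring)
  set N : Set Ω := {w | ∀ v, w ∉ A v} with hN
  have hNm : MeasurableSet N := by
    have : N = ⋂ v, (A v)ᶜ := by ext w; simp [hN]
    rw [this]
    exact MeasurableSet.iInter fun v => (hA v).compl
  have hsub : Integrable (fun w => Z w ^ 2 - 2 * s * Z w) μ := hZ2int.sub (hZint.const_mul (2 * s))
  -- Chebyshev's inequality: the count `Z` differs from its mean `s` by `s` on `N`, so `μ N * s ^ 2`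
  -- is at most the variance, which is at most `D * s`.
  have hle : ∫ w, N.indicator (fun _ => (1 : ℝ)) w * s ^ 2 ∂μ
      ≤ ∫ w, (Z w ^ 2 - 2 * s * Z w + s ^ 2) ∂μ := by
    refine integral_mono ((hint1 _ hNm).mul_const _)
      (hsub.add (integrable_const _)) fun w => ?_
    simp only
    by_cases hw : w ∈ N
    · have hz : Z w = 0 := by
        rw [hZ]
        exact Finset.sum_eq_zero fun v _ => Set.indicator_of_notMem (hw v) _
      rw [Set.indicator_of_mem hw, hz]; simp
    · rw [Set.indicator_of_notMem hw]
      nlinarith [sq_nonneg (Z w - s)]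
  rw [integral_mul_const, hI _ hNm, integral_add hsub (integrable_const _),
    integral_sub hZ2int (hZint.const_mul (2 * s)), integral_const_mul, hZI] at hle
  simp only [integral_const, probReal_univ, smul_eq_mul, one_mul] at hle
  have h6 : (μ.real N * s) * s ≤ D * s := by nlinarith
  exact le_of_mul_le_mul_right h6 h0

/-- A box: the set of all `w` with `w e ≥ a e` for all `e ∈ S`. -/
def upperBox {ι : Type*} (S : Finset ι) (a : ι → ℝ) : Set (ι → ℝ) := {w | ∀ e ∈ S, a e ≤ w e}

lemma upperBox_eq_pi {ι : Type*} (S : Finset ι) (a : ι → ℝ) :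
    upperBox S a = (S : Set ι).pi fun e => Set.Ici (a e) := by
  ext w; simp [upperBox, Set.mem_pi]

lemma measurableSet_upperBox {ι : Type*} (S : Finset ι) (a : ι → ℝ) :
    MeasurableSet (upperBox S a) := by
  rw [upperBox_eq_pi]
  exact MeasurableSet.pi S.countable_toSet fun _ _ => measurableSet_Ici

lemma measureReal_upperBox {ι : Type*} [Fintype ι] (ν : Measure ℝ) [IsProbabilityMeasure ν]
    (S : Finset ι) (a : ι → ℝ) :
    (Measure.pi fun _ : ι => ν).real (upperBox S a) = ∏ e ∈ S, ν.real (Set.Ici (a e)) := by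
  rw [upperBox_eq_pi, measureReal_def, Measure.pi_pi_finset, ENNReal.toReal_prod]
  rfl

lemma measureReal_upperBox_inter {ι : Type*} [Fintype ι] (ν : Measure ℝ) [IsProbabilityMeasure ν]
    (S T : Finset ι) (hST : Disjoint S T) (a b : ι → ℝ) :
    (Measure.pi fun _ : ι => ν).real (upperBox S a ∩ upperBox T b)
      = (Measure.pi fun _ : ι => ν).real (upperBox S a)
        * (Measure.pi fun _ : ι => ν).real (upperBox T b) := by
  classical
  have h : upperBox S a ∩ upperBox T b = upperBox (S ∪ T) (fun e => if e ∈ S then a e else b e) := by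
    ext w
    simp only [upperBox, Set.mem_inter_iff, Set.mem_ofPred_eq, Finset.mem_union]
    constructor
    · rintro ⟨h1, h2⟩ e he
      split_ifs with h'
      · exact h1 e h'
      · exact h2 e (he.resolve_left h')
    · intro h1
      refine ⟨fun e he => by simpa [he] using h1 e (Or.inl he), fun e he => ?_⟩
      have : e ∉ S := fun h' => Finset.disjoint_left.1 hST h' he
      simpa [this] using h1 e (Or.inr he)
  rw [h, measureReal_upperBox, measureReal_upperBox, measureReal_upperBox, Finset.prod_union hST]
  congr 1
  · exact Finset.prod_congr rfl fun e he => by rw [if_pos he]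
  · exact Finset.prod_congr rfl fun e he => by
      rw [if_neg fun h' => Finset.disjoint_left.1 hST h' he]

/-- Markov's inequality for the number of events that occur. -/
lemma measureReal_card_gt_le {Ω ι : Type*} [MeasurableSpace Ω] [Fintype ι] (μ : Measure Ω)
    [IsProbabilityMeasure μ] (A : ι → Set Ω) (hA : ∀ v, MeasurableSet (A v)) {b : ℝ} (hb : 0 < b) :
    μ.real {w | b < (open Classical in (Finset.univ.filter fun v => w ∈ A v).card : ℝ)}
      ≤ (∑ v, μ.real (A v)) / b := by
  classical
  rw [le_div_iff₀ hb, mul_comm]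
  have hint1 : ∀ v, Integrable ((A v).indicator fun _ => (1 : ℝ)) μ := fun v =>
    (integrable_const (1 : ℝ)).indicator (hA v)
  have h1 : ∑ v, μ.real (A v) = ∫ w, ∑ v, (A v).indicator (fun _ => (1 : ℝ)) w ∂μ := by
    rw [integral_finsetSum _ fun v _ => hint1 v]
    exact Finset.sum_congr rfl fun v _ => by rw [integral_indicator_const _ (hA v)]; simp
  rw [h1]
  refine le_trans ?_ (mul_meas_ge_le_integral_of_nonneg
    (Filter.Eventually.of_forall fun w => Finset.sum_nonneg fun v _ =>
      Set.indicator_nonneg (fun _ _ => zero_le_one) w) (integrable_finsetSum _ fun v _ => hint1 v) b)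
  refine mul_le_mul_of_nonneg_left (measureReal_mono fun w hw => ?_) hb.le
  simp only [Set.mem_ofPred_eq] at hw ⊢
  refine hw.le.trans (le_of_eq ?_)
  rw [Finset.card_filter]
  push_cast
  exact Finset.sum_congr rfl fun v _ => by simp [Set.indicator]

end Probability

/-! ### The variational constant of a neighbourhood -/

section LocalConstant

variable {n : ℕ}

/-- The values `2 ∑ a_e f_i f_j` (the sum over the edges `e = {i, j}` in `S`) of the quadratic form
of nonnegative weights `a` on `S` with `∑ a ^ α ≤ 1`, at nonnegative vectors `f` in the unit ball.
-/
def localValues (α : ℝ) (S : Finset (UpperPairs n)) : Set ℝ :=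
  {y | ∃ (a : UpperPairs n → ℝ) (f : Fin n → ℝ), (∀ e, 0 ≤ a e) ∧ ∑ e ∈ S, a e ^ α ≤ 1 ∧
    (∀ i, 0 ≤ f i) ∧ ∑ i, f i ^ 2 ≤ 1 ∧ y = 2 * ∑ e ∈ S, a e * (f e.1.1 * f e.1.2)}

/-- The supremum of the top eigenvalues of the weighted graphs with edge set `S` and weights `w`
such that `∑ |w| ^ α ≤ 1`. Passing to absolute values only increases the quadratic form, so
nonnegative weights and vectors suffice. -/
noncomputable def localConst (α : ℝ) (S : Finset (UpperPairs n)) : ℝ := sSup (localValues α S)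

lemma localValues_le {α : ℝ} (hα : 0 < α) {G : SimpleGraph (Fin n)} {d : ℕ}
    (hG : IsRegularGraph G d) (B : Finset (Fin n)) {y : ℝ} (hy : y ∈ localValues α (edgesIn G B)) :
    y ≤ d := by
  classical
  obtain ⟨a, f, ha, hS, hf, hf1, rfl⟩ := hy
  set a' : UpperPairs n → ℝ := fun e => if e ∈ edgesIn G B then a e else 0 with ha'
  have h1 : ∀ e, |a' e| ≤ 1 := by
    intro e
    simp only [ha']
    split_ifs with h
    · rw [abs_of_nonneg (ha e)]
      by_contra hlt
      push Not at hlt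
      have h2 := Finset.single_le_sum (f := fun e => a e ^ α)
        (fun e _ => Real.rpow_nonneg (ha e) α) h
      have h3 := Real.one_lt_rpow hlt hα
      linarith
    · simp
  have h2 := bilin_wmat_le hG zero_le_one a' h1 f f
  rw [bilin_wmat_self_eq G a' Finset.univ f (fun i hi => absurd (Finset.mem_univ i) hi)] at h2
  have h3 : ∑ e ∈ edgesIn G Finset.univ, a' e * (f e.1.1 * f e.1.2)
      = ∑ e ∈ edgesIn G B, a e * (f e.1.1 * f e.1.2) := by
    have hsub : edgesIn G B ⊆ edgesIn G Finset.univ := by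
      intro e he
      rw [mem_edgesIn] at he ⊢
      exact ⟨Finset.mem_univ _, Finset.mem_univ _, he.2.2⟩
    rw [← Finset.sum_subset hsub]
    · exact Finset.sum_congr rfl fun e he => by simp [ha', he]
    · intro e _ he
      simp [ha', he]
  rw [h3] at h2
  refine h2.trans ?_
  have h4 : l2norm f * l2norm f ≤ 1 := by rw [← sq, l2norm_sq]; exact hf1
  have : (0:ℝ) ≤ d := Nat.cast_nonneg d
  nlinarith

lemma bddAbove_localValues {α : ℝ} (hα : 0 < α) {G : SimpleGraph (Fin n)} {d : ℕ}
    (hG : IsRegularGraph G d) (B : Finset (Fin n)) : BddAbove (localValues α (edgesIn G B)) :=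
  ⟨d, fun _ hy => localValues_le hα hG B hy⟩

lemma zero_mem_localValues {α : ℝ} (hα : 0 < α) (S : Finset (UpperPairs n)) :
    (0 : ℝ) ∈ localValues α S :=
  ⟨fun _ => 0, fun _ => 0, fun _ => le_rfl, by simp [Real.zero_rpow hα.ne'], fun _ => le_rfl,
    by simp, by simp⟩

lemma localConst_le {α : ℝ} (hα : 0 < α) {G : SimpleGraph (Fin n)} {d : ℕ}
    (hG : IsRegularGraph G d) (B : Finset (Fin n)) : localConst α (edgesIn G B) ≤ d :=
  csSup_le ⟨0, zero_mem_localValues hα _⟩ fun _ hy => localValues_le hα hG B hy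

/-- A single edge with weight one has top eigenvalue one. -/
lemma one_mem_localValues {α : ℝ} (hα : 0 < α) {S : Finset (UpperPairs n)} {e : UpperPairs n}
    (he : e ∈ S) : (1 : ℝ) ∈ localValues α S := by
  classical
  have hne : e.1.1 ≠ e.1.2 := e.2.ne
  refine ⟨fun e' => if e' = e then 1 else 0,
    fun i => if i = e.1.1 ∨ i = e.1.2 then (Real.sqrt 2)⁻¹ else 0, ?_, ?_, ?_, ?_, ?_⟩
  · intro e'; simp only; split_ifs <;> norm_num
  · have : ∀ e', (if e' = e then (1:ℝ) else 0) ^ α = if e' = e then 1 else 0 := by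
      intro e'; split_ifs
      · simp
      · exact Real.zero_rpow hα.ne'
    simp [this, he]
  · intro i; simp only; split_ifs <;> positivity
  · have : ∀ i, (if i = e.1.1 ∨ i = e.1.2 then (Real.sqrt 2)⁻¹ else 0) ^ 2
        = if i = e.1.1 ∨ i = e.1.2 then (1/2 : ℝ) else 0 := by
      intro i; split_ifs
      · rw [inv_pow, Real.sq_sqrt (by norm_num)]; norm_num
      · simp
    simp only [this]
    rw [← Finset.sum_filter]
    have h2 : (Finset.univ.filter fun i => i = e.1.1 ∨ i = e.1.2) = {e.1.1, e.1.2} := by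
      ext i; simp
    rw [h2, Finset.sum_pair hne]; norm_num
  · simp only [ite_mul, one_mul, zero_mul, Finset.sum_ite_eq', he, if_true, true_or, or_true]
    rw [← mul_inv, Real.mul_self_sqrt (by norm_num)]; norm_num

lemma one_le_localConst {α : ℝ} (hα : 0 < α) {G : SimpleGraph (Fin n)} {d : ℕ}
    (hG : IsRegularGraph G d) (B : Finset (Fin n)) {e : UpperPairs n} (he : e ∈ edgesIn G B) :
    1 ≤ localConst α (edgesIn G B) :=
  le_csSup (bddAbove_localValues hα hG B) (one_mem_localValues hα he)

/-- The variational bound for the quadratic form of a weighted graph, by homogeneity. -/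
lemma two_mul_sum_le_localConst {α : ℝ} (hα : 0 < α) {G : SimpleGraph (Fin n)} {d : ℕ}
    (hG : IsRegularGraph G d) (B : Finset (Fin n)) (w : UpperPairs n → ℝ) (g : Fin n → ℝ) :
    2 * ∑ e ∈ edgesIn G B, w e * (g e.1.1 * g e.1.2)
      ≤ localConst α (edgesIn G B) * (∑ e ∈ edgesIn G B, |w e| ^ α) ^ (1 / α) * l2norm g ^ 2 := by
  classical
  set S := edgesIn G B
  set T := ∑ e ∈ S, |w e| ^ α with hT
  have hT0 : 0 ≤ T := Finset.sum_nonneg fun e _ => Real.rpow_nonneg (abs_nonneg _) _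
  have hL0 : 0 ≤ localConst α S := le_csSup (bddAbove_localValues hα hG B) (zero_mem_localValues hα _)
  have hle : 2 * ∑ e ∈ S, w e * (g e.1.1 * g e.1.2)
      ≤ 2 * ∑ e ∈ S, |w e| * (|g e.1.1| * |g e.1.2|) := by
    refine mul_le_mul_of_nonneg_left (Finset.sum_le_sum fun e _ => ?_) (by norm_num)
    rw [← abs_mul, ← abs_mul]; exact le_abs_self _
  refine hle.trans ?_
  rcases hT0.eq_or_lt with h0 | h0
  · have : ∀ e ∈ S, |w e| = 0 := by
      intro e he
      have := (Finset.sum_eq_zero_iff_of_nonneg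
        (fun e _ => Real.rpow_nonneg (abs_nonneg (w e)) α)).1 h0.symm e he
      exact (Real.rpow_eq_zero (abs_nonneg _) hα.ne').1 this
    rw [Finset.sum_eq_zero fun e he => by rw [this e he, zero_mul], mul_zero]
    exact mul_nonneg (mul_nonneg hL0 (Real.rpow_nonneg hT0 _)) (sq_nonneg _)
  rcases (l2norm_nonneg g).eq_or_lt with h1 | h1
  · have hg : ∀ i, g i = 0 := by
      have h2 := l2norm_sq g
      rw [← h1, zero_pow two_ne_zero] at h2
      intro i
      have := (Finset.sum_eq_zero_iff_of_nonneg (fun i _ => sq_nonneg (g i))).1 h2.symm i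
        (Finset.mem_univ i)
      simpa using this
    simp only [hg, abs_zero, mul_zero, Finset.sum_const_zero, ← h1]
    simp
  set r := T ^ (1 / α) with hr
  have hr0 : 0 < r := Real.rpow_pos_of_pos h0 _
  have hmem : 2 * ∑ e ∈ S, (|w e| / r) * ((|g e.1.1| / l2norm g) * (|g e.1.2| / l2norm g))
      ∈ localValues α S := by
    refine ⟨fun e => |w e| / r, fun i => |g i| / l2norm g, fun e => by positivity, ?_,
      fun i => by positivity, ?_, rfl⟩
    · have : ∀ e, (|w e| / r) ^ α = |w e| ^ α / T := by
        intro e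
        rw [Real.div_rpow (abs_nonneg _) hr0.le, hr, ← Real.rpow_mul hT0, one_div_mul_cancel hα.ne',
          Real.rpow_one]
      simp only [this]
      rw [← Finset.sum_div, ← hT, div_self h0.ne']
    · simp only [div_pow, sq_abs]
      rw [← Finset.sum_div, ← l2norm_sq, div_self (by positivity)]
  have h3 := le_csSup (bddAbove_localValues hα hG B) hmem
  have h4 : 2 * ∑ e ∈ S, |w e| * (|g e.1.1| * |g e.1.2|)
      = (2 * ∑ e ∈ S, (|w e| / r) * ((|g e.1.1| / l2norm g) * (|g e.1.2| / l2norm g)))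
        * (r * l2norm g ^ 2) := by
    rw [mul_assoc, Finset.sum_mul]
    congr 1
    refine Finset.sum_congr rfl fun e _ => ?_
    field_simp
  rw [h4, mul_assoc (localConst α S)]
  exact mul_le_mul_of_nonneg_right h3 (by positivity)

/-- If the weights in a ball dominate a multiple of near-optimal ones, then the top eigenvalue is
large. -/
lemma le_eigenvalue_of_upperBox {G : SimpleGraph (Fin n)} {w : UpperPairs n → ℝ} {l : ℝ}
    (hl : ∀ g : Fin n → ℝ, bilin (wmat G w) g g ≤ l * l2norm g ^ 2) (B : Finset (Fin n))
    {a : UpperPairs n → ℝ} {f : Fin n → ℝ} {t s : ℝ} (ht : 0 < t)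
    (hf : ∀ i, 0 ≤ f i) (hf1 : ∑ i, f i ^ 2 ≤ 1) (hw : ∀ e ∈ edgesIn G B, a e * s ≤ w e)
    (hst : t ≤ s * (2 * ∑ e ∈ edgesIn G B, a e * (f e.1.1 * f e.1.2))) : t ≤ l := by
  classical
  have h1 := hl (restr (B : Set (Fin n)) f)
  rw [bilin_wmat_self_eq G w B _ (fun i hi => restr_apply_not_mem (by simpa using hi))] at h1
  have h2 : s * (2 * ∑ e ∈ edgesIn G B, a e * (f e.1.1 * f e.1.2))
      ≤ 2 * ∑ e ∈ edgesIn G B, w e * (restr (B : Set (Fin n)) f e.1.1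
        * restr (B : Set (Fin n)) f e.1.2) := by
    rw [mul_left_comm, Finset.mul_sum]
    refine mul_le_mul_of_nonneg_left (Finset.sum_le_sum fun e he => ?_) (by norm_num)
    have := mem_edgesIn.1 he
    rw [restr_apply_mem (by simpa using this.1), restr_apply_mem (by simpa using this.2.1)]
    have := mul_le_mul_of_nonneg_right (hw e he) (mul_nonneg (hf e.1.1) (hf e.1.2))
    linarith
  have h3 : l2norm (restr (B : Set (Fin n)) f) ^ 2 ≤ 1 := by
    have h4 := l2norm_restr_le (B : Set (Fin n)) f
    have h5 : l2norm f ^ 2 ≤ 1 := by rw [l2norm_sq]; exact hf1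
    have h6 := l2norm_nonneg (restr (B : Set (Fin n)) f)
    nlinarith
  have h7 : t ≤ l * l2norm (restr (B : Set (Fin n)) f) ^ 2 := by linarith
  have h8 : 0 < l := by
    by_contra hle
    push Not at hle
    nlinarith [sq_nonneg (l2norm (restr (B : Set (Fin n)) f))]
  nlinarith

/-- An eigenvector whose eigenvalue is at least `t` has little mass off a set `I` of exceptional
vertices. A vertex outside `Q` is one whose neighbourhood cannot support an eigenvalue above
`(1 - θ) t`, and `I` is the union of those components of the graph of large weights that lie in `Q`
entirely. -/
lemma l2norm_restr_compl_le_of_localConst {α : ℝ} (hα : 0 < α) {G : SimpleGraph (Fin n)} {d : ℕ}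
    (hG : IsRegularGraph G d) {w : UpperPairs n → ℝ} {τ t θ l : ℝ} {K : ℕ} (hτ : 0 < τ)
    {f : Fin n → ℝ}
    (hf : ∀ i, ∑ j, wmat G w i j * f j = l * f i) (hl : t ≤ l)
    (hT : ∀ v, ∑ e ∈ edgesIn G (gball G K v), |trunc τ (w e)| ^ α < K * τ ^ α)
    (Q : Set (Fin n))
    (hQ : ∀ v, v ∉ Q → localConst α (edgesIn G (gball G K v)) *
      (∑ e ∈ edgesIn G (gball G K v), |trunc τ (w e)| ^ α) ^ (1 / α) ≤ (1 - θ) * t) :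
    ∃ I : Finset (Fin n), (↑I ⊆ Q) ∧
      (θ * t) * l2norm (restr (↑I : Set (Fin n))ᶜ f) ≤ (d * τ) * l2norm f := by
  classical
  set w' : UpperPairs n → ℝ := fun e => trunc τ (w e) with hw'
  have hbig : ∀ e, w' e ≠ 0 → τ ≤ |w' e| := fun e he => le_abs_trunc he
  set H := supportGraph G w' with hH
  let _ : Fintype H.ConnectedComponent := Fintype.ofFinite _
  set c : Fin n → H.ConnectedComponent := H.connectedComponentMk with hc
  set I : Finset (Fin n) := Finset.univ.filter fun v => ∀ u, c u = c v → u ∈ Q with hI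
  have hMc : ∀ i j, wmat G w' i j ≠ 0 → c i = c j := fun i j hij =>
    SimpleGraph.ConnectedComponent.sound (SimpleGraph.Adj.reachable (G := H) hij)
  refine ⟨I, fun v hv => ?_, ?_⟩
  · have : v ∈ I := by simpa using hv
    exact (Finset.mem_filter.1 this).2 v rfl
  have hmemI : ∀ i j, c i = c j → (i ∈ I ↔ j ∈ I) := by
    intro i j hij
    simp only [hI, Finset.mem_filter, Finset.mem_univ, true_and, hij]
  refine l2norm_restr_le_of_gap (M₁ := wmat G fun e => w e - w' e) (M₂ := wmat G w') hf ?_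
    (↑I : Set (Fin n))ᶜ ?_ ?_ ?_
  · intro i j
    simp only [wmat, symEntry]
    split_ifs <;> ring
  · intro i j hi hj
    by_contra hne
    have := hmemI i j (hMc i j hne)
    simp only [Set.mem_compl_iff, Finset.mem_coe, not_not] at hi hj
    exact hi (this.2 hj)
  · intro g h
    exact bilin_wmat_le hG hτ.le _ (fun e => abs_sub_trunc_le hτ.le (w e)) g h
  · refine (bilin_self_le_of_blocks c _ hMc _ ((1 - θ) * t) fun C => ?_).trans ?_
    · set g := restr {i | c i = C} (restr (↑I : Set (Fin n))ᶜ f) with hg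
      by_cases hC : ∃ u, c u = C ∧ u ∉ Q
      · obtain ⟨u, huC, huQ⟩ := hC
        have hsupp : ∀ i, i ∉ gball G K u → g i = 0 := by
          intro i hi
          refine restr_apply_not_mem fun hiC => hi ?_
          have hiC' : c i = C := hiC
          exact mem_gball_of_reachable hα hτ hbig (hT u)
            (SimpleGraph.ConnectedComponent.exact (huC.trans hiC'.symm))
        rw [bilin_wmat_self_eq G w' (gball G K u) g hsupp]
        exact (two_mul_sum_le_localConst hα hG _ w' g).trans
          (mul_le_mul_of_nonneg_right (hQ u huQ) (sq_nonneg _))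
      · push Not at hC
        have hg0 : g = fun _ => 0 := by
          funext i
          by_cases hi : c i = C
          · rw [hg, restr_apply_mem (s := {k | c k = C}) (i := i) hi]
            refine restr_apply_not_mem ?_
            simp only [Set.mem_compl_iff, Finset.mem_coe, not_not, hI, Finset.mem_filter,
              Finset.mem_univ, true_and]
            exact fun u hu => hC u (hu.trans hi)
          · exact restr_apply_not_mem (s := {k | c k = C}) (i := i) hi
        rw [hg0]
        simp [bilin, l2norm]
    · exact mul_le_mul_of_nonneg_right (by linarith) (sq_nonneg _)

end LocalConstant

/-! ### Asymptotic inequalities -/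

section Asymptotics

open Filter Topology

lemma tendsto_mul_rpow_sub_rpow {c p q : ℝ} (hc : 0 < c) (hp : 0 < p) (hq : q < p) (A : ℝ) :
    Tendsto (fun L : ℝ => c * L ^ p - A * L ^ q) atTop atTop := by
  have h1 : Tendsto (fun L : ℝ => c - A * L ^ (-(p - q))) atTop (𝓝 c) := by
    have := (tendsto_rpow_neg_atTop (sub_pos.2 hq)).const_mul A
    simpa using this.const_sub c
  refine (Tendsto.congr' ?_ ((tendsto_rpow_atTop hp).atTop_mul_pos hc h1))
  filter_upwards [eventually_gt_atTop 0] with L hL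
  rw [mul_sub, mul_left_comm, ← Real.rpow_add hL]
  rw [show p + -(p - q) = q by ring]; ring

/-- A stretched exponential beats one with a smaller exponent. -/
lemma eventually_mul_exp_le {c p q δ : ℝ} (hc : 0 < c) (hp : 0 < p) (hq : q < p) (hδ : 0 < δ)
    (A : ℝ) : ∀ᶠ L : ℝ in atTop, A * Real.exp (-(c * L ^ p)) ≤ δ * Real.exp (-L ^ q) := by
  have h1 := tendsto_mul_rpow_sub_rpow hc hp hq 1
  have h2 : Tendsto (fun L : ℝ => A * Real.exp (-(c * L ^ p - 1 * L ^ q))) atTop (𝓝 0) := by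
    simpa using (Real.tendsto_exp_neg_atTop_nhds_zero.comp h1).const_mul A
  filter_upwards [h2.eventually_le_const hδ] with L hL
  have h3 : A * Real.exp (-(c * L ^ p))
      = (A * Real.exp (-(c * L ^ p - 1 * L ^ q))) * Real.exp (-L ^ q) := by
    rw [mul_assoc, ← Real.exp_add]; congr 2; ring
  rw [h3]
  exact mul_le_mul_of_nonneg_right hL (Real.exp_pos _).le

lemma exists_forall_log_of_eventually {p : ℝ → Prop} (h : ∀ᶠ L in atTop, p L) :
    ∃ N : ℕ, 1 ≤ N ∧ ∀ n : ℕ, N ≤ n → p (Real.log n) := by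
  obtain ⟨N, hN⟩ := eventually_atTop.1
    ((Real.tendsto_log_atTop.comp tendsto_natCast_atTop_atTop).eventually h)
  exact ⟨max N 1, le_max_right _ _, fun n hn => hN n ((le_max_left _ _).trans hn)⟩

end Asymptotics

/-! ### Localization on few vertices -/

section AllRegularGraphs

variable {n : ℕ}

/-- The critical level. The weights in a neighbourhood with variational constant `Λ` produce an
eigenvalue `u ^ (1 / α)` with probability about `exp (-u Λ ^ (-α))`, since this requires mass
`u Λ ^ (-α)`. The level `u` at which the expected number of such neighbourhoods is `n ^ ε` exists by
continuity. -/
lemma exists_critical_level (hn : 1 ≤ n) {α ε D : ℝ} (hα : 0 < α) (hε : 0 < ε) (hε1 : ε ≤ 1)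
    (Λ : Fin n → ℝ) (h1 : ∀ v, 1 ≤ Λ v) (hD : ∀ v, Λ v ≤ D) (hD1 : 1 ≤ D) :
    ∃ u : ℝ, (1 - ε) * Real.log n ≤ u ∧ u ≤ D ^ α * Real.log n ∧
      ∑ v, Real.exp (-(u * Λ v ^ (-α))) = Real.exp (ε * Real.log n) := by
  have hn0 : (0 : ℝ) < n := by exact_mod_cast hn
  have hL : 0 ≤ Real.log n := Real.log_nonneg (by exact_mod_cast hn)
  have hb0 : 0 ≤ D ^ α * Real.log n := mul_nonneg (Real.rpow_nonneg (by linarith) _) hL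
  have hcont : ContinuousOn (fun u : ℝ => ∑ v, Real.exp (-(u * Λ v ^ (-α))))
      (Set.Icc 0 (D ^ α * Real.log n)) := by fun_prop
  have hexp : Real.exp (Real.log n) = n := Real.exp_log hn0
  have hmem : Real.exp (ε * Real.log n) ∈ Set.Icc
      (∑ v, Real.exp (-((D ^ α * Real.log n) * Λ v ^ (-α)))) (∑ v, Real.exp (-(0 * Λ v ^ (-α)))) := by
    constructor
    · calc _ ≤ ∑ _v : Fin n, Real.exp (-Real.log n) := by
            refine Finset.sum_le_sum fun v _ => Real.exp_le_exp.2 (neg_le_neg ?_)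
            have h2 : 1 ≤ D ^ α * Λ v ^ (-α) := by
              rw [Real.rpow_neg (by linarith [h1 v]), ← div_eq_mul_inv,
                one_le_div (Real.rpow_pos_of_pos (by linarith [h1 v]) _)]
              exact Real.rpow_le_rpow (by linarith [h1 v]) (hD v) hα.le
            nlinarith
        _ = 1 := by
            rw [Finset.sum_const, Finset.card_univ, Fintype.card_fin, nsmul_eq_mul, Real.exp_neg,
              hexp, mul_inv_cancel₀ hn0.ne']
        _ ≤ _ := Real.one_le_exp (by positivity)
    · simp only [zero_mul, neg_zero, Real.exp_zero, Finset.sum_const, Finset.card_univ,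
        Fintype.card_fin, nsmul_eq_mul, mul_one]
      calc Real.exp (ε * Real.log n) ≤ Real.exp (Real.log n) :=
            Real.exp_le_exp.2 (by nlinarith)
        _ = n := hexp
  obtain ⟨u, hu, hFu⟩ := intermediate_value_Icc' hb0 hcont hmem
  refine ⟨u, ?_, hu.2, hFu⟩
  have h3 : Real.exp (Real.log n - u) ≤ Real.exp (ε * Real.log n) := by
    rw [← hFu, Real.exp_sub, hexp, div_eq_mul_inv, ← Real.exp_neg]
    calc (n : ℝ) * Real.exp (-u) = ∑ _v : Fin n, Real.exp (-u) := by simp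
      _ ≤ _ := by
        refine Finset.sum_le_sum fun v _ => Real.exp_le_exp.2 (neg_le_neg ?_)
        have : Λ v ^ (-α) ≤ 1 := Real.rpow_le_one_of_one_le_of_nonpos (h1 v) (by linarith)
        nlinarith [hu.1]
  have := Real.exp_le_exp.1 h3
  linarith

/-- Independent weights exceed `s a_e` for all `e ∈ S` with probability at least a constant times
`exp (-s ^ α)`. The lower bound `1` on the thresholds keeps them where the tail bounds hold. -/
lemma IsWeibull.prod_tail_ge {α C₁ C₂ : ℝ} {ν : Measure ℝ} (h : IsWeibull α C₁ C₂ ν)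
    (hC₁ : 0 < C₁) {ι : Type*} (S : Finset ι) {D : ℕ} (hD : S.card ≤ D) (a : ι → ℝ)
    (ha : ∀ e, 0 ≤ a e) {s : ℝ} (hs : 0 ≤ s) (hS : ∑ e ∈ S, a e ^ α ≤ 1) :
    (min 1 (C₁ / 2 * Real.exp (-1))) ^ D * Real.exp (-s ^ α)
      ≤ ∏ e ∈ S, ν.real (Set.Ici (max 1 (a e * s))) := by
  set c := min 1 (C₁ / 2 * Real.exp (-1)) with hc
  have hc0 : 0 < c := lt_min one_pos (mul_pos (by linarith) (Real.exp_pos _))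
  have h1 : ∀ e ∈ S, c * Real.exp (-(s ^ α * a e ^ α)) ≤ ν.real (Set.Ici (max 1 (a e * s))) := by
    intro e _
    refine le_trans ?_ (h.upper_tail _ (le_max_left _ _)).1
    have h2 : (max 1 (a e * s)) ^ α ≤ 1 + s ^ α * a e ^ α := by
      have h3 : 0 ≤ s ^ α * a e ^ α :=
        mul_nonneg (Real.rpow_nonneg hs _) (Real.rpow_nonneg (ha e) _)
      rcases le_total (a e * s) 1 with h' | h'
      · rw [max_eq_left h', Real.one_rpow]; linarith
      · rw [max_eq_right h', Real.mul_rpow (ha e) hs]; linarith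
    calc c * Real.exp (-(s ^ α * a e ^ α))
        ≤ (C₁ / 2 * Real.exp (-1)) * Real.exp (-(s ^ α * a e ^ α)) :=
          mul_le_mul_of_nonneg_right (min_le_right _ _) (Real.exp_pos _).le
      _ = C₁ / 2 * Real.exp (-1 + -(s ^ α * a e ^ α)) := by rw [Real.exp_add]; ring
      _ ≤ C₁ / 2 * Real.exp (-(max 1 (a e * s)) ^ α) :=
          mul_le_mul_of_nonneg_left (Real.exp_le_exp.2 (by linarith)) (by linarith)
      _ = _ := by ring
  refine le_trans ?_ (Finset.prod_le_prod (fun e _ => by positivity) h1)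
  rw [Finset.prod_mul_distrib, Finset.prod_const, ← Real.exp_sum, Finset.sum_neg_distrib,
    ← Finset.mul_sum]
  refine mul_le_mul (pow_le_pow_of_le_one hc0.le (min_le_left _ _) hD)
    (Real.exp_le_exp.2 (neg_le_neg ?_)) (Real.exp_pos _).le (by positivity)
  have := Real.rpow_nonneg hs α
  nlinarith

lemma disjoint_edgesIn_of_not_mem_gball {G : SimpleGraph (Fin n)} {K : ℕ} {u v : Fin n}
    (h : u ∉ gball G (K + K) v) : Disjoint (edgesIn G (gball G K u)) (edgesIn G (gball G K v)) := by
  rw [Finset.disjoint_left]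
  intro e h1 h2
  exact h (mem_gball_trans (mem_edgesIn.1 h2).1 (mem_gball_comm.1 (mem_edgesIn.1 h1).1))

lemma exists_mem_edgesIn_gball {G : SimpleGraph (Fin n)} {d : ℕ} (hd : 1 ≤ d)
    (hG : IsRegularGraph G d) {K : ℕ} (hK : 1 ≤ K) (v : Fin n) :
    ∃ e, e ∈ edgesIn G (gball G K v) ∧ v ∈ s(e.1.1, e.1.2) := by
  classical
  have h1 : 0 < (Finset.univ.filter fun u => G.Adj v u).card := by
    have := hG v
    convert (show 0 < d by omega)
  obtain ⟨u, hu⟩ := Finset.card_pos.1 h1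
  have hadj : G.Adj v u := by simpa using hu
  obtain ⟨e, he⟩ := exists_upper_of_ne hadj.ne
  have hv := self_mem_gball G K v
  have hu' := mem_gball_of_adj hK hadj
  refine ⟨e, mem_edgesIn.2 ?_, he ▸ Sym2.mem_mk_left _ _⟩
  rcases Sym2.eq_iff.1 he with ⟨h1, h2⟩ | ⟨h1, h2⟩
  · rw [h1, h2]; exact ⟨hv, hu', hadj⟩
  · rw [h1, h2]; exact ⟨hu', hv, hadj.symm⟩

lemma measurable_sum_trunc (α τ : ℝ) (S : Finset (UpperPairs n)) :
    Measurable fun w : UpperPairs n → ℝ => ∑ e ∈ S, |trunc τ (w e)| ^ α := by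
  have := measurable_trunc τ
  fun_prop

/-- With high probability, the weights in some neighbourhood dominate the multiple of the given
profile `a v` that corresponds to the critical level, by the second moment method: neighbourhoods of
vertices at distance more than `2 K` are independent. -/
lemma measureReal_forall_not_mem_upperBox_le {n : ℕ} {α C₁ C₂ : ℝ} {ν : Measure ℝ}
    (h : IsWeibull α C₁ C₂ ν) (hα : 0 < α) (hC₁ : 0 < C₁) {d : ℕ} {G : SimpleGraph (Fin n)}
    (hG : IsRegularGraph G d) (K : ℕ) (a : Fin n → UpperPairs n → ℝ) (ha : ∀ v e, 0 ≤ a v e)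
    (haS : ∀ v, ∑ e ∈ edgesIn G (gball G K v), a v e ^ α ≤ 1) (Λ : Fin n → ℝ) (hΛ : ∀ v, 1 ≤ Λ v)
    {u F : ℝ} (hu : 0 ≤ u) (hF : ∑ v, Real.exp (-(u * Λ v ^ (-α))) = Real.exp F) :
    (Measure.pi fun _ : UpperPairs n => ν).real {w | ∀ v, w ∉ upperBox (edgesIn G (gball G K v))
        (fun e => max 1 (a v e * (u ^ (1 / α) / Λ v)))}
      ≤ ((d + 1) ^ (K + K) : ℕ) / (min 1 (C₁ / 2 * Real.exp (-1))) ^ (((d + 1) ^ K) ^ 2)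
        * Real.exp (-F) := by
  have := h.isProbabilityMeasure
  set c := (min 1 (C₁ / 2 * Real.exp (-1))) ^ (((d + 1) ^ K) ^ 2) with hc
  have hc0 : 0 < c := pow_pos (lt_min one_pos (mul_pos (by linarith) (Real.exp_pos _))) _
  set μ := Measure.pi fun _ : UpperPairs n => ν
  set A : Fin n → Set (UpperPairs n → ℝ) := fun v => upperBox (edgesIn G (gball G K v))
        (fun e => max 1 (a v e * (u ^ (1 / α) / Λ v))) with hA
  have h1 := measureReal_forall_not_mem_mul_le μ A (fun v => measurableSet_upperBox _ _)
    (fun v => gball G (K + K) v) ((d + 1) ^ (K + K)) (fun v => card_gball_le hG _ v)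
    (fun u v huv => measureReal_upperBox_inter ν _ _ (disjoint_edgesIn_of_not_mem_gball huv) _ _)
  have h2 : c * Real.exp F ≤ ∑ v, μ.real (A v) := by
    rw [← hF, Finset.mul_sum]
    refine Finset.sum_le_sum fun v _ => ?_
    rw [hA]
    simp only
    rw [measureReal_upperBox]
    have hv := hΛ v
    have h3 := h.prod_tail_ge hC₁ (edgesIn G (gball G K v)) (D := ((d + 1) ^ K) ^ 2)
      ((card_edgesIn_le _ _).trans (Nat.pow_le_pow_left (card_gball_le hG K v) 2))
      (a v) (ha v) (s := u ^ (1 / α) / Λ v) (div_nonneg (Real.rpow_nonneg hu _) (by linarith)) (haS v)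
    refine le_trans (le_of_eq ?_) h3
    congr 2
    rw [Real.div_rpow (Real.rpow_nonneg hu _) (by linarith), ← Real.rpow_mul hu,
      one_div_mul_cancel hα.ne', Real.rpow_one, Real.rpow_neg (by linarith), div_eq_mul_inv]
  have h4 : μ.real {w | ∀ v, w ∉ A v} * (c * Real.exp F) ≤ ((d + 1) ^ (K + K) : ℕ) :=
    (mul_le_mul_of_nonneg_left h2 measureReal_nonneg).trans h1
  rw [Real.exp_neg, div_mul_eq_mul_div, ← div_eq_mul_inv, div_div, le_div_iff₀
    (mul_pos (Real.exp_pos _) hc0)]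
  linarith [mul_comm c (Real.exp F)]

set_option maxHeartbeats 1000000 in
/-- On every regular graph, the top eigenvector is with high probability carried by few vertices. -/
theorem exists_localized_of_regular {α : ℝ} (hα : 0 < α) {d : ℕ} (hd : 1 ≤ d) {C₁ C₂ ε : ℝ}
    (hC₁ : 0 < C₁) (hε : 0 < ε) (hε1 : ε ≤ 1) :
    ∃ N : ℕ, ∀ n : ℕ, N ≤ n → ∀ ν : Measure ℝ, IsWeibull α C₁ C₂ ν → ∀ G : SimpleGraph (Fin n),
      IsRegularGraph G d → ∃ Bad : Set (UpperPairs n → ℝ),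
        (Measure.pi fun _ : UpperPairs n => ν).real Bad ≤ Real.exp (-(Real.log n) ^ (1 / 2 : ℝ)) ∧
        ∀ w, w ∉ Bad → ∀ f : Fin n → ℝ, IsTopEigenvector (Matrix.of (wmat G w)) f →
          ∃ I : Finset (Fin n), (I.card : ℝ) ≤ (n : ℝ) ^ ε ∧ IsLocalizedOn ε f I := by
  classical
  have hd0 : (0:ℝ) < d := by exact_mod_cast hd
  have hd1 : (1:ℝ) ≤ d := by exact_mod_cast hd
  -- All estimates lose a factor `1 - θ`, and `θ` is such that these losses together multiply
  -- probabilities by at most `n ^ (ε / 4)`.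
  set ρ := ε / (4 * (d:ℝ) ^ α) with hρ
  have hdα : 1 ≤ (d:ℝ) ^ α := Real.one_le_rpow hd1 hα.le
  have hρ0 : 0 < ρ := by positivity
  set θ := min (1 / 2) (ρ / (1 + 2 * α)) with hθ
  have hθ0 : 0 < θ := lt_min (by norm_num) (by positivity)
  have hθ2 : θ ≤ 1 / 2 := min_le_left _ _
  have hθρ : 1 - ρ ≤ (1 - θ) ^ (1 + 2 * α) := by
    have h1 := one_add_mul_self_le_rpow_one_add (s := -θ) (by linarith) (p := 1 + 2 * α)
      (by linarith)
    have h2 : (1 + 2 * α) * θ ≤ ρ := by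
      have := min_le_right (1 / 2) (ρ / (1 + 2 * α))
      rw [← hθ, le_div_iff₀ (by positivity)] at this
      linarith
    rw [← sub_eq_add_neg] at h1
    linarith
  -- The weights below the truncation level `τ = η (log n) ^ (1 / α)` form a matrix of norm at most
  -- `d τ`, which is at most `ε` times the gap `θ t`.
  set η := ε * θ * (1 / 2) ^ (1 / α) / (2 * d) with hη
  have hη0 : 0 < η := by positivity
  -- A neighbourhood of radius `K` contains mass `K τ ^ α` with probability at most `e / n ^ 2`.
  obtain ⟨K, hK1, hK⟩ : ∃ K : ℕ, 1 ≤ K ∧ 2 ≤ (1 - θ) * (K * η ^ α) := by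
    have hp : 0 < (1 - θ) * η ^ α := mul_pos (by linarith) (Real.rpow_pos_of_pos hη0 _)
    refine ⟨⌈2 / ((1 - θ) * η ^ α)⌉₊ + 1, by omega, ?_⟩
    have := Nat.le_ceil (2 / ((1 - θ) * η ^ α))
    rw [div_le_iff₀ hp] at this
    push_cast
    nlinarith
  set c := (min 1 (C₁ / 2 * Real.exp (-1))) ^ (((d + 1) ^ K) ^ 2) with hc
  set A₁ : ℝ := ((d + 1) ^ (K + K) : ℕ) / c with hA₁
  have hev : ∀ᶠ L : ℝ in Filter.atTop, 1 ≤ L ∧ 1 ≤ η * L ^ (1 / α) ∧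
      ((((d + 1) ^ K) ^ 2 : ℕ) : ℝ) * (2 * Real.exp 1 * C₂ / θ) * Real.exp (-((θ * η ^ α) * L ^ (1:ℝ)))
        ≤ 1 * Real.exp (-L ^ (0:ℝ)) ∧
      A₁ * Real.exp (-((ε / 4) * L ^ (1:ℝ))) ≤ (1/3) * Real.exp (-L ^ (1/2 : ℝ)) ∧
      Real.exp 1 * Real.exp (-((ε / 2) * L ^ (1:ℝ))) ≤ (1/3) * Real.exp (-L ^ (1/2 : ℝ)) ∧
      Real.exp 1 * Real.exp (-(1 * L ^ (1:ℝ))) ≤ (1/3) * Real.exp (-L ^ (1/2 : ℝ)) := by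
    have hηt : Filter.Tendsto (fun L : ℝ => η * L ^ (1 / α)) Filter.atTop Filter.atTop :=
      (tendsto_rpow_atTop (by positivity)).const_mul_atTop hη0
    have hηα : 0 < θ * η ^ α := mul_pos hθ0 (Real.rpow_pos_of_pos hη0 _)
    exact (Filter.eventually_ge_atTop 1).and ((hηt.eventually_ge_atTop 1).and
      ((eventually_mul_exp_le hηα one_pos one_pos one_pos _).and
      ((eventually_mul_exp_le (by positivity) one_pos (by norm_num) (by norm_num) _).and
      ((eventually_mul_exp_le (by positivity) one_pos (by norm_num) (by norm_num) _).and
      (eventually_mul_exp_le one_pos one_pos (by norm_num) (by norm_num) _)))))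
  obtain ⟨N, hN1, hN⟩ := exists_forall_log_of_eventually hev
  refine ⟨N, fun n hn ν hν G hG => ?_⟩
  have := hν.isProbabilityMeasure
  have hC₂ := hν.const_nonneg
  obtain ⟨hL1, hτ1, hb, hp1, hp2, hp3⟩ := hN n hn
  have hn1 : 1 ≤ n := hN1.trans hn
  have hn0 : (0:ℝ) < n := by exact_mod_cast hn1
  set L := Real.log n with hL
  simp only [Real.rpow_one, Real.rpow_zero] at hb hp1 hp2 hp3
  set μ := Measure.pi fun _ : UpperPairs n => ν with hμ
  set τ := η * L ^ (1 / α) with hτ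
  have hτα : τ ^ α = η ^ α * L := by
    rw [hτ, Real.mul_rpow hη0.le (Real.rpow_nonneg (by linarith) _), ← Real.rpow_mul (by linarith),
      one_div_mul_cancel hα.ne', Real.rpow_one]
  set S : Fin n → Finset (UpperPairs n) := fun v => edgesIn G (gball G K v) with hS
  set Λ : Fin n → ℝ := fun v => localConst α (S v) with hΛ
  have hΛ1 : ∀ v, 1 ≤ Λ v := fun v => by
    obtain ⟨e, he, -⟩ := exists_mem_edgesIn_gball hd hG hK1 v
    exact one_le_localConst hα hG _ he
  have hΛd : ∀ v, Λ v ≤ d := fun v => localConst_le hα hG _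
  obtain ⟨u, hu1, hu2, hF⟩ := exists_critical_level hn1 hα (ε := ε / 4) (by positivity)
    (by linarith) Λ hΛ1 hΛd hd1
  have huL : L / 2 ≤ u := by nlinarith
  have hu0 : 0 < u := by linarith
  have hnear : ∀ v, ∃ y ∈ localValues α (S v), (1 - θ) * Λ v < y := fun v =>
    exists_lt_of_lt_csSup ⟨0, zero_mem_localValues hα _⟩
      (show (1 - θ) * Λ v < localConst α (S v) by
        have := hΛ1 v
        change (1 - θ) * Λ v < Λ v
        nlinarith)
  choose y hy hylt using hnear
  choose a g ha haS hg hg1 hyeq using hy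
  -- The lower bound `t` for the top eigenvalue, and the mass `x v` that a neighbourhood needs in
  -- order to support an eigenvalue above `(1 - θ) t`.
  set t := (1 - θ) * u ^ (1 / α) with ht
  have hur : 0 < u ^ (1 / α) := Real.rpow_pos_of_pos hu0 _
  have ht0 : 0 < t := mul_pos (by linarith) hur
  set x : Fin n → ℝ := fun v => ((1 - θ) * t / Λ v) ^ α with hx
  set T : Fin n → (UpperPairs n → ℝ) → ℝ := fun v w => ∑ e ∈ S v, |trunc τ (w e)| ^ α with hT
  -- Exceptional events: no neighbourhood supports the eigenvalue `t` (`N₁`), more than `n ^ ε`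
  -- neighbourhoods have enough mass (`N₂`), or some neighbourhood carries a path of length `K` of
  -- large weights (`N₃`).
  set N₁ : Set (UpperPairs n → ℝ) := {w | ∀ v, w ∉ upperBox (S v)
        (fun e => max 1 (a v e * (u ^ (1 / α) / Λ v)))} with hN₁
  set N₂ : Set (UpperPairs n → ℝ) :=
    {w | Real.exp (ε * L) < ((Finset.univ.filter fun v => w ∈ {w | x v ≤ T v w}).card : ℝ)} with hN₂
  set N₃ : Set (UpperPairs n → ℝ) := ⋃ v, {w | K * τ ^ α ≤ T v w} with hN₃
  have hcher : ∀ v z, μ.real {w | z ≤ T v w} ≤ Real.exp 1 * Real.exp (-((1 - θ) * z)) := by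
    intro v z
    refine hν.measure_sum_trunc_ge_le hα hθ0 (by linarith) hτ1 (S v) ?_ z
    have hcard : ((S v).card : ℝ) ≤ ((((d + 1) ^ K) ^ 2 : ℕ) : ℝ) := by
      exact_mod_cast (card_edgesIn_le _ _).trans (Nat.pow_le_pow_left (card_gball_le hG K v) 2)
    rw [hτα, ← mul_assoc, ← mul_assoc θ]
    refine le_trans ?_ (hb.trans (by rw [one_mul]; exact Real.exp_le_one_iff.2 (by norm_num)))
    refine mul_le_mul_of_nonneg_right (mul_le_mul_of_nonneg_right hcard ?_) (Real.exp_pos _).le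
    positivity
  have hP1 : μ.real N₁ ≤ (1/3) * Real.exp (-L ^ (1/2 : ℝ)) := by
    refine le_trans (measureReal_forall_not_mem_upperBox_le hν hα hC₁ hG K a ha haS Λ hΛ1 hu0.le hF) ?_
    exact hp1
  have hP2 : μ.real N₂ ≤ (1/3) * Real.exp (-L ^ (1/2 : ℝ)) := by
    have h1 := measureReal_card_gt_le μ (fun v => {w | x v ≤ T v w})
      (fun v => measurableSet_le measurable_const (measurable_sum_trunc α τ (S v)))
      (Real.exp_pos (ε * L))
    have h2 : ∀ v, μ.real {w | x v ≤ T v w}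
        ≤ Real.exp 1 * Real.exp ((ε / 4) * L) * Real.exp (-(u * Λ v ^ (-α))) := by
      intro v
      refine (hcher v (x v)).trans ?_
      rw [mul_assoc, ← Real.exp_add (ε / 4 * L)]
      refine mul_le_mul_of_nonneg_left (Real.exp_le_exp.2 ?_) (Real.exp_pos _).le
      have hΛ0 : 0 < Λ v := by linarith [hΛ1 v]
      have hm1 : Λ v ^ (-α) ≤ 1 := Real.rpow_le_one_of_one_le_of_nonpos (hΛ1 v) (by linarith)
      have hm0 : 0 < Λ v ^ (-α) := Real.rpow_pos_of_pos hΛ0 _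
      have hθp : 0 < 1 - θ := by linarith
      have hxv : (1 - θ) * x v = (1 - θ) ^ (1 + 2 * α) * (u * Λ v ^ (-α)) := by
        have e1 : (1 - θ) * t / Λ v = (1 - θ) ^ (2:ℝ) * u ^ (1 / α) * (Λ v)⁻¹ := by
          rw [ht, div_eq_mul_inv, show (2:ℝ) = ((2:ℕ):ℝ) by norm_num, Real.rpow_natCast]; ring
        rw [hx]
        simp only
        rw [e1, Real.mul_rpow (by positivity) (by positivity), Real.mul_rpow (by positivity)
          (by positivity), ← Real.rpow_mul hθp.le, ← Real.rpow_mul hu0.le, one_div_mul_cancel hα.ne',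
          Real.rpow_one, Real.inv_rpow hΛ0.le, ← Real.rpow_neg hΛ0.le, Real.rpow_add hθp,
          Real.rpow_one]
        ring
      rw [hxv]
      have h3 : u * Λ v ^ (-α) ≤ (d:ℝ) ^ α * L := by nlinarith
      have h4 : ρ * ((d:ℝ) ^ α * L) = ε / 4 * L := by rw [hρ]; field_simp
      have h5 := mul_le_mul_of_nonneg_left h3 hρ0.le
      have h6 := mul_le_mul_of_nonneg_right hθρ (mul_pos hu0 hm0).le
      nlinarith
    refine le_trans (h1.trans ?_) hp2
    rw [div_le_iff₀ (Real.exp_pos _)]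
    refine (Finset.sum_le_sum fun v _ => h2 v).trans ?_
    rw [← Finset.mul_sum, hF, mul_assoc, mul_assoc, ← Real.exp_add (ε / 4 * L),
      ← Real.exp_add (-(ε / 2 * L))]
    exact mul_le_mul_of_nonneg_left (Real.exp_le_exp.2 (by linarith)) (Real.exp_pos _).le
  have hP3 : μ.real N₃ ≤ (1/3) * Real.exp (-L ^ (1/2 : ℝ)) := by
    refine le_trans ((measureReal_iUnion_fintype_le _).trans ?_) hp3
    calc ∑ v, μ.real {w | K * τ ^ α ≤ T v w} ≤ ∑ _v : Fin n, Real.exp 1 * Real.exp (-(2 * L)) := by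
          refine Finset.sum_le_sum fun v _ => (hcher v _).trans ?_
          refine mul_le_mul_of_nonneg_left (Real.exp_le_exp.2 (neg_le_neg ?_)) (Real.exp_pos _).le
          rw [hτα]
          nlinarith
      _ = Real.exp 1 * (Real.exp L * Real.exp (-(2 * L))) := by
          rw [hL, Real.exp_log hn0, Finset.sum_const, Finset.card_univ, Fintype.card_fin,
            nsmul_eq_mul]; ring
      _ = _ := by rw [← Real.exp_add]; congr 2; ring
  refine ⟨N₁ ∪ N₂ ∪ N₃, ?_, fun w hw f hf => ?_⟩
  · have h1 := measureReal_union_le (μ := μ) (N₁ ∪ N₂) N₃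
    have h2 := measureReal_union_le (μ := μ) N₁ N₂
    linarith
  · simp only [Set.mem_union, not_or] at hw
    obtain ⟨⟨hw1, hw2⟩, hw3⟩ := hw
    obtain ⟨l, hfl, hl⟩ := hf.exists_eigenvalue (by ext i j; exact wmat_comm G w j i)
    have htl : t ≤ l := by
      simp only [hN₁, Set.mem_ofPred_eq, not_forall, not_not] at hw1
      obtain ⟨v, hv⟩ := hw1
      have hΛ0 : 0 < Λ v := by linarith [hΛ1 v]
      refine le_eigenvalue_of_upperBox hl (gball G K v) (a := a v) (f := g v)
        (s := u ^ (1 / α) / Λ v) ht0 (hg v) (hg1 v) (fun e he => (le_max_right _ _).trans (hv e he)) ?_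
      have h1 := hylt v
      rw [hyeq v] at h1
      calc t = u ^ (1 / α) / Λ v * ((1 - θ) * Λ v) := by rw [ht]; field_simp
        _ ≤ _ := mul_le_mul_of_nonneg_left h1.le (by positivity)
    have hT3 : ∀ v, T v w < K * τ ^ α := by
      intro v
      by_contra hle
      push Not at hle
      exact hw3 (Set.mem_iUnion.2 ⟨v, hle⟩)
    obtain ⟨I, hIQ, hI⟩ := l2norm_restr_compl_le_of_localConst hα hG (τ := τ) (t := t) (θ := θ)
      (by linarith) hfl htl hT3 {v | x v ≤ T v w} (by
        intro v hv
        have hΛ0 : 0 < Λ v := by linarith [hΛ1 v]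
        simp only [Set.mem_ofPred_eq, not_le] at hv
        have hT0 : 0 ≤ T v w := Finset.sum_nonneg fun e _ => Real.rpow_nonneg (abs_nonneg _) _
        have hb0 : 0 ≤ (1 - θ) * t / Λ v := div_nonneg (mul_nonneg (by linarith) ht0.le) hΛ0.le
        have h1 : (T v w) ^ (1 / α) ≤ (1 - θ) * t / Λ v := by
          calc _ ≤ (x v) ^ (1 / α) := Real.rpow_le_rpow hT0 hv.le (by positivity)
            _ = _ := by
              rw [hx]
              simp only
              rw [← Real.rpow_mul hb0, mul_one_div_cancel hα.ne', Real.rpow_one]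
        calc Λ v * (T v w) ^ (1 / α) ≤ Λ v * ((1 - θ) * t / Λ v) :=
              mul_le_mul_of_nonneg_left h1 hΛ0.le
          _ = _ := by field_simp)
    refine ⟨I, ?_, isLocalizedOn_of_compl I ?_⟩
    · simp only [hN₂, Set.mem_ofPred_eq, not_lt] at hw2
      rw [Real.rpow_def_of_pos hn0, mul_comm, ← hL]
      refine le_trans ?_ hw2
      exact_mod_cast Finset.card_le_card fun i hi => by
        simpa using hIQ (by simpa using hi)
    · have h1 : (d:ℝ) * τ ≤ ε * (θ * t) := by
        have h2 : (L / 2) ^ (1 / α) ≤ u ^ (1 / α) :=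
          Real.rpow_le_rpow (by linarith) huL (by positivity)
        have h3 : (L / 2) ^ (1 / α) = L ^ (1 / α) * (1 / 2) ^ (1 / α) := by
          rw [← Real.mul_rpow (by linarith) (by norm_num)]; congr 1; ring
        have h4 : (d:ℝ) * τ = ε * θ * ((1 / 2) * (L / 2) ^ (1 / α)) := by
          rw [h3, hτ, hη]; field_simp
        rw [h4, ht, mul_assoc ε]
        refine mul_le_mul_of_nonneg_left (mul_le_mul_of_nonneg_left ?_ hθ0.le) hε.le
        exact mul_le_mul (by linarith) h2 (by positivity) (by linarith)
      have hθt : 0 < θ * t := mul_pos hθ0 ht0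
      have h5 : l2norm (restr (↑I : Set (Fin n))ᶜ f) ≤ ε * l2norm f := by
        have h6 := mul_le_mul_of_nonneg_right h1 (l2norm_nonneg f)
        have h7 : (θ * t) * l2norm (restr (↑I : Set (Fin n))ᶜ f) ≤ (θ * t) * (ε * l2norm f) := by
          linarith
        exact le_of_mul_le_mul_left h7 hθt
      have h8 := l2norm_nonneg (restr (↑I : Set (Fin n))ᶜ f)
      calc _ ≤ (ε * l2norm f) ^ 2 := pow_le_pow_left₀ h8 h5 2
        _ = ε * (ε * l2norm f ^ 2) := by ring
        _ ≤ 1 * (ε * l2norm f ^ 2) := mul_le_mul_of_nonneg_right hε1 (by positivity)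
        _ = _ := one_mul _

end AllRegularGraphs

/-! ### Short cycles in random regular graphs -/

section Switching

variable {n : ℕ}

/-- The `d`-regular graphs which contain all edges in `H`. -/
noncomputable def regularContaining (n d : ℕ) (H : Finset (Sym2 (Fin n))) :
    Finset (SimpleGraph (Fin n)) :=
  open Classical in Finset.univ.filter fun G => IsRegularGraph G d ∧ (↑H : Set (Sym2 (Fin n))) ⊆ G.edgeSet

lemma mem_regularContaining {d : ℕ} {H : Finset (Sym2 (Fin n))} {G : SimpleGraph (Fin n)} :
    G ∈ regularContaining n d H ↔ IsRegularGraph G d ∧ (↑H : Set (Sym2 (Fin n))) ⊆ G.edgeSet := by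
  simp [regularContaining]

/-- The graph `G` with the edges `uv` and `xy` replaced by `ux` and `vy`. -/
def switchEdges (G : SimpleGraph (Fin n)) (u v x y : Fin n) : SimpleGraph (Fin n) :=
  SimpleGraph.fromEdgeSet ((G.edgeSet \ {s(u, v), s(x, y)}) ∪ {s(u, x), s(v, y)})

/-- The edges `uv` and `xy` of `G` can be replaced by `ux` and `vy`: the new pairs are neither
degenerate nor edges already. -/
structure Switchable (G : SimpleGraph (Fin n)) (u v x y : Fin n) : Prop where
  adj_uv : G.Adj u v
  adj_xy : G.Adj x y
  ne_ux : u ≠ x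
  not_adj_ux : ¬ G.Adj u x
  ne_vy : v ≠ y
  not_adj_vy : ¬ G.Adj v y

lemma Switchable.ne_edges {G : SimpleGraph (Fin n)} {u v x y : Fin n} (h : Switchable G u v x y) :
    s(u, v) ≠ s(x, y) ∧ s(u, x) ≠ s(v, y) := by
  constructor
  · intro he
    rcases Sym2.eq_iff.1 he with ⟨h1, -⟩ | ⟨-, h2⟩
    · exact h.ne_ux h1
    · exact h.not_adj_ux (h2 ▸ h.adj_uv)
  · intro he
    rcases Sym2.eq_iff.1 he with ⟨h1, -⟩ | ⟨-, h2⟩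
    · exact h.adj_uv.ne h1
    · exact h.not_adj_ux (h2 ▸ h.adj_uv)

lemma Switchable.edgeSet_switchEdges {G : SimpleGraph (Fin n)} {u v x y : Fin n}
    (h : Switchable G u v x y) :
    (switchEdges G u v x y).edgeSet = (G.edgeSet \ {s(u, v), s(x, y)}) ∪ {s(u, x), s(v, y)} := by
  rw [switchEdges, SimpleGraph.edgeSet_fromEdgeSet]
  refine sdiff_eq_left.2 (Set.disjoint_left.2 ?_)
  rintro e (he | he) hd
  · exact G.not_isDiag_of_mem_edgeSet he.1 hd
  · rcases he with rfl | he
    · exact h.ne_ux hd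
    · rw [Set.mem_singleton_iff] at he
      subst he
      exact h.ne_vy hd

lemma sum_boole_eq_sym2 (i a b : Fin n) (hab : a ≠ b) :
    ∑ j, (if s(i, j) = s(a, b) then 1 else 0) = (if i = a then 1 else 0) + (if i = b then 1 else 0) := by
  have h : ∀ j, (if s(i, j) = s(a, b) then 1 else 0)
      = (if j = b then (if i = a then 1 else 0) else 0)
        + (if j = a then (if i = b then 1 else 0) else 0) := by
    intro j
    simp only [Sym2.eq_iff]
    by_cases h1 : i = a
    · subst h1
      simp [hab]
    · by_cases h2 : i = b
      · subst h2; simp [h1]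
      · simp [h1, h2]
  simp only [h, Finset.sum_add_distrib, Finset.sum_ite_eq', Finset.mem_univ, if_true]

open Classical in
lemma boole_mem_sdiff_union {β : Type*} (E : Set β) {a b c d : β} (ha : a ∈ E) (hb : b ∈ E)
    (hc : c ∉ E) (hd : d ∉ E) (hab : a ≠ b) (hcd : c ≠ d) (e : β) :
    (if e ∈ (E \ {a, b}) ∪ {c, d} then 1 else 0) + ((if e = a then 1 else 0) + (if e = b then 1 else 0))
      = (if e ∈ E then 1 else 0) + ((if e = c then 1 else 0) + (if e = d then 1 else 0)) := by
  by_cases c1 : e = a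
  · subst c1
    have h1 : e ≠ c := fun h' => hc (h' ▸ ha)
    have h2 : e ≠ d := fun h' => hd (h' ▸ ha)
    simp [ha, hab, h1, h2]
  by_cases c2 : e = b
  · subst c2
    have h1 : e ≠ c := fun h' => hc (h' ▸ hb)
    have h2 : e ≠ d := fun h' => hd (h' ▸ hb)
    simp [hb, hab.symm, h1, h2]
  by_cases c3 : e = c
  · subst c3; simp [hc, hcd, c1, c2]
  by_cases c4 : e = d
  · subst c4; simp [hd, hcd.symm, c1, c2]
  simp [c1, c2, c3, c4]

lemma Switchable.isRegularGraph {G : SimpleGraph (Fin n)} {u v x y : Fin n}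
    (h : Switchable G u v x y) {d : ℕ} (hG : IsRegularGraph G d) :
    IsRegularGraph (switchEdges G u v x y) d := by
  classical
  intro i
  have hGi := hG i
  rw [Finset.card_filter] at hGi ⊢
  have key : ∀ j, (if (switchEdges G u v x y).Adj i j then 1 else 0)
      + ((if s(i, j) = s(u, v) then 1 else 0) + (if s(i, j) = s(x, y) then 1 else 0))
      = (if G.Adj i j then 1 else 0)
      + ((if s(i, j) = s(u, x) then 1 else 0) + (if s(i, j) = s(v, y) then 1 else 0)) := by
    intro j
    obtain ⟨h5, h6⟩ := h.ne_edges
    have h7 : (switchEdges G u v x y).Adj i j ↔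
        s(i, j) ∈ (G.edgeSet \ {s(u, v), s(x, y)}) ∪ {s(u, x), s(v, y)} := by
      rw [← h.edgeSet_switchEdges, SimpleGraph.mem_edgeSet]
    have h8 := boole_mem_sdiff_union G.edgeSet (a := s(u, v)) (b := s(x, y)) (c := s(u, x))
      (d := s(v, y)) h.adj_uv h.adj_xy h.not_adj_ux h.not_adj_vy h5 h6 s(i, j)
    simp only [← h7, SimpleGraph.mem_edgeSet] at h8
    convert h8
  have hsum := Finset.sum_congr rfl fun j (_ : j ∈ Finset.univ) => key j
  simp only [Finset.sum_add_distrib, sum_boole_eq_sym2 _ _ _ h.adj_uv.ne,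
    sum_boole_eq_sym2 _ _ _ h.adj_xy.ne, sum_boole_eq_sym2 _ _ _ h.ne_ux,
    sum_boole_eq_sym2 _ _ _ h.ne_vy] at hsum
  omega

/-- The number of directed edges starting in `s`. -/
lemma card_adj_pairs {G : SimpleGraph (Fin n)} {d : ℕ} (hG : IsRegularGraph G d) (s : Finset (Fin n)) :
    open Classical in
    (Finset.univ.filter fun p : Fin n × Fin n => G.Adj p.1 p.2 ∧ p.1 ∈ s).card = s.card * d := by
  classical
  rw [Finset.card_filter, Fintype.sum_prod_type]
  have h1 : ∀ i, ∑ j, (if G.Adj i j ∧ i ∈ s then 1 else 0) = if i ∈ s then d else 0 := by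
    intro i
    by_cases hi : i ∈ s
    · simp only [hi, and_true, if_true]
      rw [← Finset.card_filter]
      convert hG i
    · simp [hi]
  simp only [h1]
  rw [← Finset.sum_filter]
  simp

/-- The number of directed edges available for a switching at `uv` that keeps the edges in `H`: a
directed edge `xy` is excluded only if `x` is `u` or a neighbour of it, `y` is `v` or a neighbour of
it, or `xy` is in `H`. -/
lemma le_card_switchable {G : SimpleGraph (Fin n)} {d : ℕ} (hG : IsRegularGraph G d) {u v : Fin n}
    (huv : G.Adj u v) (H : Finset (Sym2 (Fin n))) :
    open Classical in
    n * d ≤ (Finset.univ.filter fun p : Fin n × Fin n =>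
      Switchable G u v p.1 p.2 ∧ s(p.1, p.2) ∉ H).card + 2 * (d * (d + 1)) + 2 * H.card := by
  classical
  have hall := card_adj_pairs hG Finset.univ
  rw [Finset.card_univ, Fintype.card_fin] at hall
  rw [← hall]
  set N : Fin n → Finset (Fin n) := fun a => insert a (Finset.univ.filter fun b => G.Adj a b) with hN
  have hNc : ∀ a, (N a).card ≤ d + 1 := by
    intro a
    refine (Finset.card_insert_le _ _).trans ?_
    have : (Finset.univ.filter fun b => G.Adj a b).card = d := by convert hG a
    omega
  set P := Finset.univ.filter fun p : Fin n × Fin n =>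
      Switchable G u v p.1 p.2 ∧ s(p.1, p.2) ∉ H with hP
  set Q₁ := Finset.univ.filter fun p : Fin n × Fin n => G.Adj p.1 p.2 ∧ p.1 ∈ N u with hQ₁
  set Q₂ := (Finset.univ.filter fun p : Fin n × Fin n => G.Adj p.1 p.2 ∧ p.1 ∈ N v).image Prod.swap
    with hQ₂
  set Q₃ := H.biUnion fun e => Finset.univ.filter fun p : Fin n × Fin n => s(p.1, p.2) = e with hQ₃
  have hsub : (Finset.univ.filter fun p : Fin n × Fin n => G.Adj p.1 p.2 ∧ p.1 ∈ Finset.univ)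
      ⊆ ((P ∪ Q₁) ∪ Q₂) ∪ Q₃ := by
    rintro ⟨x, y⟩ hp
    simp only [Finset.mem_filter, Finset.mem_univ, true_and, and_true] at hp
    by_cases h1 : x ∈ N u
    · refine Finset.mem_union_left _ (Finset.mem_union_left _ (Finset.mem_union_right _ ?_))
      simp [hQ₁, hp, h1]
    by_cases h2 : y ∈ N v
    · refine Finset.mem_union_left _ (Finset.mem_union_right _ ?_)
      exact Finset.mem_image.2 ⟨(y, x), by simp [hp.symm, h2], rfl⟩
    by_cases h3 : s(x, y) ∈ H
    · refine Finset.mem_union_right _ ?_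
      exact Finset.mem_biUnion.2 ⟨_, h3, by simp⟩
    · refine Finset.mem_union_left _ (Finset.mem_union_left _ (Finset.mem_union_left _ ?_))
      simp only [hN, Finset.mem_insert, Finset.mem_filter, Finset.mem_univ, true_and, not_or] at h1 h2
      simp only [hP, Finset.mem_filter, Finset.mem_univ, true_and]
      exact ⟨⟨huv, hp, fun h => h1.1 h.symm, h1.2, fun h => h2.1 h.symm, h2.2⟩, h3⟩
  have c1 : Q₁.card ≤ d * (d + 1) := by
    rw [hQ₁, card_adj_pairs hG, mul_comm]
    exact Nat.mul_le_mul_left _ (hNc u)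
  have c2 : Q₂.card ≤ d * (d + 1) := by
    refine Finset.card_image_le.trans ?_
    rw [card_adj_pairs hG, mul_comm]
    exact Nat.mul_le_mul_left _ (hNc v)
  have c3 : Q₃.card ≤ 2 * H.card := by
    rw [mul_comm]
    refine Finset.card_biUnion_le_card_mul _ _ _ fun e _ => ?_
    induction e using Sym2.ind with
    | _ a b =>
      have : (Finset.univ.filter fun p : Fin n × Fin n => s(p.1, p.2) = s(a, b))
          ⊆ {(a, b), (b, a)} := by
        rintro ⟨x, y⟩ hp
        simp only [Finset.mem_filter, Finset.mem_univ, true_and, Sym2.eq_iff] at hp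
        simp only [Finset.mem_insert, Finset.mem_singleton, Prod.mk.injEq]
        exact hp
      exact (Finset.card_le_card this).trans Finset.card_le_two
  have h0 := Finset.card_le_card hsub
  have h1 := Finset.card_union_le ((P ∪ Q₁) ∪ Q₂) Q₃
  have h2 := Finset.card_union_le (P ∪ Q₁) Q₂
  have h3 := Finset.card_union_le P Q₁
  omega

/-- The switching inequality: prescribing one more edge cuts the number of regular graphs down by a
factor of order `n`. Pairs of a graph containing `uv` and a switching at `uv` inject into pairs of a
graph and two of its edges `ux`, `vy`. -/
lemma card_regularContaining_insert_mul_le {d : ℕ} {H : Finset (Sym2 (Fin n))} {u v : Fin n}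
    (he : s(u, v) ∉ H) :
    (regularContaining n d (insert s(u, v) H)).card * (n * d)
      ≤ (regularContaining n d (insert s(u, v) H)).card * (2 * (d * (d + 1)) + 2 * H.card)
        + (regularContaining n d H).card * d ^ 2 := by
  classical
  set 𝒜 := regularContaining n d (insert s(u, v) H) with h𝒜
  set ℬ := regularContaining n d H with hℬ
  set X : SimpleGraph (Fin n) → Finset (Fin n × Fin n) := fun G =>
    Finset.univ.filter fun p : Fin n × Fin n => Switchable G u v p.1 p.2 ∧ s(p.1, p.2) ∉ H with hX
  set Y : SimpleGraph (Fin n) → Finset (Fin n × Fin n) := fun G =>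
    (Finset.univ.filter fun x => G.Adj u x) ×ˢ (Finset.univ.filter fun y => G.Adj v y) with hY
  have hA : ∀ G ∈ 𝒜, IsRegularGraph G d ∧ G.Adj u v ∧ (↑H : Set (Sym2 (Fin n))) ⊆ G.edgeSet := by
    intro G hG
    obtain ⟨h1, h2⟩ := mem_regularContaining.1 hG
    exact ⟨h1, h2 (Finset.mem_coe.2 (Finset.mem_insert_self _ _)),
      fun e he => h2 (Finset.mem_coe.2 (Finset.mem_insert_of_mem (Finset.mem_coe.1 he)))⟩
  have hcard : (𝒜.sigma X).card ≤ (ℬ.sigma Y).card := by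
    refine Finset.card_le_card_of_injOn
      (fun q => ⟨switchEdges q.1 u v q.2.1 q.2.2, q.2⟩) ?_ ?_
    · rintro ⟨G, x, y⟩ hq
      simp only [Finset.mem_coe, Finset.mem_sigma, hX, Finset.mem_filter, Finset.mem_univ,
        true_and] at hq
      obtain ⟨hG, hs, hxy⟩ := hq
      obtain ⟨hreg, huv, hH⟩ := hA G hG
      simp only [Finset.mem_coe, Finset.mem_sigma, hY, Finset.mem_product, Finset.mem_filter,
        Finset.mem_univ, true_and]
      refine ⟨mem_regularContaining.2 ⟨hs.isRegularGraph hreg, fun e heH => ?_⟩, ?_, ?_⟩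
      · rw [hs.edgeSet_switchEdges]
        refine Or.inl ⟨hH heH, ?_⟩
        rintro (rfl | h')
        · exact he (by simpa using heH)
        · rw [Set.mem_singleton_iff] at h'
          subst h'
          exact hxy (by simpa using heH)
      · rw [← SimpleGraph.mem_edgeSet, hs.edgeSet_switchEdges]; simp
      · rw [← SimpleGraph.mem_edgeSet, hs.edgeSet_switchEdges]; simp
    · rintro ⟨G, x, y⟩ hq ⟨G', x', y'⟩ hq' heq
      simp only [Sigma.mk.injEq, heq_eq_eq, Prod.mk.injEq] at heq
      obtain ⟨h1, rfl, rfl⟩ := heq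
      simp only [Finset.mem_coe, Finset.mem_sigma, hX, Finset.mem_filter, Finset.mem_univ,
        true_and] at hq hq'
      -- The original graph is recovered by reversing the switching.
      have hrec : ∀ G : SimpleGraph (Fin n), Switchable G u v x y → G.edgeSet =
          ((switchEdges G u v x y).edgeSet \ {s(u, x), s(v, y)}) ∪ {s(u, v), s(x, y)} := by
        intro G hs
        rw [hs.edgeSet_switchEdges]
        have h1 : s(u, v) ∈ G.edgeSet := hs.adj_uv
        have h2 : s(x, y) ∈ G.edgeSet := hs.adj_xy
        have h3 : s(u, x) ∉ G.edgeSet := hs.not_adj_ux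
        have h4 : s(v, y) ∉ G.edgeSet := hs.not_adj_vy
        ext e
        simp only [Set.mem_union, Set.mem_sdiff, Set.mem_insert_iff, Set.mem_singleton_iff, not_or]
        constructor
        · intro heG
          by_cases c1 : e = s(u, v)
          · exact Or.inr (Or.inl c1)
          by_cases c2 : e = s(x, y)
          · exact Or.inr (Or.inr c2)
          · exact Or.inl ⟨Or.inl ⟨heG, c1, c2⟩, fun h => h3 (h ▸ heG), fun h => h4 (h ▸ heG)⟩
        · rintro (⟨h | h, h'⟩ | h | h)
          · exact h.1
          · rcases h with h | h
            · exact absurd h h'.1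
            · exact absurd h h'.2
          · exact h ▸ h1
          · exact h ▸ h2
      have : G = G' := by
        rw [← SimpleGraph.edgeSet_inj, hrec G hq.2.1, hrec G' hq'.2.1, h1]
      rw [this]
  have hY' : (ℬ.sigma Y).card = ℬ.card * d ^ 2 := by
    rw [Finset.card_sigma]
    have : ∀ G ∈ ℬ, (Y G).card = d ^ 2 := by
      intro G hG
      have hreg := (mem_regularContaining.1 hG).1
      rw [hY, Finset.card_product, sq]
      have h1 : (Finset.univ.filter fun x => G.Adj u x).card = d := by convert hreg u
      have h2 : (Finset.univ.filter fun x => G.Adj v x).card = d := by convert hreg v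
      rw [h1, h2]
    rw [Finset.sum_congr rfl this, Finset.sum_const, smul_eq_mul]
  rw [← hY']
  refine le_trans ?_ (Nat.add_le_add_left hcard _)
  rw [Finset.card_sigma, ← smul_eq_mul, ← smul_eq_mul (a := 𝒜.card), ← Finset.sum_const, ← Finset.sum_const,
    ← Finset.sum_add_distrib]
  refine Finset.sum_le_sum fun G hG => ?_
  obtain ⟨hreg, huv, -⟩ := hA G hG
  have := le_card_switchable hreg huv H
  simp only [hX]
  omega

/-- The probability that a random regular graph contains a given set of `m` edges is at most
`(2 d / n) ^ m`. -/
lemma card_regularContaining_le {d : ℕ} (hd : 1 ≤ d) (H : Finset (Sym2 (Fin n)))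
    (hn : 4 * (d + 1) + 4 * H.card ≤ n) :
    ((regularContaining n d H).card : ℝ)
      ≤ (2 * d / n) ^ H.card * (regularContaining n d ∅).card := by
  classical
  induction H using Finset.induction_on with
  | empty => simp
  | insert e H he ih =>
    rw [Finset.card_insert_of_notMem he] at hn ⊢
    have ih' := ih (by omega)
    have hn0 : (0:ℝ) < n := by
      have : 0 < n := by omega
      exact_mod_cast this
    have hd0 : (0:ℝ) < d := by exact_mod_cast hd
    induction e using Sym2.ind with
    | _ u v =>
      have h1 := card_regularContaining_insert_mul_le (d := d) he
      set a := (regularContaining n d (insert s(u, v) H)).card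
      set b := (regularContaining n d H).card
      have h2 : 2 * (2 * (d * (d + 1)) + 2 * H.card) ≤ n * d := by nlinarith
      have h3 : a * n * d ≤ 2 * d * b * d := by nlinarith
      have h4 : a * n ≤ 2 * d * b := Nat.le_of_mul_le_mul_right h3 hd
      have h5 : (a : ℝ) * n ≤ 2 * d * b := by exact_mod_cast h4
      calc (a : ℝ) ≤ 2 * d / n * b := by
            rw [div_mul_eq_mul_div, le_div_iff₀ hn0]; exact h5
        _ ≤ 2 * d / n * ((2 * d / n) ^ H.card * (regularContaining n d ∅).card) :=
            mul_le_mul_of_nonneg_left ih' (by positivity)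
        _ = _ := by ring

/-- The vertices on cycles of length at most `k`. -/
noncomputable def shortCycleVerts (G : SimpleGraph (Fin n)) (k : ℕ) : Finset (Fin n) :=
  open Classical in Finset.univ.filter fun u => ∃ p : G.Walk u u, p.IsCycle ∧ p.length ≤ k

/-- The edges of the closed walk through the vertices `c 0, c 1, …, c m, c 0`; addition in
`Fin (m + 1)` is cyclic. -/
def closedWalkEdges {m : ℕ} (c : Fin (m + 1) → Fin n) : Finset (Sym2 (Fin n)) :=
  Finset.univ.image fun i => s(c i, c (i + 1))

/-- A cycle through `u` visits a sequence of vertices starting at `u`, with as many distinct edges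
as vertices. -/
lemma exists_closedWalkEdges_of_isCycle {G : SimpleGraph (Fin n)} {u : Fin n} (p : G.Walk u u)
    (hp : p.IsCycle) : ∃ (m : ℕ) (c : Fin (m + 1) → Fin n), p.length = m + 1 ∧ c 0 = u ∧
      (closedWalkEdges c).card = m + 1 ∧ (↑(closedWalkEdges c) : Set (Sym2 (Fin n))) ⊆ G.edgeSet := by
  classical
  have h3 := hp.three_le_length
  obtain ⟨m, hm⟩ : ∃ m, p.length = m + 1 := ⟨p.length - 1, by omega⟩
  have hedge : ∀ i : Fin (m + 1), p.getVert (i + 1 : Fin (m + 1)) = p.getVert ((i : ℕ) + 1) := by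
    intro i
    rcases Nat.lt_or_ge ((i : ℕ) + 1) (m + 1) with h | h
    · rw [Fin.val_add_one_of_lt (by rw [Fin.lt_def, Fin.val_last]; omega)]
    · have hi : i = Fin.last m := by
        ext; rw [Fin.val_last]; omega
      subst hi
      have h1 : p.getVert (m + 1) = u := by rw [← hm, SimpleGraph.Walk.getVert_length]
      rw [Fin.last_add_one, Fin.val_last, h1]
      simp
  have himg : closedWalkEdges (fun i : Fin (m + 1) => p.getVert i) = p.edges.toFinset := by
    ext e
    simp only [closedWalkEdges, Finset.mem_image, Finset.mem_univ, true_and, List.mem_toFinset, hedge]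
    induction e using Sym2.ind with
    | _ a b =>
      rw [SimpleGraph.Walk.mk_mem_edges_iff_exists]
      constructor
      · rintro ⟨i, hi⟩
        exact ⟨i, by omega, hi⟩
      · rintro ⟨i, hi, h⟩
        exact ⟨⟨i, by omega⟩, h⟩
  refine ⟨m, fun i => p.getVert i, hm, by simp, ?_, ?_⟩
  · rw [himg, List.toFinset_card_of_nodup hp.isTrail.edges_nodup, SimpleGraph.Walk.length_edges, hm]
  · intro e he
    rw [himg] at he
    exact p.edges_subset_edgeSet (List.mem_toFinset.1 he)

/-- The expected number of vertices on cycles of length at most `k` in a random regular graph is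
bounded independently of `n`: there are `n ^ m` possible cycles of length `m`, and each is present
with probability at most `(2 d / n) ^ m`. -/
lemma sum_card_shortCycleVerts_le {d : ℕ} (hd : 1 ≤ d) (k : ℕ) (hn : 4 * (d + 1) + 4 * k ≤ n) :
    ∑ G ∈ regularContaining n d ∅, ((shortCycleVerts G k).card : ℝ)
      ≤ k * (2 * d : ℝ) ^ k * (regularContaining n d ∅).card := by
  classical
  have hn0 : (0:ℝ) < n := by
    have : 0 < n := by omega
    exact_mod_cast this
  have hd1 : (1:ℝ) ≤ d := by exact_mod_cast hd
  -- Vertex sequences of length `m + 1` whose closed walk has `m + 1` distinct edges.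
  set 𝒞 : (m : ℕ) → Finset (Fin (m + 1) → Fin n) := fun m =>
    Finset.univ.filter fun c => (closedWalkEdges c).card = m + 1 with h𝒞
  have h1 : ∀ G : SimpleGraph (Fin n), (shortCycleVerts G k).card ≤ ∑ m ∈ Finset.range k,
      ∑ c ∈ 𝒞 m, if (↑(closedWalkEdges c) : Set (Sym2 (Fin n))) ⊆ G.edgeSet then 1 else 0 := by
    intro G
    have hsub : shortCycleVerts G k ⊆ (Finset.range k).biUnion fun m =>
        ((𝒞 m).filter fun c => (↑(closedWalkEdges c) : Set (Sym2 (Fin n))) ⊆ G.edgeSet).image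
          fun c => c 0 := by
      intro u hu
      obtain ⟨p, hp, hpk⟩ := (Finset.mem_filter.1 hu).2
      obtain ⟨m, c, hm, hc0, hcard, hcG⟩ := exists_closedWalkEdges_of_isCycle p hp
      refine Finset.mem_biUnion.2 ⟨m, Finset.mem_range.2 (by omega), Finset.mem_image.2 ⟨c, ?_, hc0⟩⟩
      exact Finset.mem_filter.2 ⟨Finset.mem_filter.2 ⟨Finset.mem_univ _, hcard⟩, hcG⟩
    refine (Finset.card_le_card hsub).trans (Finset.card_biUnion_le.trans ?_)
    refine Finset.sum_le_sum fun m _ => Finset.card_image_le.trans ?_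
    rw [Finset.card_filter]
  have h2 : ∑ G ∈ regularContaining n d ∅, (shortCycleVerts G k).card ≤ ∑ m ∈ Finset.range k,
      ∑ c ∈ 𝒞 m, (regularContaining n d (closedWalkEdges c)).card := by
    refine (Finset.sum_le_sum fun G _ => h1 G).trans ?_
    rw [Finset.sum_comm]
    refine Finset.sum_le_sum fun m _ => ?_
    rw [Finset.sum_comm]
    refine Finset.sum_le_sum fun c _ => ?_
    rw [← Finset.card_filter]
    refine Finset.card_le_card fun G hG => ?_
    obtain ⟨hG1, hG2⟩ := Finset.mem_filter.1 hG
    exact mem_regularContaining.2 ⟨(mem_regularContaining.1 hG1).1, hG2⟩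
  have h3 : ∀ m ∈ Finset.range k, ∑ c ∈ 𝒞 m, ((regularContaining n d (closedWalkEdges c)).card : ℝ)
      ≤ (2 * d : ℝ) ^ k * (regularContaining n d ∅).card := by
    intro m hm
    rw [Finset.mem_range] at hm
    have h4 : ∀ c ∈ 𝒞 m, ((regularContaining n d (closedWalkEdges c)).card : ℝ)
        ≤ (2 * d / n) ^ (m + 1) * (regularContaining n d ∅).card := by
      intro c hc
      have hc' := (Finset.mem_filter.1 hc).2
      rw [← hc']
      exact card_regularContaining_le hd _ (by omega)
    refine (Finset.sum_le_sum h4).trans ?_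
    rw [Finset.sum_const, nsmul_eq_mul, ← mul_assoc]
    refine mul_le_mul_of_nonneg_right ?_ (Nat.cast_nonneg _)
    have h5 : ((𝒞 m).card : ℝ) ≤ (n : ℝ) ^ (m + 1) := by
      have := Finset.card_le_univ (𝒞 m)
      rw [Fintype.card_fun, Fintype.card_fin, Fintype.card_fin] at this
      exact_mod_cast this
    calc ((𝒞 m).card : ℝ) * (2 * d / n) ^ (m + 1) ≤ (n : ℝ) ^ (m + 1) * (2 * d / n) ^ (m + 1) :=
          mul_le_mul_of_nonneg_right h5 (by positivity)
      _ = (2 * d : ℝ) ^ (m + 1) := by rw [← mul_pow]; congr 1; field_simp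
      _ ≤ (2 * d : ℝ) ^ k := pow_le_pow_right₀ (by linarith) hm
  calc ∑ G ∈ regularContaining n d ∅, ((shortCycleVerts G k).card : ℝ)
      ≤ ∑ m ∈ Finset.range k, ∑ c ∈ 𝒞 m, ((regularContaining n d (closedWalkEdges c)).card : ℝ) := by
        exact_mod_cast h2
    _ ≤ ∑ _m ∈ Finset.range k, (2 * d : ℝ) ^ k * (regularContaining n d ∅).card :=
        Finset.sum_le_sum h3
    _ = _ := by rw [Finset.sum_const, Finset.card_range, nsmul_eq_mul]; ring

/-- In a random regular graph it is unlikely that many vertices lie on short cycles. -/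
lemma card_filter_shortCycleVerts_mul_le {d : ℕ} (hd : 1 ≤ d) (k : ℕ)
    (hn : 4 * (d + 1) + 4 * k ≤ n) (M : ℝ) :
    open Classical in
    (((regularContaining n d ∅).filter fun G => M < (shortCycleVerts G k).card).card : ℝ) * M
      ≤ k * (2 * d : ℝ) ^ k * (regularContaining n d ∅).card := by
  classical
  refine le_trans ?_ (sum_card_shortCycleVerts_le hd k hn)
  rw [← nsmul_eq_mul, ← Finset.sum_const]
  refine (Finset.sum_le_sum (g := fun G => ((shortCycleVerts G k).card : ℝ))
    fun G hG => (Finset.mem_filter.1 hG).2.le).trans ?_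
  exact Finset.sum_le_sum_of_subset_of_nonneg (Finset.filter_subset _ _)
    fun _ _ _ => Nat.cast_nonneg _

end Switching

/-! ### Heavy edges -/

section EdgeLocalization

variable {n : ℕ}

/-- A component without cycles is bipartite. -/
lemma exists_coloring_component (H : SimpleGraph (Fin n)) (C : H.ConnectedComponent)
    (hC : ∀ u, H.connectedComponentMk u = C → ∀ p : H.Walk u u, ¬ p.IsCycle) :
    ∃ φ : Fin n → Bool, ∀ i j, H.connectedComponentMk i = C → H.connectedComponentMk j = C →
      H.Adj i j → φ i ≠ φ j := by
  classical
  have hac : C.toSimpleGraph.IsAcyclic := by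
    intro x p hp
    refine hC x.1 x.2 (p.map C.toSimpleGraph_hom) (hp.map ?_)
    exact Subtype.val_injective
  have htree : C.toSimpleGraph.IsTree := ⟨C.connected_toSimpleGraph, hac⟩
  obtain ⟨χ⟩ := htree.isBipartite
  refine ⟨fun i => if h : i ∈ C.supp then decide (χ ⟨i, h⟩ = 0) else false, fun i j hi hj hij => ?_⟩
  have hi' : i ∈ C.supp := hi
  have hj' : j ∈ C.supp := hj
  have hadj : C.toSimpleGraph.Adj ⟨i, hi'⟩ ⟨j, hj'⟩ := hij
  have hne := χ.valid hadj
  simp only [hi', hj', dif_pos]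
  intro h
  apply hne
  have h1 : χ ⟨i, hi'⟩ = 0 ∨ χ ⟨i, hi'⟩ = 1 := by omega
  have h2 : χ ⟨j, hj'⟩ = 0 ∨ χ ⟨j, hj'⟩ = 1 := by omega
  rcases h1 with h1 | h1 <;> rcases h2 with h2 | h2 <;> simp [h1, h2] at h ⊢

/-- The norm of a block in terms of its mass, without any assumption on the structure of the graph.
-/
lemma bilin_wmat_le_of_sum_rpow_le {α : ℝ} (hα : 0 < α) (hα2 : α ≤ 2) (G : SimpleGraph (Fin n))
    (w : UpperPairs n → ℝ) (B : Finset (Fin n)) {S : ℝ} (hS : ∑ e ∈ edgesIn G B, |w e| ^ α ≤ S)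
    {g h : Fin n → ℝ} (hg : ∀ i, i ∉ B → g i = 0) (hh : ∀ i, i ∉ B → h i = 0) :
    bilin (wmat G w) g h ≤ Real.sqrt (2 * S ^ (2 / α)) * (l2norm g * l2norm h) := by
  have h1 : bilin (wmat G w) g h = bilin (blockOf B (wmat G w)) g h := by
    refine bilin_congr fun i j hi hj => ?_
    rw [blockOf, if_pos]
    exact ⟨by by_contra h'; exact hi (hg i h'), by by_contra h'; exact hj (hh j h')⟩
  rw [h1]
  refine (bilin_le_frobenius _ g h).trans (mul_le_mul_of_nonneg_right (Real.sqrt_le_sqrt ?_)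
    (mul_nonneg (l2norm_nonneg _) (l2norm_nonneg _)))
  rw [sum_blockOf_wmat_sq]
  exact mul_le_mul_of_nonneg_left (sum_sq_le_rpow _ w hα hα2 hS) (by norm_num)

lemma abs_trunc_le (τ x : ℝ) : |trunc τ x| ≤ |x| := by
  unfold trunc
  split_ifs
  · exact le_rfl
  · simp

/-- The edges of weight at least `m ^ (1 / α)` in absolute value. -/
noncomputable def heavyEdges (G : SimpleGraph (Fin n)) (w : UpperPairs n → ℝ) (α m : ℝ) :
    Finset (UpperPairs n) :=
  open Classical in Finset.univ.filter fun e => G.Adj e.1.1 e.1.2 ∧ m ≤ |w e| ^ α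

lemma mem_heavyEdges {G : SimpleGraph (Fin n)} {w : UpperPairs n → ℝ} {α m : ℝ} {e : UpperPairs n} :
    e ∈ heavyEdges G w α m ↔ G.Adj e.1.1 e.1.2 ∧ m ≤ |w e| ^ α := by
  simp [heavyEdges]

lemma trunc_eq_of_mem_heavyEdges {G : SimpleGraph (Fin n)} {w : UpperPairs n → ℝ} {α m τ : ℝ}
    (hα : 0 < α) (hτm : τ ^ α ≤ m) {e : UpperPairs n}
    (he : e ∈ heavyEdges G w α m) : trunc τ (w e) = w e := by
  rw [trunc, if_pos]
  by_contra hlt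
  push Not at hlt
  have h1 := Real.rpow_lt_rpow (abs_nonneg _) hlt hα
  have := (mem_heavyEdges.1 he).2
  linarith

/-- If the mass in each neighbourhood is less than twice the mass of a heavy edge, then heavy edges
are disjoint. -/
lemma isVertexDisjointEdges_heavyEdges {α m τ b : ℝ} (hα : 0 < α) {G : SimpleGraph (Fin n)}
    {w : UpperPairs n → ℝ} {k : ℕ} (hk : 1 ≤ k) (hτm : τ ^ α ≤ m) (hbm : b < 2 * m)
    (hTb : ∀ v, ∑ e ∈ edgesIn G (gball G k v), |trunc τ (w e)| ^ α ≤ b) :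
    IsVertexDisjointEdges G ((heavyEdges G w α m).image fun e => s(e.1.1, e.1.2)) := by
  classical
  constructor
  · intro e he
    obtain ⟨e', he', rfl⟩ := Finset.mem_image.1 he
    exact (mem_heavyEdges.1 he').1
  · intro e he e' he' hne v hv hv'
    obtain ⟨a, ha, rfl⟩ := Finset.mem_image.1 he
    obtain ⟨a', ha', rfl⟩ := Finset.mem_image.1 he'
    have hmem : ∀ a ∈ heavyEdges G w α m, v ∈ s(a.1.1, a.1.2) → a ∈ edgesIn G (gball G k v) := by
      intro a ha hv
      have hadj := (mem_heavyEdges.1 ha).1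
      rw [mem_edgesIn]
      rcases Sym2.mem_iff.1 hv with h | h
      · exact ⟨h ▸ self_mem_gball G k v, mem_gball_of_adj hk (h ▸ hadj), hadj⟩
      · exact ⟨mem_gball_of_adj hk (h ▸ hadj.symm), h ▸ self_mem_gball G k v, hadj⟩
    have haa' : a ≠ a' := fun h => hne (h ▸ rfl)
    have h1 : ∑ e ∈ ({a, a'} : Finset (UpperPairs n)), |trunc τ (w e)| ^ α ≤ b := by
      refine (Finset.sum_le_sum_of_subset_of_nonneg ?_
        fun e _ _ => Real.rpow_nonneg (abs_nonneg _) _).trans (hTb v)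
      intro x hx
      simp only [Finset.mem_insert, Finset.mem_singleton] at hx
      rcases hx with rfl | rfl
      · exact hmem _ ha hv
      · exact hmem _ ha' hv'
    rw [Finset.sum_pair haa', trunc_eq_of_mem_heavyEdges hα hτm ha,
      trunc_eq_of_mem_heavyEdges hα hτm ha'] at h1
    have := (mem_heavyEdges.1 ha).2
    have := (mem_heavyEdges.1 ha').2
    linarith

/-- Deterministic localization on the heavy edges. On a component of the graph of large weights that
has no heavy edge, the quadratic form is at most `β` times the squared norm: the component is a
tree, hence bipartite, or it is near a short cycle of `G` and has little mass. On a component that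
has a heavy edge, that edge takes nearly all the mass the component can have, and the other weights
are small. -/
lemma l2norm_restr_compl_heavyEdges_le {α : ℝ} (hα : 0 < α) (hα2 : α ≤ 2) {G : SimpleGraph (Fin n)}
    {d : ℕ} (hG : IsRegularGraph G d) {w : UpperPairs n → ℝ} {τ t l m b b₀ β δ : ℝ} {k : ℕ}
    (hτ : 0 < τ) (hτm : τ ^ α ≤ m) (hδ : 0 ≤ δ) (ht : 0 < t) (hβt : β < t)
    {f : Fin n → ℝ} (hf : ∀ i, ∑ j, wmat G w i j * f j = l * f i) (hl : t ≤ l)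
    (hT : ∀ v, ∑ e ∈ edgesIn G (gball G k v), |trunc τ (w e)| ^ α < k * τ ^ α)
    (hTb : ∀ v, ∑ e ∈ edgesIn G (gball G k v), |trunc τ (w e)| ^ α ≤ b)
    (hTc : ∀ v, (∃ u ∈ gball G k v, u ∈ shortCycleVerts G k) →
      ∑ e ∈ edgesIn G (gball G k v), |trunc τ (w e)| ^ α ≤ b₀)
    (htree : Real.sqrt (m ^ ((2 - α) / α) * b) ≤ β)
    (hcyc : Real.sqrt (2 * b₀ ^ (2 / α)) ≤ β)
    (hδ1 : d * τ ≤ δ * (t - β))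
    (hδ2 : d * τ + Real.sqrt (2 * (b - m) ^ (2 / α)) ≤ δ * t) :
    l2norm (restr (↑(edgeVertices ((heavyEdges G w α m).image fun e => s(e.1.1, e.1.2))) :
      Set (Fin n))ᶜ f) ^ 2 ≤ 2 * δ ^ 2 * l2norm f ^ 2 := by
  classical
  have hm : 0 < m := (Real.rpow_pos_of_pos hτ _).trans_le hτm
  set w' : UpperPairs n → ℝ := fun e => trunc τ (w e) with hw'
  have hbig : ∀ e, w' e ≠ 0 → τ ≤ |w' e| := fun e he => le_abs_trunc he
  set H := supportGraph G w' with hH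
  let _ : Fintype H.ConnectedComponent := Fintype.ofFinite _
  set c : Fin n → H.ConnectedComponent := H.connectedComponentMk with hc
  have hMc : ∀ i j, wmat G w' i j ≠ 0 → c i = c j := fun i j hij =>
    SimpleGraph.ConnectedComponent.sound (SimpleGraph.Adj.reachable (G := H) hij)
  have hball : ∀ v i, c i = c v → i ∈ gball G k v := fun v i hi =>
    mem_gball_of_reachable hα hτ hbig (hT v) (SimpleGraph.ConnectedComponent.exact hi.symm)
  set J := heavyEdges G w α m with hJ
  set VJ : Set (Fin n) := ↑(edgeVertices (J.image fun e => s(e.1.1, e.1.2))) with hVJ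
  have hmemVJ : ∀ v, v ∈ VJ ↔ ∃ e ∈ J, v ∈ s(e.1.1, e.1.2) := by
    intro v
    simp [hVJ, edgeVertices]
  set P : H.ConnectedComponent → Prop := fun C => ∃ e ∈ J, c e.1.1 = C with hP
  -- `B₁` consists of the components without heavy edges, and `B₂` of the vertices off the heavy
  -- edges in the other components.
  set B₁ : Set (Fin n) := {v | ¬ P (c v)} with hB₁
  set B₂ : Set (Fin n) := {v | P (c v) ∧ v ∉ VJ} with hB₂
  have hwJ : ∀ e ∈ J, w' e = w e := fun e he => trunc_eq_of_mem_heavyEdges hα hτm he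
  have hX1 : ∀ i j, wmat G w i j = wmat G (fun e => w e - w' e) i j + wmat G w' i j := by
    intro i j
    simp only [wmat, symEntry]
    split_ifs <;> ring
  have hX1b : ∀ g h : Fin n → ℝ,
      bilin (wmat G fun e => w e - w' e) g h ≤ (d * τ) * (l2norm g * l2norm h) :=
    bilin_wmat_le hG hτ.le _ (fun e => abs_sub_trunc_le hτ.le (w e))
  have hf0 := l2norm_nonneg f
  have hb1 : l2norm (restr B₁ f) ≤ δ * l2norm f := by
    have hgap : (t - β) * l2norm (restr B₁ f) ≤ (d * τ) * l2norm f := by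
      refine l2norm_restr_le_of_gap (M₁ := wmat G fun e => w e - w' e) (M₂ := wmat G w') hf hX1 B₁
        ?_ hX1b ?_
      · intro i j hi hj
        by_contra hne
        have h1 := hMc i j hne
        simp only [hB₁, Set.mem_ofPred_eq, ← h1, not_not] at hi hj
        exact hi hj
      · refine (bilin_self_le_of_blocks c _ hMc _ β fun C => ?_).trans
          (mul_le_mul_of_nonneg_right (by linarith) (sq_nonneg _))
        set g := restr {i | c i = C} (restr B₁ f) with hg
        have hgC : ∀ i, c i ≠ C → g i = 0 := fun i hi =>
          restr_apply_not_mem (s := {k | c k = C}) (i := i) hi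
        by_cases hPC : P C
        · have hg0 : g = fun _ => 0 := by
            funext i
            by_cases hi : c i = C
            · rw [hg, restr_apply_mem (s := {k | c k = C}) (i := i) hi]
              refine restr_apply_not_mem ?_
              simp only [hB₁, Set.mem_ofPred_eq, not_not, hi]
              exact hPC
            · exact hgC i hi
          rw [hg0]
          simp [bilin, l2norm]
        obtain ⟨v, hv⟩ : ∃ v, c v = C := C.exists_rep
        have hgB : ∀ i, i ∉ gball G k v → g i = 0 := fun i hi =>
          hgC i fun h => hi (hball v i (h.trans hv.symm))
        by_cases hcycle : ∃ u ∈ gball G k v, u ∈ shortCycleVerts G k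
        · refine (bilin_wmat_le_of_sum_rpow_le hα hα2 G w' (gball G k v) (hTc v hcycle) hgB hgB).trans ?_
          rw [← sq]
          exact mul_le_mul_of_nonneg_right hcyc (sq_nonneg _)
        · have hnocyc : ∀ u, H.connectedComponentMk u = C → ∀ p : H.Walk u u, ¬ p.IsCycle := by
            intro u hu p hp
            have huv : c u = c v := hu.trans hv.symm
            have hlen := length_cycle_lt hα hτ hbig (hT v)
              (SimpleGraph.ConnectedComponent.exact huv.symm) p hp
            refine hcycle ⟨u, hball v u huv, ?_⟩
            rw [shortCycleVerts, Finset.mem_filter]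
            refine ⟨Finset.mem_univ _, p.mapLe (supportGraph_le G w'),
              (SimpleGraph.Walk.isCycle_mapLe _).2 hp, ?_⟩
            simpa using hlen.le
          obtain ⟨φ, hφ⟩ := exists_coloring_component H C hnocyc
          set D : Finset (Fin n) := Finset.univ.filter fun i => c i = C with hD
          have h1 : bilin (wmat G w') g g = bilin (blockOf D (wmat G w')) g g := by
            refine bilin_congr fun i j hi hj => ?_
            rw [blockOf, if_pos]
            constructor
            · by_contra h'
              exact hi (hgC i (by simpa [hD] using h'))
            · by_contra h'
              exact hj (hgC j (by simpa [hD] using h'))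
          rw [h1]
          refine (bilin_le_of_bipartite _ φ g ?_ (m ^ ((2 - α) / α) * b) ?_).trans
            (mul_le_mul_of_nonneg_right htree (sq_nonneg _))
          · intro i j hi hj hij
            have hi' : c i = C := by by_contra h'; exact hi (hgC i h')
            have hj' : c j = C := by by_contra h'; exact hj (hgC j h')
            refine hφ i j hi' hj' ?_
            rw [blockOf] at hij
            split_ifs at hij with hh
            · exact hij
            · exact absurd rfl hij
          · rw [sum_blockOf_wmat_sq]
            refine mul_le_mul_of_nonneg_left ?_ (by norm_num)
            refine (sum_sq_le_rpow_mul (m := m) _ w' hα hα2 ?_).trans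
              (mul_le_mul_of_nonneg_left ?_ (Real.rpow_nonneg hm.le _))
            · intro e he
              have heJ : e ∉ J := fun h => hPC ⟨e, h, by
                have := (mem_edgesIn.1 he).1
                simpa [hD] using this⟩
              have h2 : |w e| ^ α < m := by
                by_contra hge
                exact heJ (mem_heavyEdges.2 ⟨(mem_edgesIn.1 he).2.2, not_lt.1 hge⟩)
              exact (Real.rpow_le_rpow (abs_nonneg _) (abs_trunc_le τ (w e)) hα.le).trans h2.le
            · refine (Finset.sum_le_sum_of_subset_of_nonneg ?_
                fun e _ _ => Real.rpow_nonneg (abs_nonneg _) _).trans (hTb v)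
              intro e he
              rw [mem_edgesIn] at he ⊢
              simp only [hD, Finset.mem_filter, Finset.mem_univ, true_and] at he
              exact ⟨hball v _ (he.1.trans hv.symm), hball v _ (he.2.1.trans hv.symm), he.2.2⟩
    have h2 := mul_le_mul_of_nonneg_right hδ1 hf0
    have h3 : (t - β) * l2norm (restr B₁ f) ≤ (t - β) * (δ * l2norm f) := by linarith
    exact le_of_mul_le_mul_left h3 (by linarith)
  have hb2 : l2norm (restr B₂ f) ≤ δ * l2norm f := by
    set w'' : UpperPairs n → ℝ := fun e => if e ∈ J then 0 else w' e with hw''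
    have h1 := eigen_restr hf B₂
    have h2 : bilin (wmat G w) (restr B₂ f) f
        = bilin (wmat G fun e => w e - w' e) (restr B₂ f) f + bilin (wmat G w'') (restr B₂ f) f := by
      rw [← bilin_add_left]
      refine bilin_congr fun i j hi _ => ?_
      rw [hX1]
      congr 1
      have hiB : i ∉ VJ := by
        by_contra h'
        exact hi (restr_apply_not_mem fun h'' => h''.2 h')
      rw [hmemVJ] at hiB
      simp only [wmat, symEntry, hw'']
      split_ifs with ha hb hb' hb hb'
      · exact absurd ⟨_, hb', by simp⟩ hiB
      · rfl
      · exact absurd ⟨_, hb', by simp⟩ hiB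
      · rfl
      · rfl
      · rfl
    have hMc'' : ∀ i j, wmat G w'' i j ≠ 0 → c i = c j := by
      intro i j hij
      refine hMc i j fun h0 => hij ?_
      simp only [wmat, symEntry, hw''] at h0 ⊢
      split_ifs at h0 ⊢ <;> first | rfl | exact h0
    have h3 : bilin (wmat G w'') (restr B₂ f) f
        ≤ Real.sqrt (2 * (b - m) ^ (2 / α)) * (l2norm (restr B₂ f) * l2norm f) := by
      refine bilin_le_of_blocks c _ hMc'' _ _ _ (Real.sqrt_nonneg _) fun C => ?_
      by_cases hPC : P C
      · obtain ⟨e₀, he₀, hC⟩ := hPC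
        have hsupp : ∀ (q : Fin n → ℝ) (i : Fin n), i ∉ gball G k e₀.1.1 →
            restr {i | c i = C} q i = 0 := fun q i hi =>
          restr_apply_not_mem (s := {k | c k = C}) (i := i)
            fun h => hi (hball e₀.1.1 i (Eq.trans h hC.symm))
        refine bilin_wmat_le_of_sum_rpow_le hα hα2 G w'' (gball G k e₀.1.1) ?_ (hsupp _) (hsupp _)
        have he₀m := mem_heavyEdges.1 he₀
        have hadj₀ : wmat G w' e₀.1.1 e₀.1.2 ≠ 0 := by
          rw [wmat_upper he₀m.1, hwJ e₀ he₀]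
          intro h0
          rw [h0, abs_zero, Real.zero_rpow hα.ne'] at he₀m
          linarith [he₀m.2]
        have he₀B : e₀ ∈ edgesIn G (gball G k e₀.1.1) :=
          mem_edgesIn.2 ⟨self_mem_gball G k _, hball _ _ (hMc _ _ hadj₀).symm, he₀m.1⟩
        -- Removing the heavy edges removes mass at least `m`, that of `e₀`.
        have h4 : ∑ e ∈ edgesIn G (gball G k e₀.1.1), (|w'' e| ^ α + if e = e₀ then m else 0)
            ≤ ∑ e ∈ edgesIn G (gball G k e₀.1.1), |trunc τ (w e)| ^ α := by
          refine Finset.sum_le_sum fun e _ => ?_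
          by_cases hee : e = e₀
          · rw [if_pos hee, hee]
            simp only [hw'', he₀, if_true, abs_zero, Real.zero_rpow hα.ne', zero_add]
            have : trunc τ (w e₀) = w e₀ := hwJ e₀ he₀
            rw [this]
            exact he₀m.2
          · rw [if_neg hee, add_zero]
            simp only [hw'']
            split_ifs
            · rw [abs_zero, Real.zero_rpow hα.ne']
              exact Real.rpow_nonneg (abs_nonneg _) _
            · exact le_rfl
        rw [Finset.sum_add_distrib, Finset.sum_ite_eq', if_pos he₀B] at h4
        linarith [hTb e₀.1.1]
      · have hg0 : restr {i | c i = C} (restr B₂ f) = fun _ => 0 := by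
          funext i
          by_cases hi : c i = C
          · rw [restr_apply_mem (s := {k | c k = C}) (i := i) hi]
            refine restr_apply_not_mem fun h => hPC ?_
            rw [← hi]
            exact h.1
          · exact restr_apply_not_mem (s := {k | c k = C}) (i := i) hi
        rw [hg0]
        simp [bilin, l2norm]
    have h5 := hX1b (restr B₂ f) f
    have hr0 := l2norm_nonneg (restr B₂ f)
    have h6 : t * l2norm (restr B₂ f) ^ 2 ≤ (δ * t) * (l2norm (restr B₂ f) * l2norm f) := by
      have h7 := mul_le_mul_of_nonneg_right hl (sq_nonneg (l2norm (restr B₂ f)))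
      have h8 := mul_le_mul_of_nonneg_right hδ2 (mul_nonneg hr0 hf0)
      rw [h1, h2] at h7
      linarith
    rcases hr0.eq_or_lt with h0 | h0
    · rw [← h0]; positivity
    · have h9 : (t * l2norm (restr B₂ f)) * l2norm (restr B₂ f)
          ≤ (t * l2norm (restr B₂ f)) * (δ * l2norm f) := by nlinarith
      exact le_of_mul_le_mul_left h9 (mul_pos ht h0)
  have hcompl : VJᶜ ⊆ B₁ ∪ B₂ := by
    intro v hv
    by_cases h : P (c v)
    · exact Or.inr ⟨h, hv⟩
    · exact Or.inl h
  have h1 : l2norm (restr VJᶜ f) ^ 2 ≤ l2norm (restr (B₁ ∪ B₂) f) ^ 2 := by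
    rw [l2norm_sq, l2norm_sq]
    refine Finset.sum_le_sum fun i _ => ?_
    by_cases hi : i ∈ VJᶜ
    · rw [restr_apply_mem hi, restr_apply_mem (hcompl hi)]
    · rw [restr_apply_not_mem hi, zero_pow two_ne_zero]; positivity
  have h2 := l2norm_restr_union_sq_le B₁ B₂ f
  have h3 := pow_le_pow_left₀ (l2norm_nonneg _) hb1 2
  have h4 := pow_le_pow_left₀ (l2norm_nonneg _) hb2 2
  calc _ ≤ (δ * l2norm f) ^ 2 + (δ * l2norm f) ^ 2 := by linarith
    _ = _ := by ring

end EdgeLocalization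

/-! ### Localization on few edges -/

section EdgeLocalization

lemma exp_neg_two_mul_le {x : ℝ} (h0 : 0 ≤ x) (h1 : x ≤ 1 / 2) : Real.exp (-(2 * x)) ≤ 1 - x := by
  have h2 : 1 + 2 * x ≤ Real.exp (2 * x) := by linarith [Real.add_one_le_exp (2 * x)]
  have h3 : Real.exp (-(2 * x)) * Real.exp (2 * x) = 1 := by rw [← Real.exp_add]; simp
  have h4 := Real.exp_pos (-(2 * x))
  nlinarith

/-- The gap between a tree without a heavy edge and the top eigenvalue. On a tree with mass at most
`(1 + r κ / 3) L` all of whose edges have mass at most `(1 - κ) L`, the norm is at most the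
left-hand side, and `((1 - α r κ / 12) L) ^ (1 / α)` is a lower bound for the top eigenvalue. The
factor `(1 - κ) ^ r`, about `1 - r κ`, pays for the three losses. -/
lemma sqrt_tree_le {α r κ L : ℝ} (hα : 0 < α) (hr : r = (2 - α) / α) (hr0 : 0 < r) (hL : 0 < L)
    (hκ : 0 < κ) (hκ1 : κ ≤ 1 / 4) (hg : r * κ / 12 ≤ 1 / 2) (hκ' : α * r * κ / 12 ≤ 1 / 2) :
    Real.sqrt (((1 - κ) * L) ^ ((2 - α) / α) * ((1 + r * κ / 3) * L))
      ≤ (1 - r * κ / 12) * ((1 - α * r * κ / 12) * L) ^ (1 / α) := by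
  rw [← hr, Real.sqrt_le_iff]
  have hL1 : 0 ≤ (1 - α * r * κ / 12) * L := mul_nonneg (by linarith) hL.le
  have hrκ : 0 < r * κ := mul_pos hr0 hκ
  refine ⟨mul_nonneg (by linarith) (Real.rpow_nonneg hL1 _), ?_⟩
  have e1 : (((1 - α * r * κ / 12) * L) ^ (1 / α)) ^ 2
      = (1 - α * r * κ / 12) ^ (2 / α) * L ^ (2 / α) := by
    rw [← Real.rpow_natCast, ← Real.rpow_mul hL1, ← Real.mul_rpow (by linarith) hL.le]
    congr 1
    push_cast; ring
  have e2 : ((1 - κ) * L) ^ r * ((1 + r * κ / 3) * L)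
      = ((1 - κ) ^ r * (1 + r * κ / 3)) * L ^ (2 / α) := by
    have e3 : L ^ (2 / α) = L ^ r * L := by
      rw [← Real.rpow_add_one hL.ne']
      congr 1; rw [hr]; field_simp; ring
    rw [Real.mul_rpow (by linarith) hL.le, e3]; ring
  rw [mul_pow, e1, e2, ← mul_assoc]
  refine mul_le_mul_of_nonneg_right ?_ (Real.rpow_nonneg hL.le _)
  have b1 : (1 - κ) ^ r ≤ Real.exp (-(r * κ)) := by
    calc (1 - κ) ^ r ≤ (Real.exp (-κ)) ^ r :=
          Real.rpow_le_rpow (by linarith) (by linarith [Real.add_one_le_exp (-κ)]) hr0.le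
      _ = _ := by rw [← Real.exp_mul]; congr 1; ring
  have b2 : 1 + r * κ / 3 ≤ Real.exp (r * κ / 3) := by linarith [Real.add_one_le_exp (r * κ / 3)]
  have b3 : Real.exp (-(r * κ / 3)) ≤ (1 - r * κ / 12) ^ 2 := by
    calc Real.exp (-(r * κ / 3)) = (Real.exp (-(2 * (r * κ / 12)))) ^ 2 := by
          rw [← Real.exp_nat_mul]; congr 1; push_cast; ring
      _ ≤ _ := pow_le_pow_left₀ (Real.exp_pos _).le (exp_neg_two_mul_le (by linarith) hg) 2
  have hα' : 0 ≤ α * r * κ / 12 := by positivity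
  have b4 : Real.exp (-(r * κ / 3)) ≤ (1 - α * r * κ / 12) ^ (2 / α) := by
    calc Real.exp (-(r * κ / 3)) = (Real.exp (-(2 * (α * r * κ / 12)))) ^ (2 / α) := by
          rw [← Real.exp_mul]; congr 1; field_simp; ring
      _ ≤ _ := Real.rpow_le_rpow (Real.exp_pos _).le (exp_neg_two_mul_le hα' hκ') (by positivity)
  calc (1 - κ) ^ r * (1 + r * κ / 3) ≤ Real.exp (-(r * κ)) * Real.exp (r * κ / 3) :=
        mul_le_mul b1 b2 (by positivity) (Real.exp_pos _).le
    _ = Real.exp (-(r * κ / 3)) * Real.exp (-(r * κ / 3)) := by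
        rw [← Real.exp_add, ← Real.exp_add]; congr 1; ring
    _ ≤ _ := mul_le_mul b3 b4 (Real.exp_pos _).le (sq_nonneg _)

lemma half_rpow_le {α x L : ℝ} (hα : 0 < α) (hL : 0 < L) (hx : x ≤ 1 / 2) :
    L ^ (1 / α) * (1 / 2) ^ (1 / α) ≤ ((1 - x) * L) ^ (1 / α) := by
  rw [← Real.mul_rpow hL.le (by norm_num)]
  exact Real.rpow_le_rpow (by positivity) (by nlinarith) (by positivity)

/-- A component of mass `(1 / 2) (1 / 8) ^ (α / 2) L` cannot support the top eigenvalue, even if it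
has cycles. -/
lemma sqrt_cycle_le {α g x L : ℝ} (hα : 0 < α) (hL : 0 < L) (hg : g ≤ 1 / 2) (hx : x ≤ 1 / 2) :
    Real.sqrt (2 * (1 / 2 * (1 / 8) ^ (α / 2) * L) ^ (2 / α)) ≤ (1 - g) * ((1 - x) * L) ^ (1 / α) := by
  have h1 : (1 / 2 : ℝ) * (L ^ (1 / α) * (1 / 2) ^ (1 / α)) ≤ (1 - g) * ((1 - x) * L) ^ (1 / α) :=
    mul_le_mul (by linarith) (half_rpow_le hα hL hx) (by positivity) (by linarith)
  refine le_trans ?_ h1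
  rw [Real.sqrt_le_iff]
  refine ⟨by positivity, le_of_eq ?_⟩
  have e1 : ∀ y : ℝ, 0 ≤ y → (y ^ (1 / α)) ^ 2 = y ^ (2 / α) := by
    intro y hy
    rw [← Real.rpow_natCast, ← Real.rpow_mul hy]; congr 1; push_cast; ring
  rw [mul_pow, mul_pow, e1 _ hL.le, e1 _ (by norm_num), Real.mul_rpow (by positivity) hL.le,
    Real.mul_rpow (by norm_num) (by positivity), ← Real.rpow_mul (by norm_num),
    div_mul_div_comm, mul_comm α 2, div_self (by positivity), Real.rpow_one]
  ring

/-- A mass `y L` with small `y` supports only a small part of the top eigenvalue. -/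
lemma sqrt_rest_le {α ρ δ x L y : ℝ} (hα : 0 < α) (hL : 0 < L) (hδ : 0 < δ) (hx : x ≤ 1 / 2)
    (hρ : ρ = (δ / 2 * (1 / 2) ^ (1 / α) / Real.sqrt 2) ^ α) (hy0 : 0 ≤ y) (hy : y ≤ ρ) :
    Real.sqrt (2 * (y * L) ^ (2 / α)) ≤ δ / 2 * ((1 - x) * L) ^ (1 / α) := by
  have h2 : 0 < Real.sqrt 2 := by positivity
  have hq : 0 < δ / 2 * (1 / 2) ^ (1 / α) / Real.sqrt 2 := by positivity
  have h1 : y ^ (1 / α) ≤ δ / 2 * (1 / 2) ^ (1 / α) / Real.sqrt 2 := by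
    calc y ^ (1 / α) ≤ ρ ^ (1 / α) := Real.rpow_le_rpow hy0 hy (by positivity)
      _ = _ := by rw [hρ, ← Real.rpow_mul hq.le, mul_one_div_cancel hα.ne', Real.rpow_one]
  have e1 : (y * L) ^ (2 / α) = (y ^ (1 / α) * L ^ (1 / α)) ^ 2 := by
    rw [← Real.mul_rpow hy0 hL.le, ← Real.rpow_natCast, ← Real.rpow_mul (by positivity)]
    congr 1; push_cast; ring
  rw [e1, Real.sqrt_mul (by norm_num), Real.sqrt_sq (by positivity)]
  rw [le_div_iff₀ h2] at h1
  calc Real.sqrt 2 * (y ^ (1 / α) * L ^ (1 / α)) = (y ^ (1 / α) * Real.sqrt 2) * L ^ (1 / α) := by ring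
    _ ≤ (δ / 2 * (1 / 2) ^ (1 / α)) * L ^ (1 / α) := mul_le_mul_of_nonneg_right h1 (by positivity)
    _ = δ / 2 * (L ^ (1 / α) * (1 / 2) ^ (1 / α)) := by ring
    _ ≤ _ := mul_le_mul_of_nonneg_left (half_rpow_le hα hL hx) (by positivity)

variable {n : ℕ}

/-- With high probability, the top eigenvalue is at least `u ^ (1 / α)`, for `u` somewhat below
`log n`. This is the second moment bound for balls of radius `1`, each with a profile of value `1`,
such as that of a single edge. -/
lemma exists_event_le_eigenvalue {α C₁ C₂ : ℝ} {ν : Measure ℝ} (h : IsWeibull α C₁ C₂ ν)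
    (hα : 0 < α) (hC₁ : 0 < C₁) {d : ℕ} (hd : 1 ≤ d) {G : SimpleGraph (Fin n)}
    (hG : IsRegularGraph G d) (hn : 1 ≤ n) {u : ℝ} (hu : 0 < u) :
    ∃ N : Set (UpperPairs n → ℝ), (Measure.pi fun _ : UpperPairs n => ν).real N
      ≤ ((d + 1) ^ (1 + 1) : ℕ) / (min 1 (C₁ / 2 * Real.exp (-1))) ^ (((d + 1) ^ 1) ^ 2)
        * Real.exp (-(Real.log n - u)) ∧
      ∀ w, w ∉ N → ∀ l, (∀ g : Fin n → ℝ, bilin (wmat G w) g g ≤ l * l2norm g ^ 2) →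
        u ^ (1 / α) ≤ l := by
  have hn0 : (0:ℝ) < n := by exact_mod_cast hn
  have hmem : ∀ v, (1 : ℝ) ∈ localValues α (edgesIn G (gball G 1 v)) := fun v => by
    obtain ⟨e, he, -⟩ := exists_mem_edgesIn_gball hd hG le_rfl v
    exact one_mem_localValues hα he
  choose a f ha haS hf hf1 hval using hmem
  have hF : ∑ _v : Fin n, Real.exp (-(u * (1:ℝ) ^ (-α))) = Real.exp (Real.log n - u) := by
    rw [Finset.sum_const, Finset.card_univ, Fintype.card_fin, nsmul_eq_mul, Real.one_rpow, mul_one,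
      sub_eq_add_neg, Real.exp_add, Real.exp_log hn0]
  refine ⟨_, measureReal_forall_not_mem_upperBox_le h hα hC₁ hG 1 a ha haS (fun _ => 1)
    (fun _ => le_rfl) hu.le hF, fun w hw l hl => ?_⟩
  simp only [Set.mem_ofPred_eq, not_forall, not_not] at hw
  obtain ⟨v, hv⟩ := hw
  refine le_eigenvalue_of_upperBox hl (gball G 1 v) (a := a v) (f := f v) (s := u ^ (1 / α) / 1)
    (Real.rpow_pos_of_pos hu _) (hf v) (hf1 v) (fun e he => (le_max_right _ _).trans (hv e he)) ?_
  rw [← hval v]; simp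

lemma card_edgesIn_univ_le {d : ℕ} {G : SimpleGraph (Fin n)} (hG : IsRegularGraph G d) :
    (edgesIn G Finset.univ).card ≤ n * d := by
  classical
  have h := card_adj_pairs hG Finset.univ
  rw [Finset.card_univ, Fintype.card_fin] at h
  rw [← h]
  refine Finset.card_le_card_of_injOn (fun e => e.1) ?_ (Subtype.val_injective.injOn)
  intro e he
  simpa using (mem_edgesIn.1 he).2.2

/-- Markov's inequality for the number of heavy edges. -/
lemma measureReal_card_heavyEdges_gt_le {α C₁ C₂ : ℝ} {ν : Measure ℝ} (h : IsWeibull α C₁ C₂ ν)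
    (hα : 0 < α) {d : ℕ} {G : SimpleGraph (Fin n)} (hG : IsRegularGraph G d) {m M : ℝ} (hm : 1 ≤ m)
    (hM : 0 < M) :
    (Measure.pi fun _ : UpperPairs n => ν).real {w | M < ((heavyEdges G w α m).card : ℝ)}
      ≤ n * d * (C₂ * Real.exp (-m)) / M := by
  classical
  have := h.isProbabilityMeasure
  have hC₂ := h.const_nonneg
  set A : UpperPairs n → Set (UpperPairs n → ℝ) := fun e =>
    {w | e ∈ edgesIn G Finset.univ ∧ m ≤ |w e| ^ α} with hA
  have hAm : ∀ e, MeasurableSet (A e) := fun e => by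
    by_cases he : e ∈ edgesIn G Finset.univ
    · simp only [hA, he, true_and]
      exact measurableSet_le measurable_const (by fun_prop)
    · simp [hA, he]
  have h1 := measureReal_card_gt_le (Measure.pi fun _ : UpperPairs n => ν) A hAm hM
  have h2 : ∀ w, heavyEdges G w α m = Finset.univ.filter fun e => w ∈ A e := by
    intro w
    ext e
    simp [hA, mem_heavyEdges, mem_edgesIn]
  replace h1 : (Measure.pi fun _ : UpperPairs n => ν).real {w | M < ((heavyEdges G w α m).card : ℝ)}
      ≤ (∑ e, (Measure.pi fun _ : UpperPairs n => ν).real (A e)) / M := by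
    refine le_trans (le_of_eq ?_) h1
    congr 1
    ext w
    simp only [Set.mem_ofPred_eq, h2 w]
    rw [iff_iff_eq]
    congr!
  have h3 : ∀ e, (Measure.pi fun _ : UpperPairs n => ν).real (A e)
      ≤ if e ∈ edgesIn G Finset.univ then C₂ * Real.exp (-m) else 0 := by
    intro e
    split_ifs with he
    · have h4 : A e ⊆ (fun w : UpperPairs n → ℝ => w e) ⁻¹' {x | m ^ (1 / α) ≤ |x|} := by
        intro w hw
        have h5 : m ≤ |w e| ^ α := hw.2
        simp only [Set.mem_preimage, Set.mem_ofPred_eq]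
        calc m ^ (1 / α) ≤ (|w e| ^ α) ^ (1 / α) :=
              Real.rpow_le_rpow (by linarith) h5 (by positivity)
          _ = _ := by rw [← Real.rpow_mul (abs_nonneg _), mul_one_div_cancel hα.ne', Real.rpow_one]
      have hms : MeasurableSet {x : ℝ | m ^ (1 / α) ≤ |x|} :=
        measurableSet_le measurable_const (by fun_prop)
      have h6 := h.tail_abs (Real.one_le_rpow hm (by positivity : 0 ≤ 1 / α))
      rw [← Real.rpow_mul (by linarith), one_div_mul_cancel hα.ne', Real.rpow_one] at h6
      have h7 := (measure_mono h4).trans_eq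
        ((measurePreserving_eval (fun _ : UpperPairs n => ν) e).measure_preimage
          hms.nullMeasurableSet)
      exact ENNReal.toReal_le_of_le_ofReal (by positivity) (h7.trans h6)
    · have : A e = ∅ := by simp [hA, he]
      rw [this]; simp
  refine h1.trans (div_le_div_of_nonneg_right ((Finset.sum_le_sum fun e _ => h3 e).trans ?_) hM.le)
  rw [← Finset.sum_filter, Finset.sum_const, nsmul_eq_mul]
  refine mul_le_mul_of_nonneg_right ?_ (by positivity)
  have h8 : Finset.univ.filter (fun e => e ∈ edgesIn G Finset.univ) = edgesIn G Finset.univ := by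
    ext; simp
  rw [h8]
  exact_mod_cast card_edgesIn_univ_le hG

/-- The vertices within distance `k` of a cycle of length at most `k`. -/
noncomputable def nearShortCycle (G : SimpleGraph (Fin n)) (k : ℕ) : Finset (Fin n) :=
  open Classical in Finset.univ.filter fun v => ∃ u ∈ gball G k v, u ∈ shortCycleVerts G k

lemma card_nearShortCycle_le {d : ℕ} {G : SimpleGraph (Fin n)} (hG : IsRegularGraph G d) (k : ℕ) :
    (nearShortCycle G k).card ≤ (shortCycleVerts G k).card * (d + 1) ^ k := by
  classical
  have hsub : nearShortCycle G k ⊆ (shortCycleVerts G k).biUnion fun u => gball G k u := by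
    intro v hv
    obtain ⟨u, hu, hu'⟩ := (Finset.mem_filter.1 hv).2
    exact Finset.mem_biUnion.2 ⟨u, hu', mem_gball_comm.1 hu⟩
  exact (Finset.card_le_card hsub).trans
    (Finset.card_biUnion_le_card_mul _ _ _ fun u _ => card_gball_le hG k u)

end EdgeLocalization

section EdgeLocalization

/-- The asymptotic inequalities, in `L = log n`, behind the choice of the parameters. -/
lemma eventually_edge_parameters {α r c c₂ c₃ c₄ κ₀ ρ ε C₂ A₁ d : ℝ} (hα : 0 < α) (hr0 : 0 < r)
    (hc0 : 0 < c) (hc₂0 : 0 < c₂) (hc₃0 : 0 < c₃) (hκ₀0 : 0 < κ₀) (hρ0 : 0 < ρ) (hε : 0 < ε) :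
    ∀ᶠ L : ℝ in Filter.atTop, 2 ≤ L ∧
      (c * L ^ (-(1 / 8 : ℝ)) ≤ 1 / 8 ∧ c * L ^ (-(1 / 8 : ℝ)) ≤ 1 / r ∧
        c * L ^ (-(1 / 8 : ℝ)) ≤ 6 / (α * r) ∧ c * L ^ (-(1 / 8 : ℝ)) ≤ (1 / 2) ^ (1 / α) / c₂ ∧
        c * L ^ (-(1 / 8 : ℝ)) ≤ ρ / (1 + r / 3)) ∧
      (4 * (d + 1)) ≤ 1 * L ^ (1 : ℝ) - (4 * c₄) * L ^ (1 / 4 : ℝ) ∧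
      1 ≤ c₃ * L ^ (3 / 4 : ℝ) ∧
      0 ≤ (r * c / 9 * c₃ / 2) * L ^ (5 / 8 : ℝ) - (2 * c₄ * Real.log (d + 1) + 1) * L ^ (1 / 4 : ℝ) ∧
      (2 * Real.exp 1 * C₂ * (9 / (r * c))) * Real.exp (-((r * c / 9 * c₃ / 2) * L ^ (5 / 8 : ℝ)))
        ≤ 1 * Real.exp (-L ^ (0 : ℝ)) ∧
      A₁ * Real.exp (-((α * r * c / 12) * L ^ (7 / 8 : ℝ))) ≤ (1 / 8) * Real.exp (-L ^ (1 / 2 : ℝ)) ∧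
      (d * C₂) * Real.exp (-((ε / 2) * L ^ (7 / 8 : ℝ))) ≤ (1 / 8) * Real.exp (-L ^ (1 / 2 : ℝ)) ∧
      Real.exp 1 * Real.exp (-((r * c / 9) * L ^ (7 / 8 : ℝ))) ≤ (1 / 8) * Real.exp (-L ^ (1 / 2 : ℝ)) ∧
      0 ≤ (κ₀ / 8) * L ^ (1 : ℝ) - (c₄ * Real.log (4 * d * (d + 1))) * L ^ (1 / 4 : ℝ) ∧
      0 ≤ (κ₀ / 8) * L ^ (1 : ℝ) - 1 * L ^ (1 / 2 : ℝ) ∧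
      (2 * Real.exp 1) * Real.exp (-((κ₀ / 4) * L ^ (1 : ℝ))) ≤ (1 / 8) * Real.exp (-L ^ (1 / 2 : ℝ)) := by
  have hκt : Filter.Tendsto (fun L : ℝ => c * L ^ (-(1 / 8 : ℝ))) Filter.atTop (nhds 0) := by
    simpa using (tendsto_rpow_neg_atTop (by norm_num : (0:ℝ) < 1 / 8)).const_mul c
  have hκe : ∀ x : ℝ, 0 < x → ∀ᶠ L : ℝ in Filter.atTop, c * L ^ (-(1 / 8 : ℝ)) ≤ x :=
    fun x hx => hκt.eventually_le_const hx
  have h34 : Filter.Tendsto (fun L : ℝ => c₃ * L ^ (3 / 4 : ℝ)) Filter.atTop Filter.atTop :=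
    (tendsto_rpow_atTop (by norm_num)).const_mul_atTop hc₃0
  refine (Filter.eventually_ge_atTop 2).and (((hκe _ (by norm_num)).and ((hκe _ (by positivity)).and
    ((hκe _ (by positivity)).and ((hκe _ (by positivity)).and (hκe _ (by positivity)))))).and
    (((tendsto_mul_rpow_sub_rpow one_pos one_pos (by norm_num) _).eventually_ge_atTop _).and
    ((h34.eventually_ge_atTop 1).and
    (((tendsto_mul_rpow_sub_rpow (by positivity) (by norm_num) (by norm_num) _).eventually_ge_atTop
      _).and
    ((eventually_mul_exp_le (by positivity) (by norm_num) (by norm_num) one_pos _).and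
    ((eventually_mul_exp_le (by positivity) (by norm_num) (by norm_num) (by norm_num) _).and
    ((eventually_mul_exp_le (by positivity) (by norm_num) (by norm_num) (by norm_num) _).and
    ((eventually_mul_exp_le (by positivity) (by norm_num) (by norm_num) (by norm_num) _).and
    (((tendsto_mul_rpow_sub_rpow (by positivity) one_pos (by norm_num) _).eventually_ge_atTop _).and
    (((tendsto_mul_rpow_sub_rpow (by positivity) one_pos (by norm_num) _).eventually_ge_atTop _).and
    (eventually_mul_exp_le (by positivity) one_pos (by norm_num) (by norm_num) _)))))))))))

/-- The truncation level is high enough for Chernoff's bound to lose only a constant factor on a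
ball of radius `k`. -/
lemma chernoff_ball_condition {L r c c₃ c₄ C₂ θ κ τα : ℝ} {d k m : ℕ} (hL2 : 2 ≤ L)
    (hr0 : 0 < r) (hc0 : 0 < c) (hC₂ : 0 ≤ C₂) (hκ : κ = c * L ^ (-(1 / 8 : ℝ)))
    (hθ : θ = r * κ / 9) (hm : m ≤ ((d + 1) ^ k) ^ 2)
    (hkc : (k : ℝ) ≤ c₄ * L ^ (1 / 4 : ℝ)) (hτage : c₃ * L ^ (3 / 4 : ℝ) ≤ τα)
    (hch1 : 0 ≤ (r * c / 9 * c₃ / 2) * L ^ (5 / 8 : ℝ)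
      - (2 * c₄ * Real.log (d + 1) + 1) * L ^ (1 / 4 : ℝ))
    (hch2 : (2 * Real.exp 1 * C₂ * (9 / (r * c)))
      * Real.exp (-((r * c / 9 * c₃ / 2) * L ^ (5 / 8 : ℝ))) ≤ 1 * Real.exp (-1)) :
    m * (2 * Real.exp 1 * C₂ / θ * Real.exp (-(θ * τα))) ≤ 1 := by
  have hL0 : 0 < L := by linarith
  have hκ0 : 0 < κ := by rw [hκ]; positivity
  have hθ0 : 0 < θ := by rw [hθ]; positivity
  have hlog1 : 0 ≤ Real.log (d + 1) := Real.log_nonneg (by linarith [d.cast_nonneg (α := ℝ)])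
  have h1 : (m : ℝ)
      ≤ Real.exp (2 * c₄ * Real.log (d + 1) * L ^ (1 / 4 : ℝ)) := by
    have h2 : (m : ℝ) ≤ (((d + 1) ^ k) ^ 2 : ℕ) := by
      exact_mod_cast hm
    refine h2.trans ?_
    push_cast
    have h3 : ((d : ℝ) + 1) = Real.exp (Real.log (d + 1)) := by rw [Real.exp_log (by positivity)]
    rw [h3, ← Real.exp_nat_mul, ← Real.exp_nat_mul, ← h3]
    refine Real.exp_le_exp.2 ?_
    have := mul_le_mul_of_nonneg_right hkc hlog1
    push_cast
    linarith
  have h2 : 2 * Real.exp 1 * C₂ / θ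
      ≤ (2 * Real.exp 1 * C₂ * (9 / (r * c))) * Real.exp (L ^ (1 / 4 : ℝ)) := by
    have h3 : 1 / θ = 9 / (r * c) * L ^ (1 / 8 : ℝ) := by
      rw [hθ, hκ, Real.rpow_neg hL0.le]
      field_simp
    have h4 : L ^ (1 / 8 : ℝ) ≤ Real.exp (L ^ (1 / 4 : ℝ)) := by
      have h5 : L ^ (1 / 8 : ℝ) ≤ L ^ (1 / 4 : ℝ) :=
        Real.rpow_le_rpow_of_exponent_le (by linarith) (by norm_num)
      linarith [Real.add_one_le_exp (L ^ (1 / 4 : ℝ))]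
    calc 2 * Real.exp 1 * C₂ / θ = 2 * Real.exp 1 * C₂ * (1 / θ) := by ring
      _ = (2 * Real.exp 1 * C₂ * (9 / (r * c))) * L ^ (1 / 8 : ℝ) := by rw [h3]; ring
      _ ≤ _ := mul_le_mul_of_nonneg_left h4 (by positivity)
  have h3 : Real.exp (-(θ * τα)) ≤ Real.exp (-(r * c / 9 * c₃ * L ^ (5 / 8 : ℝ))) := by
    refine Real.exp_le_exp.2 (neg_le_neg ?_)
    calc r * c / 9 * c₃ * L ^ (5 / 8 : ℝ) = θ * (c₃ * L ^ (3 / 4 : ℝ)) := by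
          have : L ^ (5 / 8 : ℝ) = L ^ (-(1 / 8 : ℝ)) * L ^ (3 / 4 : ℝ) := by
            rw [← Real.rpow_add hL0]; norm_num
          rw [this, hθ, hκ]; ring
      _ ≤ _ := mul_le_mul_of_nonneg_left hτage hθ0.le
  calc (m : ℝ) * _ ≤ Real.exp (2 * c₄ * Real.log (d + 1) * L ^ (1 / 4 : ℝ)) *
        ((2 * Real.exp 1 * C₂ * (9 / (r * c))) * Real.exp (L ^ (1 / 4 : ℝ))
          * Real.exp (-(r * c / 9 * c₃ * L ^ (5 / 8 : ℝ)))) := by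
        refine mul_le_mul h1 (mul_le_mul h2 h3 (Real.exp_pos _).le (by positivity))
          (by positivity) (Real.exp_pos _).le
    _ = (2 * Real.exp 1 * C₂ * (9 / (r * c))) *
        Real.exp (2 * c₄ * Real.log (d + 1) * L ^ (1 / 4 : ℝ) + L ^ (1 / 4 : ℝ)
          + -(r * c / 9 * c₃ * L ^ (5 / 8 : ℝ))) := by
        rw [Real.exp_add, Real.exp_add]; ring
    _ ≤ (2 * Real.exp 1 * C₂ * (9 / (r * c))) *
        Real.exp (-((r * c / 9 * c₃ / 2) * L ^ (5 / 8 : ℝ))) := by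
        refine mul_le_mul_of_nonneg_left (Real.exp_le_exp.2 ?_) (by positivity)
        linarith
    _ ≤ 1 * Real.exp (-1) := hch2
    _ ≤ 1 := by rw [one_mul]; exact Real.exp_le_one_iff.2 (by norm_num)

/-- A graph with few short cycles has few vertices near a short cycle. -/
lemma card_nearShortCycle_le_exp {n d k : ℕ} {G : SimpleGraph (Fin n)} (hG : IsRegularGraph G d)
    (hd1 : (1:ℝ) ≤ d) {M L c₄ : ℝ} (hkc : (k : ℝ) ≤ c₄ * L ^ (1 / 4 : ℝ))
    (hM : M = 2 * (k * (2 * d : ℝ) ^ k) * Real.exp (L ^ (1 / 2 : ℝ)))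
    (hGM : ((shortCycleVerts G k).card : ℝ) ≤ M) :
    ((nearShortCycle G k).card : ℝ)
      ≤ 2 * Real.exp (c₄ * Real.log (4 * d * (d + 1)) * L ^ (1 / 4 : ℝ) + L ^ (1 / 2 : ℝ)) := by
  have hd0 : (0:ℝ) < d := by linarith
  have h2 : ((nearShortCycle G k).card : ℝ) ≤ M * ((d:ℝ) + 1) ^ k := by
    have h3 : ((nearShortCycle G k).card : ℝ) ≤ (shortCycleVerts G k).card * ((d:ℝ) + 1) ^ k := by
      exact_mod_cast card_nearShortCycle_le hG k
    exact h3.trans (mul_le_mul_of_nonneg_right hGM (by positivity))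
  have h4 : (k : ℝ) ≤ 2 ^ k := by exact_mod_cast Nat.lt_two_pow_self.le
  have h5 : (1:ℝ) ≤ 4 * d * (d + 1) := by nlinarith
  have h6 : ((4:ℝ) * d * (d + 1)) ^ k
      ≤ Real.exp (c₄ * Real.log (4 * d * (d + 1)) * L ^ (1 / 4 : ℝ)) := by
    have h7 : ((4:ℝ) * d * (d + 1)) ^ k = Real.exp (k * Real.log (4 * d * (d + 1))) := by
      rw [Real.exp_nat_mul, Real.exp_log (by positivity)]
    rw [h7]
    refine Real.exp_le_exp.2 ?_
    have := mul_le_mul_of_nonneg_right hkc (Real.log_nonneg h5)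
    linarith
  calc _ ≤ M * ((d:ℝ) + 1) ^ k := h2
    _ = 2 * k * ((2 * d : ℝ) * (d + 1)) ^ k * Real.exp (L ^ (1 / 2 : ℝ)) := by
        rw [hM, mul_pow ((2:ℝ) * d)]; ring
    _ ≤ 2 * 2 ^ k * ((2 * d : ℝ) * (d + 1)) ^ k * Real.exp (L ^ (1 / 2 : ℝ)) := by gcongr
    _ = 2 * ((4:ℝ) * d * (d + 1)) ^ k * Real.exp (L ^ (1 / 2 : ℝ)) := by
        rw [mul_assoc 2 ((2:ℝ) ^ k), ← mul_pow]; congr 3; ring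
    _ ≤ 2 * Real.exp (c₄ * Real.log (4 * d * (d + 1)) * L ^ (1 / 4 : ℝ))
        * Real.exp (L ^ (1 / 2 : ℝ)) := by gcongr
    _ = _ := by rw [Real.exp_add]; ring

set_option maxHeartbeats 1000000 in
/-- If `α < 2`, then on a regular graph with few vertices on short cycles the top eigenvector is
with high probability carried by few disjoint edges. The bound on `M` makes that assumption likely
for a random regular graph. -/
theorem exists_localized_on_edges {α : ℝ} (hα : 0 < α) (hα2 : α < 2) {d : ℕ} (hd : 1 ≤ d)
    {C₁ C₂ ε : ℝ} (hC₁ : 0 < C₁) (hε : 0 < ε) (hε1 : ε ≤ 1) :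
    ∃ N : ℕ, ∀ n : ℕ, N ≤ n → ∃ (k : ℕ) (M : ℝ), 0 < M ∧ 4 * (d + 1) + 4 * k ≤ n ∧
      k * (2 * d : ℝ) ^ k / M ≤ (1 / 2) * Real.exp (-(Real.log n) ^ (1 / 2 : ℝ)) ∧
      ∀ ν : Measure ℝ, IsWeibull α C₁ C₂ ν → ∀ G : SimpleGraph (Fin n), IsRegularGraph G d →
        ((shortCycleVerts G k).card : ℝ) ≤ M → ∃ Bad : Set (UpperPairs n → ℝ),
        (Measure.pi fun _ : UpperPairs n => ν).real Bad
          ≤ (1 / 2) * Real.exp (-(Real.log n) ^ (1 / 2 : ℝ)) ∧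
        ∀ w, w ∉ Bad → ∀ f : Fin n → ℝ, IsTopEigenvector (Matrix.of (wmat G w)) f →
          ∃ J : Finset (Sym2 (Fin n)), IsVertexDisjointEdges G J ∧
            (J.card : ℝ) ≤ Real.exp (ε * (Real.log n) ^ (7 / 8 : ℝ)) ∧
            IsLocalizedOn ε f (edgeVertices J) := by
  classical
  have hd0 : (0:ℝ) < d := by exact_mod_cast hd
  have hd1 : (1:ℝ) ≤ d := by exact_mod_cast hd
  -- The constants. The relative precision is `κ = c (log n) ^ (-1 / 8)` and the truncation level is
  -- `τ = c₂ κ (log n) ^ (1 / α)`; `c₂` makes `d τ` small against the spectral gap, `ρ` bounds the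
  -- mass off a heavy edge, and `κ₀ log n` is the mass allowed near short cycles.
  obtain ⟨r, hr⟩ : ∃ r : ℝ, r = (2 - α) / α := ⟨_, rfl⟩
  have hr0 : 0 < r := by rw [hr]; exact div_pos (by linarith) hα
  obtain ⟨δ, hδ⟩ : ∃ δ : ℝ, δ = ε / 2 := ⟨_, rfl⟩
  have hδ0 : 0 < δ := by rw [hδ]; positivity
  obtain ⟨c, hc⟩ : ∃ c : ℝ, c = ε / 2 := ⟨_, rfl⟩
  have hc0 : 0 < c := by rw [hc]; positivity
  obtain ⟨c₂, hc₂⟩ : ∃ c₂ : ℝ, c₂ = δ * r * (1 / 2) ^ (1 / α) / (12 * d) := ⟨_, rfl⟩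
  have hc₂0 : 0 < c₂ := by rw [hc₂]; positivity
  obtain ⟨c₃, hc₃⟩ : ∃ c₃ : ℝ, c₃ = (c₂ * c) ^ α := ⟨_, rfl⟩
  have hc₃0 : 0 < c₃ := by rw [hc₃]; positivity
  obtain ⟨c₄, hc₄⟩ : ∃ c₄ : ℝ, c₄ = 3 / c₃ + 1 := ⟨_, rfl⟩
  have hc₄0 : 0 < c₄ := by rw [hc₄]; positivity
  obtain ⟨κ₀, hκ₀⟩ : ∃ κ₀ : ℝ, κ₀ = 1 / 2 * (1 / 8) ^ (α / 2) := ⟨_, rfl⟩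
  have hκ₀0 : 0 < κ₀ := by rw [hκ₀]; positivity
  obtain ⟨ρ, hρ⟩ : ∃ ρ : ℝ, ρ = (δ / 2 * (1 / 2) ^ (1 / α) / Real.sqrt 2) ^ α := ⟨_, rfl⟩
  have hρ0 : 0 < ρ := by rw [hρ]; positivity
  obtain ⟨A₁, hA₁⟩ : ∃ A₁ : ℝ, A₁ = ((d + 1) ^ (1 + 1) : ℕ)
    / (min 1 (C₁ / 2 * Real.exp (-1))) ^ (((d + 1) ^ 1) ^ 2) := ⟨_, rfl⟩
  have hlog1 : 0 ≤ Real.log (d + 1) := Real.log_nonneg (by linarith)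
  obtain ⟨N, hN1, hN⟩ := exists_forall_log_of_eventually
    (eventually_edge_parameters (c₄ := c₄) (C₂ := C₂) (A₁ := A₁) (d := d) hα hr0 hc0 hc₂0 hc₃0 hκ₀0 hρ0 hε)
  refine ⟨N, fun n hn => ?_⟩
  obtain ⟨hL2, ⟨hκ8, hκr, hκα, hκc, hκρ⟩, hnk, hτ34, hch1, hch2, hp1, hp2, hp3, hq1, hq2, hp4⟩ :=
    hN n hn
  have hn1 : 1 ≤ n := hN1.trans hn
  have hn0 : (0:ℝ) < n := by exact_mod_cast hn1
  obtain ⟨L, hL⟩ : ∃ L : ℝ, L = Real.log n := ⟨_, rfl⟩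
  rw [← hL] at hL2 hκ8 hκr hκα hκc hκρ hnk hτ34 hch1 hch2 hp1 hp2 hp3 hq1 hq2 hp4 ⊢
  have hexpL : Real.exp L = n := by rw [hL, Real.exp_log hn0]
  simp only [Real.rpow_one, Real.rpow_zero] at hnk hch2 hq1 hq2 hp4
  have hL0 : 0 < L := by linarith
  obtain ⟨κ, hκ⟩ : ∃ κ : ℝ, κ = c * L ^ (-(1 / 8 : ℝ)) := ⟨_, rfl⟩
  rw [← hκ] at hκ8 hκr hκα hκc hκρ
  have hκ0 : 0 < κ := by rw [hκ]; positivity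
  have hκL : κ * L = c * L ^ (7 / 8 : ℝ) := by
    rw [hκ, mul_assoc, ← Real.rpow_add_one hL0.ne']; norm_num
  have hrκ : r * κ ≤ 1 := by rw [le_div_iff₀ hr0] at hκr; linarith
  have hrκ0 : 0 < r * κ := mul_pos hr0 hκ0
  have hαrκ : α * r * κ / 12 ≤ 1 / 2 := by
    rw [le_div_iff₀ (by positivity)] at hκα; linarith
  have hg : r * κ / 12 ≤ 1 / 2 := by linarith
  obtain ⟨θ, hθ⟩ : ∃ θ : ℝ, θ = r * κ / 9 := ⟨_, rfl⟩
  have hθ0 : 0 < θ := by rw [hθ]; positivity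
  have hθ1 : θ ≤ 1 / 2 := by rw [hθ]; linarith
  obtain ⟨τ, hτ⟩ : ∃ τ : ℝ, τ = c₂ * κ * L ^ (1 / α) := ⟨_, rfl⟩
  have hτ0 : 0 < τ := by rw [hτ]; positivity
  have hτα : τ ^ α = (c₂ * κ) ^ α * L := by
    rw [hτ, Real.mul_rpow (by positivity) (by positivity), ← Real.rpow_mul hL0.le,
      one_div_mul_cancel hα.ne', Real.rpow_one]
  have hτage : c₃ * L ^ (3 / 4 : ℝ) ≤ τ ^ α := by
    have h1 : (c₂ * κ) ^ α * L = c₃ * L ^ (1 - α / 8) := by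
      rw [hκ, ← mul_assoc, Real.mul_rpow (by positivity) (by positivity), ← hc₃,
        ← Real.rpow_mul hL0.le, mul_assoc, ← Real.rpow_add_one hL0.ne']
      congr 2; ring
    rw [hτα, h1]
    exact mul_le_mul_of_nonneg_left
      (Real.rpow_le_rpow_of_exponent_le (by linarith) (by linarith)) hc₃0.le
  have hτ1 : 1 ≤ τ := by
    by_contra hlt
    push Not at hlt
    have := Real.rpow_lt_one hτ0.le hlt hα
    linarith
  have hτm : τ ^ α ≤ (1 - κ) * L := by
    have h1 : (c₂ * κ) ^ α ≤ 1 / 2 := by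
      calc (c₂ * κ) ^ α ≤ ((1 / 2) ^ (1 / α)) ^ α := by
            refine Real.rpow_le_rpow (by positivity) ?_ hα.le
            rw [le_div_iff₀ hc₂0] at hκc; linarith
        _ = 1 / 2 := by
            rw [← Real.rpow_mul (by norm_num), one_div_mul_cancel hα.ne', Real.rpow_one]
    rw [hτα]
    exact mul_le_mul_of_nonneg_right (by linarith) hL0.le
  have hτα0 : 0 < τ ^ α := Real.rpow_pos_of_pos hτ0 _
  -- The radius `k` is such that a path of `k` large weights has mass at least `3 L`.
  obtain ⟨k, hk⟩ : ∃ k : ℕ, k = ⌈3 * L / τ ^ α⌉₊ := ⟨_, rfl⟩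
  have hk1 : 1 ≤ k := by
    rw [hk]; exact Nat.one_le_ceil_iff.2 (by positivity)
  have hk3 : 3 * L ≤ k * τ ^ α := by
    have := Nat.le_ceil (3 * L / τ ^ α)
    rw [← hk, div_le_iff₀ hτα0] at this
    exact this
  have hL14 : 1 ≤ L ^ (1 / 4 : ℝ) := Real.one_le_rpow (by linarith) (by norm_num)
  have hkc : (k : ℝ) ≤ c₄ * L ^ (1 / 4 : ℝ) := by
    have h1 : (k : ℝ) < 3 * L / τ ^ α + 1 := by
      rw [hk]; exact Nat.ceil_lt_add_one (by positivity)
    have h2 : 3 * L / τ ^ α ≤ 3 / c₃ * L ^ (1 / 4 : ℝ) := by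
      rw [div_le_iff₀ hτα0]
      calc 3 * L = 3 / c₃ * L ^ (1 / 4 : ℝ) * (c₃ * L ^ (3 / 4 : ℝ)) := by
            have : L = L ^ (1 / 4 : ℝ) * L ^ (3 / 4 : ℝ) := by
              rw [← Real.rpow_add hL0]; norm_num
            field_simp
            nth_rewrite 1 [this]
            ring
        _ ≤ _ := mul_le_mul_of_nonneg_left hτage (by positivity)
    rw [hc₄, add_mul, one_mul]; linarith
  have hk0 : (0:ℝ) < k := by exact_mod_cast hk1
  obtain ⟨M, hM⟩ : ∃ M : ℝ, M = 2 * (k * (2 * d : ℝ) ^ k) * Real.exp (L ^ (1 / 2 : ℝ)) := ⟨_, rfl⟩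
  have hM0 : 0 < M := by rw [hM]; positivity
  refine ⟨k, M, hM0, ?_, ?_, fun ν hν G hG hGM => ?_⟩
  · have h1 : L ≤ n := by rw [← hexpL]; linarith [Real.add_one_le_exp L]
    have h2 : ((4 * (d + 1) + 4 * k : ℕ) : ℝ) ≤ n := by
      push_cast; linarith
    exact_mod_cast h2
  · rw [hM, Real.exp_neg]
    apply le_of_eq
    field_simp
  have := hν.isProbabilityMeasure
  have hC₂ := hν.const_nonneg
  obtain ⟨μ, hμ⟩ : ∃ μ : Measure (UpperPairs n → ℝ), μ = Measure.pi fun _ : UpperPairs n => ν :=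
    ⟨_, rfl⟩
  rw [← hμ]
  have hμp : IsProbabilityMeasure μ := by rw [hμ]; infer_instance
  -- `T v` is the mass of the large weights in the ball of radius `k` around `v`.
  obtain ⟨T, hT⟩ : ∃ T : Fin n → (UpperPairs n → ℝ) → ℝ,
    T = fun v w => ∑ e ∈ edgesIn G (gball G k v), |trunc τ (w e)| ^ α := ⟨_, rfl⟩
  have hcher : ∀ v z, μ.real {w | z ≤ T v w} ≤ Real.exp 1 * Real.exp (-((1 - θ) * z)) := by
    intro v z
    rw [hμ, hT]
    refine hν.measure_sum_trunc_ge_le hα hθ0 (by linarith) hτ1 (edgesIn G (gball G k v)) ?_ z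
    exact chernoff_ball_condition hL2 hr0 hc0 hC₂ hκ hθ
      ((card_edgesIn_le _ _).trans (Nat.pow_le_pow_left (card_gball_le hG k v) 2)) hkc hτage hch1 hch2
  have hu0 : 0 < (1 - α * r * κ / 12) * L := mul_pos (by linarith) hL0
  -- Outside `N₁`, the top eigenvalue is at least `((1 - α r κ / 12) L) ^ (1 / α)`.
  obtain ⟨N₁, hN₁P, hN₁⟩ := exists_event_le_eigenvalue hν hα hC₁ hd hG hn1 hu0
  rw [← hμ, ← hA₁, ← hL] at hN₁P
  have hm1 : 1 ≤ (1 - κ) * L := by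
    have := mul_le_mul_of_nonneg_right (show 7 / 8 ≤ 1 - κ by linarith) hL0.le
    linarith
  have hP1 : μ.real N₁ ≤ (1 / 8) * Real.exp (-L ^ (1 / 2 : ℝ)) := by
    refine hN₁P.trans (le_trans (le_of_eq ?_) hp1)
    congr 3
    have : L - (1 - α * r * κ / 12) * L = α * r / 12 * (κ * L) := by ring
    rw [this, hκL]; ring
  -- There are too many heavy edges.
  obtain ⟨N₂, hN₂⟩ : ∃ N₂ : Set (UpperPairs n → ℝ), N₂ = {w | Real.exp (ε * L ^ (7 / 8 : ℝ))
    < ((heavyEdges G w α ((1 - κ) * L)).card : ℝ)} := ⟨_, rfl⟩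
  have hP2 : μ.real N₂ ≤ (1 / 8) * Real.exp (-L ^ (1 / 2 : ℝ)) := by
    rw [hN₂, hμ]
    refine (measureReal_card_heavyEdges_gt_le hν hα hG hm1 (Real.exp_pos _)).trans
      (le_trans (le_of_eq ?_) hp2)
    rw [div_eq_mul_inv, ← Real.exp_neg, ← hexpL]
    have : Real.exp L * d * (C₂ * Real.exp (-((1 - κ) * L))) * Real.exp (-(ε * L ^ (7 / 8 : ℝ)))
        = d * C₂ * Real.exp (L + -((1 - κ) * L) + -(ε * L ^ (7 / 8 : ℝ))) := by
      rw [Real.exp_add, Real.exp_add]; ring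
    rw [this]
    congr 2
    have h2 : L + -((1 - κ) * L) = κ * L := by ring
    rw [h2, hκL, hc]; ring
  -- Some neighbourhood has more mass than a component can have.
  obtain ⟨N₃, hN₃⟩ : ∃ N₃ : Set (UpperPairs n → ℝ),
    N₃ = ⋃ v, {w | (1 + r * κ / 3) * L ≤ T v w} := ⟨_, rfl⟩
  have hP3 : μ.real N₃ ≤ (1 / 8) * Real.exp (-L ^ (1 / 2 : ℝ)) := by
    refine le_trans ?_ hp3
    rw [hN₃]
    refine (measureReal_iUnion_fintype_le _).trans ((Finset.sum_le_sum fun v _ => hcher v _).trans ?_)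
    rw [Finset.sum_const, Finset.card_univ, Fintype.card_fin, nsmul_eq_mul, ← hexpL, mul_left_comm,
      ← Real.exp_add]
    refine mul_le_mul_of_nonneg_left (Real.exp_le_exp.2 ?_) (Real.exp_pos _).le
    have h1 : 1 + r * κ / 9 ≤ (1 - θ) * (1 + r * κ / 3) := by 
      have := mul_le_mul_of_nonneg_left hrκ hrκ0.le
      rw [hθ]; linarith
    have h2 := mul_le_mul_of_nonneg_right h1 hL0.le
    have h3 : r * κ / 9 * L = r * c / 9 * L ^ (7 / 8 : ℝ) := by
      have : r * κ / 9 * L = r / 9 * (κ * L) := by ring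
      rw [this, hκL]; ring
    linarith
  -- Some neighbourhood near a short cycle has mass `κ₀ L`.
  obtain ⟨N₄, hN₄⟩ : ∃ N₄ : Set (UpperPairs n → ℝ),
    N₄ = ⋃ v ∈ nearShortCycle G k, {w | κ₀ * L ≤ T v w} := ⟨_, rfl⟩
  have hP4 : μ.real N₄ ≤ (1 / 8) * Real.exp (-L ^ (1 / 2 : ℝ)) := by
    refine le_trans ?_ hp4
    rw [hN₄]
    refine (measureReal_biUnion_finset_le _ _).trans
      ((Finset.sum_le_sum fun v _ => hcher v _).trans ?_)
    rw [Finset.sum_const, nsmul_eq_mul]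
    have h1 := card_nearShortCycle_le_exp hG hd1 hkc hM hGM
    calc _ ≤ 2 * Real.exp (c₄ * Real.log (4 * d * (d + 1)) * L ^ (1 / 4 : ℝ) + L ^ (1 / 2 : ℝ))
          * (Real.exp 1 * Real.exp (-((1 - θ) * (κ₀ * L)))) :=
          mul_le_mul_of_nonneg_right h1 (by positivity)
      _ = 2 * Real.exp 1 * Real.exp (c₄ * Real.log (4 * d * (d + 1)) * L ^ (1 / 4 : ℝ)
            + L ^ (1 / 2 : ℝ) + -((1 - θ) * (κ₀ * L))) := by
          rw [Real.exp_add _ (-((1 - θ) * (κ₀ * L)))]; ring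
      _ ≤ _ := by
          refine mul_le_mul_of_nonneg_left (Real.exp_le_exp.2 ?_) (by positivity)
          have := mul_le_mul_of_nonneg_right (show 1 / 2 ≤ 1 - θ by linarith)
            (mul_pos hκ₀0 hL0).le
          linarith
  refine ⟨N₁ ∪ N₂ ∪ (N₃ ∪ N₄), ?_, fun w hw f hf => ?_⟩
  · have h1 := measureReal_union_le (μ := μ) (N₁ ∪ N₂) (N₃ ∪ N₄)
    have h2 := measureReal_union_le (μ := μ) N₁ N₂
    have h3 := measureReal_union_le (μ := μ) N₃ N₄
    linarith
  simp only [Set.mem_union, not_or] at hw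
  obtain ⟨⟨hw1, hw2⟩, hw3, hw4⟩ := hw
  obtain ⟨l, hfl, hl⟩ := hf.exists_eigenvalue (by ext i j; exact wmat_comm G w j i)
  have htl := hN₁ w hw1 l hl
  obtain ⟨t, ht⟩ : ∃ t : ℝ, t = ((1 - α * r * κ / 12) * L) ^ (1 / α) := ⟨_, rfl⟩
  rw [← ht] at htl
  have ht0 : 0 < t := by rw [ht]; exact Real.rpow_pos_of_pos hu0 _
  have hTb : ∀ v, T v w ≤ (1 + r * κ / 3) * L := by
    intro v
    by_contra hle
    push Not at hle
    exact hw3 (hN₃ ▸ Set.mem_iUnion.2 ⟨v, hle.le⟩)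
  have hTc : ∀ v, (∃ u ∈ gball G k v, u ∈ shortCycleVerts G k) →
      T v w ≤ 1 / 2 * (1 / 8) ^ (α / 2) * L := by
    intro v hv
    by_contra hle
    push Not at hle
    refine hw4 (hN₄ ▸ Set.mem_iUnion₂.2 ⟨v, ?_, ?_⟩)
    · simpa [nearShortCycle] using hv
    · rw [hκ₀]; exact hle.le
  have hτt : d * τ ≤ δ * (r * κ / 12 * t) := by
    have h1 : (d:ℝ) * τ = δ * (r * κ / 12 * (L ^ (1 / α) * (1 / 2) ^ (1 / α))) := by
      rw [hτ, hc₂]; field_simp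
    rw [h1, ht]
    have := half_rpow_le hα hL0 hαrκ
    gcongr
  have hbm : (1 + r * κ / 3) * L < 2 * ((1 - κ) * L) := by
    rw [← mul_assoc]
    exact mul_lt_mul_of_pos_right (by linarith) hL0
  have hbk : (1 + r * κ / 3) * L < k * τ ^ α :=
    (mul_lt_mul_of_pos_right (show 1 + r * κ / 3 < 3 by linarith) hL0).trans_le hk3
  subst hT
  have hmain := l2norm_restr_compl_heavyEdges_le hα hα2.le hG (w := w) (τ := τ) (t := t) (l := l)
    (m := (1 - κ) * L) (b := (1 + r * κ / 3) * L) (b₀ := 1 / 2 * (1 / 8) ^ (α / 2) * L)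
    (β := (1 - r * κ / 12) * t) (δ := δ) (k := k) hτ0 hτm hδ0.le ht0
    (mul_lt_of_lt_one_left ht0 (by linarith)) hfl htl
    (fun v => (hTb v).trans_lt hbk) hTb hTc
    (by rw [ht]; exact sqrt_tree_le hα hr hr0 hL0 hκ0 (by linarith) hg hαrκ)
    (by rw [ht]; exact sqrt_cycle_le hα hL0 hg hαrκ)
    (by linarith)
    (by
      have h1 : (1 + r * κ / 3) * L - (1 - κ) * L = (κ * (1 + r / 3)) * L := by ring
      rw [h1]
      have h2 := sqrt_rest_le hα hL0 hδ0 hαrκ hρ (y := κ * (1 + r / 3)) (by positivity)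
        (by rwa [le_div_iff₀ (by positivity)] at hκρ)
      rw [← ht] at h2
      have h3 : δ * (r * κ / 12 * t) ≤ δ * (1 / 2 * t) := by gcongr
      linarith)
  have hdisj := isVertexDisjointEdges_heavyEdges hα hk1 hτm hbm hTb
  refine ⟨_, hdisj, ?_, isLocalizedOn_of_compl _ ?_⟩
  · rw [hN₂] at hw2
    simp only [Set.mem_ofPred_eq, not_lt] at hw2
    refine le_trans ?_ hw2
    exact_mod_cast Finset.card_image_le
  · refine hmain.trans (mul_le_mul_of_nonneg_right ?_ (sq_nonneg _))
    have := mul_le_mul_of_nonneg_left hε1 hε.le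
    rw [hδ]; linarith

end EdgeLocalization

/-! ### From fixed graphs to random graphs -/

section RandomGraph

variable {n : ℕ}

instance : MeasurableSingletonClass (SimpleGraph (Fin n)) where
  measurableSet_singleton G := by
    have h : ({G} : Set (SimpleGraph (Fin n))) = SimpleGraph.edgeSet ⁻¹' {G.edgeSet} := by
      ext H; simp
    rw [h]
    exact SimpleGraph.measurable_edgeSet (measurableSet_singleton _)

lemma coe_regularContaining_empty (n d : ℕ) :
    (↑(regularContaining n d ∅) : Set (SimpleGraph (Fin n))) = regularGraphs n d := by
  ext G
  simp [mem_regularContaining, isRegularGraph_of_mem]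

lemma uniformOn_regularGraphs_real (d : ℕ) (B : SimpleGraph (Fin n) → Prop) [DecidablePred B] :
    (uniformOn (regularGraphs n d)).real {G | B G}
      = ((regularContaining n d ∅).filter B).card / (regularContaining n d ∅).card := by
  classical
  have h1 : {G : SimpleGraph (Fin n) | B G} = ↑(Finset.univ.filter B) := by ext; simp
  have h2 : regularContaining n d ∅ ∩ Finset.univ.filter B
      = (regularContaining n d ∅).filter B := by ext; simp
  rw [h1, ← coe_regularContaining_empty, measureReal_def, uniformOn_apply_finset, h2]
  simp [ENNReal.toReal_div]

lemma uniformOn_not_regular (n d : ℕ) :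
    (uniformOn (regularGraphs n d)).real {G | ¬ IsRegularGraph G d} = 0 := by
  classical
  rw [uniformOn_regularGraphs_real, Finset.filter_eq_empty_iff.2, Finset.card_empty]
  · simp
  · intro G hG
    simpa using (mem_regularContaining.1 hG).1

lemma uniformOn_many_shortCycleVerts {d : ℕ} (hd : 1 ≤ d) {k : ℕ} (hn : 4 * (d + 1) + 4 * k ≤ n)
    {M : ℝ} (hM : 0 < M) :
    (uniformOn (regularGraphs n d)).real
      {G | ¬ (IsRegularGraph G d ∧ ((shortCycleVerts G k).card : ℝ) ≤ M)}
      ≤ k * (2 * d : ℝ) ^ k / M := by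
  classical
  have h := card_filter_shortCycleVerts_mul_le hd k hn M
  rw [uniformOn_regularGraphs_real]
  rcases Nat.eq_zero_or_pos (regularContaining n d ∅).card with h0 | h0
  · rw [h0]; simp only [Nat.cast_zero, div_zero]; positivity
  have h0' : (0:ℝ) < (regularContaining n d ∅).card := by exact_mod_cast h0
  rw [div_le_div_iff₀ h0' hM]
  refine le_trans (le_of_eq ?_) h
  congr 3
  refine Finset.filter_congr fun G hG => ?_
  simp [(mem_regularContaining.1 hG).1]

/-- If, for every `G` outside a set of graphs of small probability, the weights lie outside `Bad G`
with high probability, then so they do for a random graph independent of the weights. Since `A` and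
`W` are only almost everywhere measurable and `Bad G` is arbitrary, the event is found as the
complement of a measurable hull. -/
lemma exists_event_of_forall_graph {Ω : Type*} [MeasurableSpace Ω] {P : Measure Ω}
    [IsProbabilityMeasure P] {d : ℕ} {ν : Measure ℝ} [IsProbabilityMeasure ν]
    {A : Ω → SimpleGraph (Fin n)} {W : Ω → Matrix (Fin n) (Fin n) ℝ}
    (h : IsWeightedRandomRegularGraph P d ν A W) {Good : SimpleGraph (Fin n) → Prop}
    {Bad : SimpleGraph (Fin n) → Set (UpperPairs n → ℝ)} {b p : ℝ}
    (hb : (uniformOn (regularGraphs n d)).real {G | ¬ Good G} ≤ b)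
    (hp : ∀ G, Good G → (Measure.pi fun _ : UpperPairs n => ν).real (Bad G) ≤ p) (hp0 : 0 ≤ p) :
    ∃ E : Set Ω, MeasurableSet E ∧ 1 - (b + p) ≤ P.real E ∧
      ∀ ω ∈ E, Good (A ω) ∧ (fun e : UpperPairs n => W ω e.1.1 e.1.2) ∉ Bad (A ω) := by
  classical
  set V : Ω → UpperPairs n → ℝ := fun ω e => W ω e.1.1 e.1.2 with hV
  have hVlaw : HasLaw V (Measure.pi fun _ : UpperPairs n => ν) P :=
    iIndepFun.hasLaw_pi h.weights_law h.weights_indep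
  have hAprob : IsProbabilityMeasure (uniformOn (regularGraphs n d)) :=
    h.graph_law.isProbabilityMeasure_iff.1 inferInstance
  have hmeas : ∀ B : Set (SimpleGraph (Fin n)), MeasurableSet B := fun B => B.toFinite.measurableSet
  have hA : ∀ B : Set (SimpleGraph (Fin n)),
      P.real (A ⁻¹' B) = (uniformOn (regularGraphs n d)).real B := fun B => by
    rw [← h.graph_law.map_eq, map_measureReal_apply_of_aemeasurable h.graph_law.aemeasurable (hmeas B)]
  set F : Set Ω := {ω | ¬ (Good (A ω) ∧ V ω ∉ Bad (A ω))} with hF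
  have hFsub : F ⊆ A ⁻¹' {G | ¬ Good G} ∪ ⋃ G ∈ Finset.univ.filter Good,
      A ⁻¹' {G} ∩ V ⁻¹' (toMeasurable (Measure.pi fun _ : UpperPairs n => ν) (Bad G)) := by
    intro ω hω
    by_cases hg : Good (A ω)
    · refine Or.inr (Set.mem_iUnion₂.2 ⟨A ω, by simpa using hg, rfl, subset_toMeasurable _ _ ?_⟩)
      by_contra hn
      exact hω ⟨hg, hn⟩
    · exact Or.inl hg
  have hterm : ∀ G ∈ Finset.univ.filter Good,
      P.real (A ⁻¹' {G} ∩ V ⁻¹' (toMeasurable (Measure.pi fun _ : UpperPairs n => ν) (Bad G)))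
        ≤ (uniformOn (regularGraphs n d)).real {G} * p := by
    intro G hG
    have hm := measurableSet_toMeasurable (Measure.pi fun _ : UpperPairs n => ν) (Bad G)
    rw [measureReal_def, h.graph_weights_indep.measure_inter_preimage_eq_mul _ _ (hmeas _) hm,
      ENNReal.toReal_mul, ← measureReal_def, ← measureReal_def, hA]
    refine mul_le_mul_of_nonneg_left ?_ measureReal_nonneg
    rw [← map_measureReal_apply_of_aemeasurable hVlaw.aemeasurable hm, hVlaw.map_eq, measureReal_def,
      measure_toMeasurable, ← measureReal_def]
    exact hp G (by simpa using hG)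
  have hsum : ∑ G ∈ Finset.univ.filter Good, (uniformOn (regularGraphs n d)).real {G} ≤ 1 := by
    rw [sum_measureReal_singleton]
    exact measureReal_le_one
  have hFle : P.real F ≤ b + p := by
    refine (measureReal_mono hFsub).trans ((measureReal_union_le _ _).trans (add_le_add ?_ ?_))
    · rw [hA]; exact hb
    · refine (measureReal_biUnion_finset_le _ _).trans ((Finset.sum_le_sum hterm).trans ?_)
      rw [← Finset.sum_mul]
      exact mul_le_of_le_one_left hp0 hsum
  refine ⟨(toMeasurable P F)ᶜ, (measurableSet_toMeasurable _ _).compl, ?_, fun ω hω => ?_⟩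
  · rw [probReal_compl_eq_one_sub (measurableSet_toMeasurable _ _), measureReal_def,
      measure_toMeasurable, ← measureReal_def]
    linarith
  · by_contra hn
    exact hω (subset_toMeasurable _ _ hn)

lemma IsLocalizedOn.mono {ε ε' : ℝ} (hε : ε ≤ ε') {f : Fin n → ℝ} {I : Finset (Fin n)}
    (h : IsLocalizedOn ε f I) : IsLocalizedOn ε' f I :=
  (mul_le_mul_of_nonneg_right (by linarith) (Real.sqrt_nonneg _)).trans h

end RandomGraph

theorem theorem2 (α : ℝ) (hα : 0 < α) :
    (∀ d : ℕ, 3 ≤ d → ∀ C₁ C₂ : ℝ, 0 < C₁ → 0 < C₂ → ∀ ε : ℝ, 0 < ε →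
      ∃ N : ℕ, ∀ n : ℕ, N ≤ n →
      ∀ (Ω : Type*) [MeasurableSpace Ω] (P : Measure Ω) [IsProbabilityMeasure P] (ν : Measure ℝ)
        (A : Ω → SimpleGraph (Fin n)) (W : Ω → Matrix (Fin n) (Fin n) ℝ),
        IsWeibull α C₁ C₂ ν → IsWeightedRandomRegularGraph P d ν A W →
        ∃ E : Set Ω, MeasurableSet E ∧
          1 - Real.exp (-(Real.log n) ^ (1 / 2 : ℝ)) ≤ P.real E ∧
          ∀ ω ∈ E, ∀ f : Fin n → ℝ, IsTopEigenvector (weightedAdjMatrix (A ω) (W ω)) f →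
            ∃ I : Finset (Fin n), (I.card : ℝ) ≤ (n : ℝ) ^ ε ∧ IsLocalizedOn ε f I) ∧
    (α < 2 → ∃ ζ : ℝ, 0 < ζ ∧ ζ < 1 ∧
      ∀ d : ℕ, 3 ≤ d → ∀ C₁ C₂ : ℝ, 0 < C₁ → 0 < C₂ → ∀ ε : ℝ, 0 < ε →
      ∃ N : ℕ, ∀ n : ℕ, N ≤ n →
      ∀ (Ω : Type*) [MeasurableSpace Ω] (P : Measure Ω) [IsProbabilityMeasure P] (ν : Measure ℝ)
        (A : Ω → SimpleGraph (Fin n)) (W : Ω → Matrix (Fin n) (Fin n) ℝ),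
        IsWeibull α C₁ C₂ ν → IsWeightedRandomRegularGraph P d ν A W →
        ∃ E : Set Ω, MeasurableSet E ∧
          1 - Real.exp (-(Real.log n) ^ (1 / 2 : ℝ)) ≤ P.real E ∧
          ∀ ω ∈ E, ∀ f : Fin n → ℝ, IsTopEigenvector (weightedAdjMatrix (A ω) (W ω)) f →
            ∃ J : Finset (Sym2 (Fin n)), IsVertexDisjointEdges (A ω) J ∧
              (J.card : ℝ) ≤ Real.exp (ε * (Real.log n) ^ ζ) ∧
              IsLocalizedOn ε f (edgeVertices J)) := by
  constructor
  · intro d hd C₁ C₂ hC₁ _ ε hε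
    obtain ⟨N, hN⟩ := exists_localized_of_regular hα (by omega : 1 ≤ d) (C₂ := C₂) hC₁
      (lt_min hε one_pos) (min_le_right ε 1)
    refine ⟨max N 1, fun n hn Ω _ P _ ν A W hν h => ?_⟩
    have := hν.isProbabilityMeasure
    have hn1 : (1:ℝ) ≤ n := by exact_mod_cast (le_max_right N 1).trans hn
    choose! Bad hBad hloc using hN n ((le_max_left N 1).trans hn) ν hν
    obtain ⟨E, hE, hEP, hEω⟩ := exists_event_of_forall_graph h
      (uniformOn_not_regular n d).le hBad (Real.exp_pos _).le
    rw [zero_add] at hEP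
    refine ⟨E, hE, hEP, fun ω hω f hf => ?_⟩
    obtain ⟨hreg, hw⟩ := hEω ω hω
    rw [weightedAdjMatrix_eq_wmat _ (h.weights_symm ω)] at hf
    obtain ⟨I, hI, hIf⟩ := hloc _ hreg _ hw f hf
    exact ⟨I, hI.trans (Real.rpow_le_rpow_of_exponent_le hn1 (min_le_left _ _)),
      hIf.mono (min_le_left _ _)⟩
  · intro hα2
    refine ⟨7 / 8, by norm_num, by norm_num, fun d hd C₁ C₂ hC₁ _ ε hε => ?_⟩
    have hd1 : 1 ≤ d := by omega
    obtain ⟨N, hN⟩ := exists_localized_on_edges hα hα2 hd1 (C₂ := C₂) hC₁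
      (lt_min hε one_pos) (min_le_right ε 1)
    refine ⟨N, fun n hn Ω _ P _ ν A W hν h => ?_⟩
    have := hν.isProbabilityMeasure
    obtain ⟨k, M, hM, hnk, hkM, hN⟩ := hN n hn
    have hBadG : ∀ G : SimpleGraph (Fin n),
        (IsRegularGraph G d ∧ ((shortCycleVerts G k).card : ℝ) ≤ M) → _ :=
      fun G hG => hN ν hν G hG.1 hG.2
    choose! Bad hBad hloc using hBadG
    obtain ⟨E, hE, hEP, hEω⟩ := exists_event_of_forall_graph h
      ((uniformOn_many_shortCycleVerts hd1 hnk hM).trans hkM) hBad (by positivity)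
    refine ⟨E, hE, by linarith, fun ω hω f hf => ?_⟩
    obtain ⟨hgood, hw⟩ := hEω ω hω
    rw [weightedAdjMatrix_eq_wmat _ (h.weights_symm ω)] at hf
    obtain ⟨J, hJ, hJc, hJf⟩ := hloc _ hgood _ hw f hf
    refine ⟨J, hJ, hJc.trans (Real.exp_le_exp.2 ?_), hJf.mono (min_le_left _ _)⟩
    exact mul_le_mul_of_nonneg_right (min_le_left _ _)
      (Real.rpow_nonneg (Real.log_natCast_nonneg n) _)
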